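/- Let $M$ be an oriented smooth manifold of dimension $n\ge 2$. Consider a diffeomorphism-invariant theory of a Lorentzian metric $g_{ab}$, an independent torsion-free connection $\Gamma^a{}_{bc}$ with covariant derivative $\nabla$, and further tensor (density) fields $\Psi$ (matter fields and Lagrange multipliers). Its Lagrangian is $\mathbf L=\varepsilon\,\mathcal L$, where $\varepsilon$ is the totally antisymmetric symbol and the density $\mathcal L$ (of weight $-1$, like $\sqrt{-g}$) is a smooth function, the same in all oriented frames and without background fields, of $g_{ab}$ and of finitely many symmetrized derivatives $\nabla_{(a_1}\cdots\nabla_{a_i)}$ of the curvature $R^a{}_{bcd}$ of $\Gamma$, of the non-metricity $Q_{abc}=\nabla_a g_{bc}$, and of $\Psi$. Put $$E_{R\,a}{}^{bcd}=\frac{\partial\mathcal L}{\partial R^a{}_{bcd}}-\nabla_{a_1}\frac{\partial\mathcal L}{\partial\nabla_{a_1}R^a{}_{bcd}}+\dots+(-1)^m\nabla_{(a_1}\cdots\nabla_{a_m)}\frac{\partial\mathcal L}{\partial\nabla_{(a_1}\cdots\nabla_{a_m)}R^a{}_{bcd}},$$ where the partial derivatives are taken with the symmetries of the curvature of a torsion-free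 connection, let $E_R^{abcd}=g^{ae}E_{R\,e}{}^{bcd}$, and define $E_Q^{abc}$ in the same way from $Q_{abc}$. Let $\mathbf\Theta(\phi,\delta\phi)$ be the boundary term obtained from $\delta\mathcal L$ by successive integrations by parts: $\mathbf\Theta_{a_2\dots a_n}=\varepsilon_{da_2\dots a_n}\Theta^d$ with $$\Theta^d=2E_{R\,a}{}^{cdb}\,\delta\Gamma^a{}_{bc}+E_Q^{dab}\,\delta g_{ab}+\sum_{T\in\{R,Q,\Psi\}}\ \sum_{i\ge0}U_T^{\,d a_1\dots a_i}\cdot\delta(\nabla_{a_1}\cdots\nabla_{a_i}T),$$ $$U_T^{\,a_1\dots a_i}=\sum_{r\ge0}(-1)^r\nabla_{c_1}\cdots\nabla_{c_r}\frac{\partial\mathcal L}{\partial\nabla_{(c_1}\cdots\nabla_{c_r}\nabla_{a_1}\cdots\nabla_{a_i)}T}.$$ Let $\phi=(g,\Gamma,\Psi)$ satisfy the equations of motion. For a smooth vector field $V$ let $\mathbf J[V]=\mathbf\Theta(\phi,\mathcal L_V\phi)-i_V\mathbf L$ be the Noether current. A Noether charge is an assignment $V\mapsto\mathbf Q_N[V]$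 of $(n-2)$-forms to all smooth vector fields which is linear, local (the value of $\mathbf Q_N[V]$ on an open set depends only on $V$ there), and satisfies $\mathrm d\mathbf Q_N[V]=\mathbf J[V]$ for all $V$. Let $V$ be a Killing field of $g$ with a bifurcate Killing horizon: two null hypersurfaces $\mathcal H_A,\mathcal H_B$, to which $V$ is normal and on which it is nonzero away from their intersection, meet transversally in a compact oriented $(n-2)$-surface $\Sigma$ on which $V$ vanishes. Let the constant $\kappa\ne0$ be the surface gravity, $V^b\mathcal D_bV^a=\kappa V^a$ on $\mathcal H_A$, with $\mathcal D$ the Levi-Civita derivative of $g$. Let $\mathbf b_{cd}=k_cl_d-l_ck_d$ be the binormal of $\Sigma$, where $k,l$ are null vectors at $\Sigma$ normal to $\mathcal H_A$, $\mathcal H_B$ respectively with $k_al^a=-1$. Then for every Noether charge $\mathbf Q_N$ the entropy $S$, defined by $$\int_\Sigma\mathbf Q_N[V]=\frac{\kappa}{2\pi}\,S,$$ is given by $$S=2\pi\int_\Sigma\mathbf X^{cd}\,\mathbf b_{cd},\qquad (\mathbf X^{cd})_{a_3\dots a_n}=\varepsilon_{aba_3\dots a_n}E_R^{dcab}.$$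 -/

import Mathlib

open scoped ContDiff Manifold Topology

noncomputable section

namespace Palatini

/-! ## Index notation on coordinate domains

All tensor calculus is done in components, with summation over repeated indices written out. -/

/-- Coordinate space. -/
abbrev Coord (n : ℕ) : Type := Fin n → ℝ

/-- Lists of `k` tensor indices. -/
abbrev Idx (n k : ℕ) : Type := Fin k → Fin n

/-- The type of a tensor density: the number of its indices, which of them are upper indices,
and its weight.  In this convention a Lagrangian density and `√-g` have weight `-1`. -/
structure TensorType where
  rank : ℕ
  up : Fin rank → Bool
  weight : ℤ

/-- Vector fields. -/
abbrev vectorType : TensorType := ⟨1, fun _ => true, 0⟩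

/-- Covariant tensors with `p` indices. -/
abbrev covariantType (p : ℕ) : TensorType := ⟨p, fun _ => false, 0⟩

/-- The type of `R^a_{bcd}`. -/
abbrev curvatureType : TensorType := ⟨4, ![true, false, false, false], 0⟩

/-- The change of the components of a tensor density, whose indices are labelled by `κ`, under a
change of frame with matrix `A = ∂x'/∂x`. -/
def transformArr {n : ℕ} {κ : Type} [Fintype κ] [DecidableEq κ]
    (A : Matrix (Fin n) (Fin n) ℝ) (up : κ → Bool) (w : ℤ)
    (T : (κ → Fin n) → ℝ) (I : κ → Fin n) : ℝ :=
  A.det ^ w * ∑ I' : κ → Fin n,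
    (∏ k, if up k = true then A (I k) (I' k) else A⁻¹ (I' k) (I k)) * T I'

/-- The coordinate derivative `∂_c f`. -/
def pd {n : ℕ} (f : Coord n → ℝ) (c : Fin n) (x : Coord n) : ℝ :=
  fderiv ℝ f x (Pi.single c 1)

/-- The totally antisymmetric symbol, `ε_{0 1 … n-1} = 1`. -/
def eps {n : ℕ} (a : Idx n n) : ℝ :=
  Matrix.det (Matrix.of fun i j : Fin n => if a i = j then (1 : ℝ) else 0)

/-- Connection coefficients: `Γ x a b c` is `Γ^a_{bc}(x)`. -/
abbrev ConnCoeff (n : ℕ) : Type := Coord n → Fin n → Fin n → Fin n → ℝ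

/-- The covariant derivative `∇_c T` of a tensor density of weight `w`, where
`∇_b V^a = ∂_b V^a + Γ^a_{bc} V^c`, `∇_b V_a = ∂_b V_a - Γ^c_{ba} V_c`, and densities carry the
additional term `w Γ^d_{dc} T`. -/
def covD {n : ℕ} {κ : Type} [Fintype κ] [DecidableEq κ] (Γ : ConnCoeff n)
    (up : κ → Bool) (w : ℤ) (T : Coord n → (κ → Fin n) → ℝ)
    (x : Coord n) (c : Fin n) (I : κ → Fin n) : ℝ :=
  pd (fun y => T y I) c x
    + ∑ k, ∑ d, (if up k = true then Γ x (I k) c d * T x (Function.update I k d)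
        else -(Γ x d c (I k) * T x (Function.update I k d)))
    + (w : ℝ) * (∑ d, Γ x d d c) * T x I

/-- The iterated covariant derivative: `nablaIter Γ τ T i x a I` is
`∇_{a 0} ∇_{a 1} ⋯ ∇_{a (i-1)} T_I` at `x`. -/
def nablaIter {n : ℕ} (Γ : ConnCoeff n) (τ : TensorType) (T : Coord n → Idx n τ.rank → ℝ) :
    (i : ℕ) → Coord n → Idx n i → Idx n τ.rank → ℝ
  | 0 => fun x _ I => T x I
  | i + 1 => fun x a I =>
      covD Γ (Sum.elim (fun _ : Fin i => false) τ.up) τ.weight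
        (fun y J => nablaIter Γ τ T i y (J ∘ Sum.inl) (J ∘ Sum.inr))
        x (a 0) (Sum.elim (Fin.tail a) I)

/-- Symmetrization in a group of indices, normalized as a projection. -/
def symmetrize {n i : ℕ} {X : Type} (T : Idx n i → X → ℝ) (a : Idx n i) (I : X) : ℝ :=
  ((Nat.factorial i : ℕ) : ℝ)⁻¹ * ∑ p : Equiv.Perm (Fin i), T (a ∘ p) I

/-- The curvature `R^a_{bcd}` of a connection. -/
def curvature {n : ℕ} (Γ : ConnCoeff n) (x : Coord n) (I : Idx n 4) : ℝ :=
  pd (fun y => Γ y (I 0) (I 3) (I 1)) (I 2) x - pd (fun y => Γ y (I 0) (I 2) (I 1)) (I 3) x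
    + ∑ e, (Γ x (I 0) (I 2) e * Γ x e (I 3) (I 1) - Γ x (I 0) (I 3) e * Γ x e (I 2) (I 1))

/-- The non-metricity `Q_{abc} = ∇_a g_{bc}`. -/
def nonmetricity {n : ℕ} (g : Coord n → Idx n 2 → ℝ) (Γ : ConnCoeff n)
    (x : Coord n) (I : Idx n 3) : ℝ :=
  covD Γ (fun _ : Fin 2 => false) 0 g x (I 0) ![I 1, I 2]

/-- The matrix of a metric. -/
def gramMatrix {n : ℕ} (g : Idx n 2 → ℝ) : Matrix (Fin n) (Fin n) ℝ :=
  Matrix.of fun a b => g ![a, b]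

/-- The Christoffel symbols of a metric. -/
def leviCivita {n : ℕ} (g : Coord n → Idx n 2 → ℝ) : ConnCoeff n := fun x a b c =>
  (1 / 2) * ∑ d, (gramMatrix (g x))⁻¹ a d *
    (pd (fun y => g y ![d, c]) b x + pd (fun y => g y ![b, d]) c x - pd (fun y => g y ![b, c]) d x)

/-- The Lie derivative of a tensor density along the vector field with components `V`. -/
def lieTensor {n : ℕ} (V : Coord n → Fin n → ℝ) (τ : TensorType)
    (T : Coord n → Idx n τ.rank → ℝ) (x : Coord n) (I : Idx n τ.rank) : ℝ :=
  ∑ d, V x d * pd (fun y => T y I) d x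
    + ∑ k, ∑ d, (if τ.up k = true
        then -(pd (fun y => V y (I k)) d x * T x (Function.update I k d))
        else pd (fun y => V y d) (I k) x * T x (Function.update I k d))
    - (τ.weight : ℝ) * (∑ d, pd (fun y => V y d) d x) * T x I

/-- The Lie derivative of a connection. -/
def lieConn {n : ℕ} (V : Coord n → Fin n → ℝ) (Γ : ConnCoeff n) : ConnCoeff n :=
  fun x a b c =>
    ∑ d, (V x d * pd (fun y => Γ y a b c) d x - Γ x d b c * pd (fun y => V y a) d x
      + Γ x a d c * pd (fun y => V y d) b x + Γ x a b d * pd (fun y => V y d) c x)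
    + pd (pd (fun y => V y a) c) b x

/-- The exterior derivative of a `p`-form, in components. -/
def extD {n p : ℕ} (α : Coord n → Idx n p → ℝ) (x : Coord n) (A : Idx n (p + 1)) : ℝ :=
  ∑ i : Fin (p + 1), (-1 : ℝ) ^ (i : ℕ) * pd (fun y => α y (A ∘ i.succAbove)) (A i) x

/-! ## Lagrangians -/

/-- The space of values of the variables
`(g_{ab}; ∇_{(a_1}⋯∇_{a_i)} R^a_{bcd}, i ≤ kR; ∇_{(a_1}⋯∇_{a_i)} Q_{abc}, i ≤ kQ;
∇_{(a_1}⋯∇_{a_i)} Ψ_j, i ≤ kM j)`. -/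
abbrev JetSpace (n kR kQ N : ℕ) (typ : Fin N → TensorType) (kM : Fin N → ℕ) : Type :=
  (Idx n 2 → ℝ) × ((i : Fin (kR + 1)) → Idx n i → Idx n 4 → ℝ) ×
    ((i : Fin (kQ + 1)) → Idx n i → Idx n 3 → ℝ) ×
      ((j : Fin N) → (i : Fin (kM j + 1)) → Idx n i → Idx n (typ j).rank → ℝ)

/-- Change of frame for an `i`-th covariant derivative of a tensor density of type `τ`. -/
def transformBlock {n i : ℕ} (A : Matrix (Fin n) (Fin n) ℝ) (τ : TensorType)
    (T : Idx n i → Idx n τ.rank → ℝ) (a : Idx n i) (I : Idx n τ.rank) : ℝ :=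
  transformArr A (Sum.elim (fun _ : Fin i => false) τ.up) τ.weight
    (fun J => T (J ∘ Sum.inl) (J ∘ Sum.inr)) (Sum.elim a I)

/-- Change of frame on the space of all variables of the Lagrangian. -/
def transformJet {n kR kQ N : ℕ} {typ : Fin N → TensorType} {kM : Fin N → ℕ}
    (A : Matrix (Fin n) (Fin n) ℝ) (z : JetSpace n kR kQ N typ kM) :
    JetSpace n kR kQ N typ kM :=
  (transformArr A (fun _ : Fin 2 => false) 0 z.1,
    fun i => transformBlock A curvatureType (z.2.1 i),
    fun i => transformBlock A (covariantType 3) (z.2.2.1 i),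
    fun j i => transformBlock A (typ j) (z.2.2.2 j i))

/-- A diffeomorphism-invariant theory of a metric, a torsion-free connection and finitely many
further tensor(-density) fields `Ψ_j` (matter fields and Lagrange multipliers).  Its Lagrangian is
a density of weight `-1` which is a smooth function of the metric and of the symmetrized covariant
derivatives, up to given orders, of the curvature, the non-metricity and the `Ψ_j`, and which
involves no background field: in every oriented frame it is given by the same function.
The function is allowed to be defined only on an open set of values (for instance where `g` is
Lorentzian); it is written as a function of arrays without symmetry constraints, and
only its values on arrays with the symmetries of the actual variables matter. -/
structure Theory (n : ℕ) where
  kR : ℕ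
  kQ : ℕ
  N : ℕ
  typ : Fin N → TensorType
  kM : Fin N → ℕ
  dom : Set (JetSpace n kR kQ N typ kM)
  lag : JetSpace n kR kQ N typ kM → ℝ
  isOpen_dom : IsOpen dom
  smooth : ContDiffOn ℝ ∞ lag dom
  dom_invariant : ∀ A : Matrix (Fin n) (Fin n) ℝ, 0 < A.det → ∀ z ∈ dom, transformJet A z ∈ dom
  density : ∀ A : Matrix (Fin n) (Fin n) ℝ, 0 < A.det → ∀ z ∈ dom,
    lag (transformJet A z) = A.det ^ (-1 : ℤ) * lag z

/-- The fields of a theory, or a variation of them, in one coordinate system. -/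
structure LocalFields {n : ℕ} (L : Theory n) where
  g : Coord n → Idx n 2 → ℝ
  Γ : ConnCoeff n
  Ψ : (j : Fin L.N) → Coord n → Idx n (L.typ j).rank → ℝ

section Local

variable {n : ℕ} {L : Theory n}

/-- The family of fields `φ + t η`. -/
def LocalFields.vary (φ η : LocalFields L) (t : ℝ) : LocalFields L where
  g := fun x I => φ.g x I + t * η.g x I
  Γ := fun x a b c => φ.Γ x a b c + t * η.Γ x a b c
  Ψ := fun j x I => φ.Ψ j x I + t * η.Ψ j x I

/-- The variables of the Lagrangian, evaluated on the fields `φ` at `x`. -/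
def LocalFields.jet (φ : LocalFields L) (x : Coord n) :
    JetSpace n L.kR L.kQ L.N L.typ L.kM :=
  (φ.g x,
    fun i => symmetrize (nablaIter φ.Γ curvatureType (curvature φ.Γ) i x),
    fun i => symmetrize (nablaIter φ.Γ (covariantType 3) (nonmetricity φ.g φ.Γ) i x),
    fun j i => symmetrize (nablaIter φ.Γ (L.typ j) (φ.Ψ j) i x))

/-- The Lagrangian density. -/
def LocalFields.density (φ : LocalFields L) (x : Coord n) : ℝ := L.lag (φ.jet x)

/-- The projection of an array `P_a^{bcd}` onto the arrays with the symmetries of the curvature of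
a torsion-free connection: `P_a^{bcd} = - P_a^{bdc}` and `P_a^{bcd} + P_a^{cdb} + P_a^{dbc} = 0`. -/
def curvatureSym (P : Idx n 4 → ℝ) (I : Idx n 4) : ℝ :=
  let A : Fin n → Fin n → Fin n → Fin n → ℝ := fun a b c d =>
    (1 / 2) * (P ![a, b, c, d] - P ![a, b, d, c])
  A (I 0) (I 1) (I 2) (I 3)
    - (1 / 3) * (A (I 0) (I 1) (I 2) (I 3) + A (I 0) (I 2) (I 3) (I 1) + A (I 0) (I 3) (I 1) (I 2))

/-- `∂ℒ / ∂(∇_{(a_1}⋯∇_{a_m)} R^a_{bcd})`, with the symmetries of the variable by which one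
differentiates; it vanishes for `m > kR`. -/
def momentumR (φ : LocalFields L) (m : ℕ) (x : Coord n) (a : Idx n m) (I : Idx n 4) : ℝ :=
  if h : m < L.kR + 1 then
    symmetrize (fun a' I' => curvatureSym (fun I'' =>
      fderiv ℝ L.lag (φ.jet x) (0, Pi.single ⟨m, h⟩ (Pi.single a' (Pi.single I'' 1)), 0, 0)) I') a I
  else 0

/-- `∂ℒ / ∂(∇_{(a_1}⋯∇_{a_m)} Q_{abc})`. -/
def momentumQ (φ : LocalFields L) (m : ℕ) (x : Coord n) (a : Idx n m) (I : Idx n 3) : ℝ :=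
  if h : m < L.kQ + 1 then
    symmetrize (fun a' I' =>
      fderiv ℝ L.lag (φ.jet x) (0, 0, Pi.single ⟨m, h⟩ (Pi.single a' (Pi.single I' 1)), 0)) a I
  else 0

/-- `∂ℒ / ∂(∇_{(a_1}⋯∇_{a_m)} Ψ_j)`. -/
def momentumM (φ : LocalFields L) (j : Fin L.N) (m : ℕ) (x : Coord n) (a : Idx n m)
    (I : Idx n (L.typ j).rank) : ℝ :=
  if h : m < L.kM j + 1 then
    symmetrize (fun a' I' =>
      fderiv ℝ L.lag (φ.jet x)
        (0, 0, 0, Pi.single j (Pi.single ⟨m, h⟩ (Pi.single a' (Pi.single I' 1))))) a I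
  else 0

/-- The divergence `∇_c P^{c a_1 … a_i}` of a density dual to the `(i+1)`-st derivative of a field
of type `τ`: upper and lower indices of `τ` are interchanged, and the weight is `-1 - w`. -/
def divMomentum (Γ : ConnCoeff n) (τ : TensorType) (i : ℕ)
    (P : Coord n → Idx n (i + 1) → Idx n τ.rank → ℝ) (x : Coord n) (a : Idx n i)
    (I : Idx n τ.rank) : ℝ :=
  ∑ c, covD Γ (Sum.elim (fun _ : Fin (i + 1) => true) (fun k => !(τ.up k))) (-1 - τ.weight)
    (fun y J => P y (J ∘ Sum.inl) (J ∘ Sum.inr)) x c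
    (Sum.elim (Fin.cons c a : Idx n (i + 1)) I)

/-- The alternating sums `P_i - ∇P_{i+1} + ∇∇P_{i+2} - ⋯ ± ∇⋯∇P_{i+r}` that arise by integration
by parts. -/
def reduced (Γ : ConnCoeff n) (τ : TensorType)
    (P : (m : ℕ) → Coord n → Idx n m → Idx n τ.rank → ℝ) :
    (r i : ℕ) → Coord n → Idx n i → Idx n τ.rank → ℝ
  | 0, i => P i
  | r + 1, i => fun x a I => P i x a I - divMomentum Γ τ i (reduced Γ τ P r (i + 1)) x a I

/-- The Euler-Lagrange derivative with respect to the curvature,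
`E_{R a}^{bcd} = ∂ℒ/∂R^a_{bcd} - ∇_{a_1} ∂ℒ/∂(∇_{a_1}R^a_{bcd}) + ⋯
 + (-1)^m ∇_{(a_1}⋯∇_{a_m)} ∂ℒ/∂(∇_{(a_1}⋯∇_{a_m)}R^a_{bcd})`. -/
def eulerR (φ : LocalFields L) (x : Coord n) (I : Idx n 4) : ℝ :=
  reduced φ.Γ curvatureType (momentumR φ) L.kR 0 x ![] I

/-- The Euler-Lagrange derivative `E_Q^{abc}` with respect to the non-metricity. -/
def eulerQ (φ : LocalFields L) (x : Coord n) (I : Idx n 3) : ℝ :=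
  reduced φ.Γ (covariantType 3) (momentumQ φ) L.kQ 0 x ![] I

/-- `E_R^{abcd} = g^{ae} E_{R e}^{bcd}`. -/
def eulerRUp (φ : LocalFields L) (x : Coord n) (a b c d : Fin n) : ℝ :=
  ∑ e, (gramMatrix (φ.g x))⁻¹ a e * eulerR φ x ![e, b, c, d]

/-- The boundary terms `∑_i (reduced momentum)^{c a_1 … a_i} δ(∇_{a_1}⋯∇_{a_i} T)`, `i < K`, left by
the integrations by parts for a tensor field `T` of type `τ`, given `δ(∇_{a_1}⋯∇_{a_i} T)`. -/
def thetaTensor (Γ : ConnCoeff n) (τ : TensorType) (K : ℕ)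
    (P : (m : ℕ) → Coord n → Idx n m → Idx n τ.rank → ℝ)
    (δT : (i : ℕ) → Idx n i → Idx n τ.rank → ℝ) (x : Coord n) (c : Fin n) : ℝ :=
  ∑ i ∈ Finset.range K, ∑ a : Idx n i, ∑ I : Idx n τ.rank,
    reduced Γ τ P (K - (i + 1)) (i + 1) x (Fin.cons c a) I * δT i a I

/-- The boundary term, a vector density of weight `-1`:
`Θ^d = 2 E_{R a}^{cdb} δΓ^a_{bc} + E_Q^{dab} δg_{ab} +` terms in `δ(∇⋯∇R)`, `δ(∇⋯∇Q)`, `δ(∇⋯∇Ψ)`,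
where `δ` is the derivative at `t = 0` along `φ + t η`. -/
def theta (φ η : LocalFields L) (x : Coord n) (d : Fin n) : ℝ :=
  2 * ∑ a, ∑ b, ∑ c, eulerR φ x ![a, c, d, b] * η.Γ x a b c
    + ∑ a, ∑ b, eulerQ φ x ![d, a, b] * η.g x ![a, b]
    + thetaTensor φ.Γ curvatureType L.kR (momentumR φ)
        (fun i a I => deriv (fun t => nablaIter (φ.vary η t).Γ curvatureType
          (curvature (φ.vary η t).Γ) i x a I) 0) x d
    + thetaTensor φ.Γ (covariantType 3) L.kQ (momentumQ φ)
        (fun i a I => deriv (fun t => nablaIter (φ.vary η t).Γ (covariantType 3)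
          (nonmetricity (φ.vary η t).g (φ.vary η t).Γ) i x a I) 0) x d
    + ∑ j, thetaTensor φ.Γ (L.typ j) (L.kM j) (momentumM φ j)
        (fun i a I => deriv (fun t => nablaIter (φ.vary η t).Γ (L.typ j)
          ((φ.vary η t).Ψ j) i x a I) 0) x d

/-- The variation `ℒ_V φ` of all fields. -/
def lieFields (V : Coord n → Fin n → ℝ) (φ : LocalFields L) : LocalFields L where
  g := lieTensor V (covariantType 2) φ.g
  Γ := lieConn V φ.Γ
  Ψ := fun j => lieTensor V (L.typ j) (φ.Ψ j)

/-- The Noether current `J = Θ(φ, ℒ_V φ) - i_V L` as an `(n-1)`-form,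
`J_{a_2 … a_n} = ε_{a a_2 … a_n} (Θ^a - V^a ℒ)`. -/
def noetherCurrent {m : ℕ} {L : Theory (m + 1)} (φ : LocalFields L)
    (V : Coord (m + 1) → Fin (m + 1) → ℝ) (x : Coord (m + 1)) (A : Idx (m + 1) m) : ℝ :=
  ∑ a, eps (Fin.cons a A : Idx (m + 1) (m + 1)) *
    (theta φ (lieFields V φ) x a - V x a * φ.density x)

/-- The `(n-2)`-form `X^{cd} b_{cd}`, where `(X^{cd})_{a_3 … a_n} = ε_{a b a_3 … a_n} E_R^{dcab}`. -/
def entropyForm {m : ℕ} {L : Theory (m + 2)} (φ : LocalFields L)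
    (b : Coord (m + 2) → Fin (m + 2) → Fin (m + 2) → ℝ) (x : Coord (m + 2))
    (A : Idx (m + 2) m) : ℝ :=
  ∑ c, ∑ d, (∑ p, ∑ q, eps (Fin.cons p (Fin.cons q A : Idx (m + 2) (m + 1)) : Idx (m + 2) (m + 2))
    * eulerRUp φ x d c p q) * b x c d

end Local

/-! ## Fields on an oriented manifold -/

section Global

variable (n : ℕ) (M : Type*) [TopologicalSpace M] [ChartedSpace (Coord n) M]

/-- The atlas of `M` is oriented: its transition maps have positive Jacobian determinant. -/
def IsOrientedAtlas : Prop :=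
  ∀ e ∈ atlas (Coord n) M, ∀ e' ∈ atlas (Coord n) M, ∀ x ∈ (e.symm ≫ₕ e').source,
    0 < (fderiv ℝ (e.symm ≫ₕ e') x).det

/-- The smooth charts of `M` that are positively oriented with respect to the given atlas. -/
abbrev OChart : Type _ :=
  {e : OpenPartialHomeomorph M (Coord n) //
    e ∈ IsManifold.maximalAtlas 𝓘(ℝ, Coord n) ∞ M ∧
      ∀ e' ∈ atlas (Coord n) M, ∀ x ∈ (e.symm ≫ₕ e').source,
        0 < (fderiv ℝ (e.symm ≫ₕ e') x).det}

variable {n M}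

/-- The transition map between two charts. -/
def transition (e e' : OChart n M) : OpenPartialHomeomorph (Coord n) (Coord n) :=
  e.1.symm ≫ₕ e'.1

/-- The Jacobian matrix `∂x'^a/∂x^b` of a transition map. -/
def jacobian (e e' : OChart n M) (x : Coord n) : Matrix (Fin n) (Fin n) ℝ :=
  Matrix.of fun a b => pd (fun y => transition e e' y a) b x

variable (n M)

/-- Smooth tensor density fields, given by their components in all oriented charts.  The component
functions matter on the range of the chart only. -/
structure TensorField (τ : TensorType) where
  comp : OChart n M → Coord n → Idx n τ.rank → ℝ
  smooth : ∀ e I, ContDiffOn ℝ ∞ (fun x => comp e x I) e.1.target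
  transform : ∀ e e', ∀ x ∈ (transition e e').source,
    comp e' (transition e e' x) = transformArr (jacobian e e' x) τ.up τ.weight (comp e x)

/-- Smooth vector fields. -/
abbrev VectorField : Type _ := TensorField n M vectorType

/-- Smooth differential `p`-forms. -/
structure DiffForm (p : ℕ) extends TensorField n M (covariantType p) where
  antisymm : ∀ e, ∀ x ∈ e.1.target, ∀ (A : Idx n p) (π : Equiv.Perm (Fin p)),
    comp e x (A ∘ π) = ((Equiv.Perm.sign π : ℤ) : ℝ) * comp e x A

/-- Smooth torsion-free connections. -/
structure Connection where
  comp : OChart n M → ConnCoeff n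
  smooth : ∀ e a b c, ContDiffOn ℝ ∞ (fun x => comp e x a b c) e.1.target
  torsionFree : ∀ e, ∀ x ∈ e.1.target, ∀ a b c, comp e x a b c = comp e x a c b
  transform : ∀ e e', ∀ x ∈ (transition e e').source, ∀ a b c,
    comp e' (transition e e' x) a b c =
      ∑ p, ∑ q, (jacobian e e' x)⁻¹ p b * (jacobian e e' x)⁻¹ q c *
        (∑ d, jacobian e e' x a d * comp e x d p q
          - pd (pd (fun y => transition e e' y a) q) p x)

variable {n M}

/-- The components of a vector field in a chart. -/
def vec (V : VectorField n M) (e : OChart n M) (x : Coord n) (a : Fin n) : ℝ := V.comp e x ![a]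

end Global

section Spacetime

variable (m : ℕ) (M : Type*) [TopologicalSpace M] [ChartedSpace (Coord (m + 2)) M]

/-- Smooth Lorentzian metrics, of signature `(-, +, …, +)`. -/
structure LorentzMetric extends TensorField (m + 2) M (covariantType 2) where
  symm : ∀ e, ∀ x ∈ e.1.target, ∀ a b, comp e x ![a, b] = comp e x ![b, a]
  lorentzian : ∀ e, ∀ x ∈ e.1.target, ∃ B : Matrix (Fin (m + 2)) (Fin (m + 2)) ℝ, IsUnit B.det ∧
    B.transpose * gramMatrix (comp e x) * B = Matrix.diagonal fun i => if i = 0 then -1 else 1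

variable {m}

/-- The field configurations of a theory on `M` at which its Lagrangian is defined. -/
structure Config (L : Theory (m + 2)) where
  g : LorentzMetric m M
  Γ : Connection (m + 2) M
  Ψ : (j : Fin L.N) → TensorField (m + 2) M (L.typ j)
  mem_dom : ∀ e, ∀ x ∈ e.1.target,
    (LocalFields.mk (L := L) (g.comp e) (Γ.comp e) fun j => (Ψ j).comp e).jet x ∈ L.dom

variable {M}

/-- The components of all fields in a chart. -/
def Config.loc {L : Theory (m + 2)} (φ : Config M L) (e : OChart (m + 2) M) : LocalFields L :=
  ⟨φ.g.comp e, φ.Γ.comp e, fun j => (φ.Ψ j).comp e⟩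

/-- The equations of motion: the action is stationary under all smooth variations of the metric,
the torsion-free connection and the further fields with compact support in a chart. -/
def Config.OnShell {L : Theory (m + 2)} (φ : Config M L) : Prop :=
  ∀ (e : OChart (m + 2) M) (η : LocalFields L) (K : Set (Coord (m + 2))),
    IsCompact K → K ⊆ e.1.target →
    (∀ I, ContDiff ℝ ∞ fun x => η.g x I) → (∀ a b c, ContDiff ℝ ∞ fun x => η.Γ x a b c) →
    (∀ j I, ContDiff ℝ ∞ fun x => η.Ψ j x I) →
    (∀ x a b, η.g x ![a, b] = η.g x ![b, a]) → (∀ x a b c, η.Γ x a b c = η.Γ x a c b) →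
    (∀ x ∉ K, η.g x = 0 ∧ η.Γ x = 0 ∧ ∀ j, η.Ψ j x = 0) →
    ∫ x in e.1.target, deriv (fun t => ((φ.loc e).vary η t).density x) 0 = 0

/-- `Q` is a Noether charge of the theory at the fields `φ`: an assignment `V ↦ Q[V]` of an
`(n-2)`-form to every smooth vector field, which is linear and locally determined by `V`, and
satisfies `dQ[V] = J[V]` for all `V`. -/
structure IsNoetherCharge {L : Theory (m + 2)} (φ : Config M L)
    (Q : VectorField (m + 2) M → DiffForm (m + 2) M m) : Prop where
  local_linear : ∀ (e : OChart (m + 2) M) (O : Set (Coord (m + 2))), IsOpen O → O ⊆ e.1.target →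
    ∀ (r s : ℝ) (U V W : VectorField (m + 2) M),
      (∀ x ∈ O, U.comp e x = r • V.comp e x + s • W.comp e x) →
      ∀ x ∈ O, (Q U).comp e x = r • (Q V).comp e x + s • (Q W).comp e x
  potential : ∀ (V : VectorField (m + 2) M) (e : OChart (m + 2) M), ∀ x ∈ e.1.target,
    extD ((Q V).comp e) x = noetherCurrent (φ.loc e) (vec V e) x

/-! ## Bifurcate Killing horizons -/

/-- `f` is a local defining function, with `df ≠ 0`, of the hypersurface `H` near the point with
coordinates `x`. -/
def IsLocalEquation (H : Set M) (e : OChart (m + 2) M) (x : Coord (m + 2))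
    (f : Coord (m + 2) → ℝ) : Prop :=
  ContDiffAt ℝ ∞ f x ∧ fderiv ℝ f x ≠ 0 ∧ ∀ᶠ y in 𝓝 x, (e.1.symm y ∈ H ↔ f y = 0)

/-- Smooth embedded hypersurfaces. -/
def IsHypersurface (H : Set M) : Prop :=
  ∀ (e : OChart (m + 2) M), ∀ x ∈ e.1.target, e.1.symm x ∈ H → ∃ f, IsLocalEquation H e x f

/-- The scalar product `g_{ab} k^a l^b`. -/
def LorentzMetric.dot (g : LorentzMetric m M) (e : OChart (m + 2) M) (x : Coord (m + 2))
    (k l : Fin (m + 2) → ℝ) : ℝ :=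
  ∑ a, ∑ b, g.comp e x ![a, b] * k a * l b

/-- The covector `g_{ab} k^b`. -/
def LorentzMetric.lower (g : LorentzMetric m M) (e : OChart (m + 2) M) (x : Coord (m + 2))
    (k : Fin (m + 2) → ℝ) (a : Fin (m + 2)) : ℝ :=
  ∑ b, g.comp e x ![a, b] * k b

/-- The vector `k` at the point with coordinates `x` is normal to the hypersurface `H`. -/
def IsNormal (g : LorentzMetric m M) (H : Set M) (e : OChart (m + 2) M) (x : Coord (m + 2))
    (k : Fin (m + 2) → ℝ) : Prop :=
  ∃ f, IsLocalEquation H e x f ∧ ∃ c : ℝ, ∀ a, g.lower e x k a = c * pd f a x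

/-- `V` is a Killing field, nonzero on the hypersurface `H` away from `S`, and `H` is a null
hypersurface to which `V` is normal. -/
structure IsKillingHorizon (g : LorentzMetric m M) (V : VectorField (m + 2) M)
    (H S : Set M) : Prop where
  hypersurface : IsHypersurface (m := m) H
  null : ∀ e, ∀ x ∈ e.1.target, e.1.symm x ∈ H → ∀ k, IsNormal g H e x k → g.dot e x k k = 0
  normal : ∀ e, ∀ x ∈ e.1.target, e.1.symm x ∈ H → IsNormal g H e x (vec V e x)
  ne_zero : ∀ e, ∀ x ∈ e.1.target, e.1.symm x ∈ H \ S → vec V e x ≠ 0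

/-- A bifurcate Killing horizon of the Killing field `V`: two null hypersurfaces `HA`, `HB` normal
to `V` that intersect transversally in the compact surface `S`, on which `V` vanishes.  The surface
gravity `κ` is defined by `V^b D_b V^a = κ V^a` on `HA`, where `D` is the Levi-Civita derivative. -/
structure IsBifurcateKillingHorizon (g : LorentzMetric m M) (V : VectorField (m + 2) M)
    (HA HB S : Set M) (κ : ℝ) : Prop where
  killing : ∀ e, ∀ x ∈ e.1.target, lieTensor (vec V e) (covariantType 2) (g.comp e) x = 0
  horizonA : IsKillingHorizon g V HA S
  horizonB : IsKillingHorizon g V HB S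
  inter : HA ∩ HB = S
  compact : IsCompact S
  transversal : ∀ e, ∀ x ∈ e.1.target, e.1.symm x ∈ S →
    ∀ k, IsNormal g HA e x k → IsNormal g HB e x k → k = 0
  vanishes : ∀ e, ∀ x ∈ e.1.target, e.1.symm x ∈ S → vec V e x = 0
  surfaceGravity : ∀ e, ∀ x ∈ e.1.target, e.1.symm x ∈ HA → ∀ a,
    ∑ b, vec V e x b * covD (leviCivita (g.comp e)) vectorType.up 0 (V.comp e) x b ![a]
      = κ * vec V e x a

/-- `b` is the binormal of the bifurcation surface: on `S`, `b_{cd} = k_c l_d - l_c k_d`, where `k`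
and `l` are null normals of `S` with `k_a l^a = -1`, `k` being normal (hence tangent) to the null
hypersurface `HA`, and `l` to `HB`. -/
def IsBinormal (g : LorentzMetric m M) (HA HB S : Set M)
    (b : OChart (m + 2) M → Coord (m + 2) → Fin (m + 2) → Fin (m + 2) → ℝ) : Prop :=
  ∀ e, ∀ x ∈ e.1.target, e.1.symm x ∈ S → ∃ k l : Fin (m + 2) → ℝ,
    IsNormal g HA e x k ∧ IsNormal g HB e x l ∧ g.dot e x k l = -1 ∧
      ∀ c d, b e x c d = g.lower e x k c * g.lower e x l d - g.lower e x l c * g.lower e x k d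

/-! ## Integration over an oriented closed surface of codimension two -/

/-- The point with coordinates `(0, 0, y)`. -/
def slice (y : Coord m) : Coord (m + 2) := Fin.cons 0 (Fin.cons 0 y : Coord (m + 1))

/-- The data by which the integral over an oriented compact embedded surface `S` of codimension two
is computed: finitely many charts of `M` in which `S` is given by `x^0 = x^1 = 0`, signs which say
whether `(x^2, …, x^{n-1})` is a positive coordinate system of `S`, and a partition of unity in a
neighbourhood of `S` by smooth functions compactly supported in the charts. -/
structure OrientedSurface (M : Type*) [TopologicalSpace M] [ChartedSpace (Coord (m + 2)) M]
    (S : Set M) where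
  num : ℕ
  chart : Fin num → OChart (m + 2) M
  chart_slice : ∀ i, ∀ p ∈ (chart i).1.source,
    (p ∈ S ↔ (chart i).1 p 0 = 0 ∧ (chart i).1 p 1 = 0)
  sign : Fin num → ℝ
  sign_eq : ∀ i, sign i = 1 ∨ sign i = -1
  oriented : ∀ i j, ∀ y : Coord m, slice y ∈ (transition (chart i) (chart j)).source →
    0 < sign i * sign j *
      (fderiv ℝ (fun y' k => transition (chart i) (chart j) (slice y') (Fin.succ (Fin.succ k)) :
        Coord m → Coord m) y).det
  weight : Fin num → M → ℝ
  weight_nonneg : ∀ i p, 0 ≤ weight i p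
  weight_smooth : ∀ i, ContMDiff 𝓘(ℝ, Coord (m + 2)) 𝓘(ℝ, ℝ) ∞ (weight i)
  weight_compact : ∀ i, HasCompactSupport (weight i)
  weight_support : ∀ i, tsupport (weight i) ⊆ (chart i).1.source
  weight_sum : ∀ᶠ p in 𝓝ˢ S, ∑ i, weight i p = 1

/-- The integral over `S` of an `(n-2)`-form, given by its components in all charts. -/
def OrientedSurface.integral {S : Set M} (σ : OrientedSurface (m := m) M S)
    (α : OChart (m + 2) M → Coord (m + 2) → Idx (m + 2) m → ℝ) : ℝ :=
  ∑ i, σ.sign i * ∫ y in {y : Coord m | slice y ∈ (σ.chart i).1.target},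
    σ.weight i ((σ.chart i).1.symm (slice y)) *
      α (σ.chart i) (slice y) (fun k => Fin.succ (Fin.succ k))

end Spacetime

end Palatini

end

open Palatini

noncomputable section

namespace Palatini

open MeasureTheory

/-! ## Coordinate derivatives -/

section PartialDerivatives

variable {n : ℕ} {f g : Coord n → ℝ} {x : Coord n} {c : Fin n}

/-! The proof does not classify Noether charges. It uses only that `V ↦ Q[V]` is linear and local
and that `dQ[V] = J[V]`; these fix the integral of `Q[V]` over a surface on which `V` vanishes in
terms of the principal symbol of `J`.

The current is a second order operator in `V`. When the fields vary by `ℒ_V φ`, every `∇⋯∇T` with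
`T` the curvature, the non-metricity or a `Ψ_j` varies by its own Lie derivative (`lie_covD`,
`lie_curvMatrix`, `LieVariation.join`), which is of first order in `V`. Second derivatives of `V`
therefore come only from `δΓ = ℒ_V Γ` in the term `2 E_R δΓ`, so that the principal symbol is `2
E_{R a}^{cdb}` (`noether_secondOrder`).

Let `w` be a vector field compactly supported in a chart in which the surface is `x^0 = x^1 = 0`.
For a function `h` of `x^0` alone put `F h (s) = ∫ Q[h w]` over the slice `x^0 = s, x^1 = 0`. By
Stokes' theorem `(F h)' = h a + h' b + h'' c`, where `a, b, c` are slice integrals built from `w`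
and the coefficients of the operator. Since each `F h` has compact support, `∫ (h a + h' b + h'' c)
= 0` for all smooth `h`, whence `a - b' + c'' = 0` and `F h = h (b - c') + h' c`. For `h = 1` the
slice integral of `Q[w]` is `b - c'` (`primitive_eq_of_forall_primitive`). If `w` vanishes on the
slice at `s = 0`, only the principal symbol survives there (`integral_slice_of_secondOrder`), and
the antisymmetry of `E_R` in its last two indices turns the result into `∫ 2 E_{R a}^{c01} ∂_c w^a`
(`IsNoetherCharge.integral_slice`).

At the bifurcation surface `∂_c V_a = κ b_{ca}` (`killing_gradient`): the gradient is antisymmetric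
by Killing's equation and kills tangent directions, hence is a multiple of the binormal;
differentiating the surface gravity equation along the null generator leaves the multiples `0` and
`κ`, and `0` would put the hypersurface `HA` locally inside a set of codimension two. Substituting
gives `κ` times the entropy form.

The chart results are glued by a partition of unity `χ_j`. Near the surface `V = ∑ χ_j V`, so `Q[V]
= ∑ Q[χ_j V]` by locality, and each summand can be integrated in its own chart
(`IsNoetherCharge.integral_eq_sum`). As `V` vanishes on the surface, a derivative of `χ_j V` there
is `χ_j` times the derivative of `V` (`sliceIntegral_mul`), and the weights are those in the
definition of the surface integral. -/

theorem pd_add (hf : DifferentiableAt ℝ f x) (hg : DifferentiableAt ℝ g x) :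
    pd (fun y => f y + g y) c x = pd f c x + pd g c x := by
  simp [pd, fderiv_fun_add hf hg]

theorem pd_sub (hf : DifferentiableAt ℝ f x) (hg : DifferentiableAt ℝ g x) :
    pd (fun y => f y - g y) c x = pd f c x - pd g c x := by
  simp [pd, fderiv_fun_sub hf hg]

theorem pd_neg : pd (fun y => -f y) c x = -pd f c x := by
  simp [pd]

theorem pd_mul (hf : DifferentiableAt ℝ f x) (hg : DifferentiableAt ℝ g x) :
    pd (fun y => f y * g y) c x = pd f c x * g x + f x * pd g c x := by
  simp [pd, fderiv_fun_mul hf hg]; ring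

theorem pd_const (r : ℝ) : pd (fun _ => r) c x = 0 := by
  simp [pd]

theorem pd_const_mul (r : ℝ) (hf : DifferentiableAt ℝ f x) :
    pd (fun y => r * f y) c x = r * pd f c x := by
  simp [pd, fderiv_const_mul hf]

theorem pd_sum {ι : Type*} (s : Finset ι) {F : ι → Coord n → ℝ}
    (hF : ∀ i ∈ s, DifferentiableAt ℝ (F i) x) :
    pd (fun y => ∑ i ∈ s, F i y) c x = ∑ i ∈ s, pd (F i) c x := by
  simp [pd, fderiv_fun_sum hF]

theorem pd_congr (h : f =ᶠ[𝓝 x] g) : pd f c x = pd g c x := by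
  simp [pd, h.fderiv_eq]

theorem pd_eq_deriv (hf : DifferentiableAt ℝ f x) :
    HasDerivAt (fun t : ℝ => f (x + t • Pi.single c 1)) (pd f c x) 0 := by
  have h1 : HasDerivAt (fun t : ℝ => x + t • (Pi.single c 1 : Coord n)) (Pi.single c 1) 0 := by
    simpa using ((hasDerivAt_id (0 : ℝ)).smul_const (Pi.single c 1 : Coord n)).const_add x
  have h2 : HasFDerivAt f (fderiv ℝ f x) (x + (0 : ℝ) • (Pi.single c 1 : Coord n)) := by
    simpa using hf.hasFDerivAt
  exact h2.comp_hasDerivAt 0 h1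

theorem fderiv_apply_eq_sum_pd (f : Coord n → ℝ) (x v : Coord n) :
    fderiv ℝ f x v = ∑ c, v c * pd f c x := by
  conv_lhs => rw [pi_eq_sum_univ' v]
  simp [pd, map_sum]

theorem pd_coord (d : Fin n) : pd (fun y : Coord n => y d) c x = if d = c then 1 else 0 := by
  have : HasFDerivAt (fun y : Coord n => y d) (ContinuousLinearMap.proj (R := ℝ) d) x :=
    hasFDerivAt_apply d x
  simp [pd, this.fderiv, Pi.single_apply]

theorem contDiff_pd (hf : ContDiff ℝ ∞ f) : ContDiff ℝ ∞ (pd f c) := by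
  unfold pd
  exact (hf.fderiv_right (m := ∞) (by simp)).clm_apply contDiff_const

theorem contDiffOn_pd {T : Set (Coord n)} (hT : IsOpen T) (hf : ContDiffOn ℝ ∞ f T) :
    ContDiffOn ℝ ∞ (pd f c) T := by
  unfold pd
  exact (hf.fderiv_of_isOpen hT (m := ∞) (by simp)).clm_apply contDiffOn_const

theorem pd_pd_comm {d : Fin n} (hf : ContDiffAt ℝ ∞ f x) :
    pd (pd f c) d x = pd (pd f d) c x := by
  have h := hf.isSymmSndFDerivAt (by simpa using WithTop.coe_le_coe.2 (OrderTop.le_top (2 : ℕ∞)))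
  have hd : DifferentiableAt ℝ (fderiv ℝ f) x :=
    (hf.fderiv_right (m := 1) (by norm_cast)).differentiableAt (by norm_num)
  have key : ∀ a b : Fin n, pd (pd f a) b x
      = fderiv ℝ (fderiv ℝ f) x (Pi.single b 1) (Pi.single a 1) := by
    intro a b
    unfold pd
    rw [fderiv_clm_apply hd (differentiableAt_const _)]
    simp
  rw [key, key]
  exact h _ _

theorem hasCompactSupport_pd (hf : HasCompactSupport f) : HasCompactSupport (pd f c) := by
  unfold pd
  exact (hf.fderiv (𝕜 := ℝ)).comp_left (g := fun A : Coord n →L[ℝ] ℝ => A (Pi.single c 1)) (by simp)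

theorem pd_eq_zero_of_notMem_tsupport (hx : x ∉ tsupport f) : pd f c x = 0 := by
  have : f =ᶠ[𝓝 x] fun _ => 0 := notMem_tsupport_iff_eventuallyEq.1 hx
  rw [pd_congr this, pd_const]

end PartialDerivatives

/-! ## Integrals over slices -/

section Slices

variable {m : ℕ}

/-- The point with coordinates `(s, 0, y)`. -/
def line (s : ℝ) (y : Coord m) : Coord (m + 2) := Fin.cons s (Fin.cons 0 y : Coord (m + 1))

theorem line_zero (y : Coord m) : line 0 y = slice y := rfl

theorem line_coord_zero (s : ℝ) (y : Coord m) : line s y 0 = s := rfl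

theorem contDiff_line : ContDiff ℝ ∞ (fun p : ℝ × Coord m => line p.1 p.2) := by
  rw [contDiff_pi]
  intro i
  refine Fin.cases ?_ (fun i => Fin.cases ?_ (fun k => ?_) i) i
  · exact contDiff_fst
  · exact contDiff_const
  · exact (contDiff_apply ℝ ℝ k).comp contDiff_snd

theorem continuous_line (s : ℝ) : Continuous (line s : Coord m → Coord (m + 2)) :=
  (contDiff_line (m := m)).continuous.comp (by fun_prop : Continuous fun y : Coord m => (s, y))

theorem isClosedEmbedding_line (s : ℝ) :
    Topology.IsClosedEmbedding (line s : Coord m → Coord (m + 2)) :=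
  Function.LeftInverse.isClosedEmbedding (f := fun x : Coord (m + 2) => fun k : Fin m => x k.succ.succ)
    (fun _ => rfl) (by fun_prop) (continuous_line s)

theorem line_add_single_zero (s t : ℝ) (y : Coord m) :
    line s y + t • Pi.single 0 1 = line (s + t) y := by
  funext i
  refine Fin.cases ?_ (fun i => Fin.cases ?_ (fun k => ?_) i) i
  · simp [line_coord_zero]
  · simp [line]
  · simp [line]

theorem line_add_single_succ (s t : ℝ) (y : Coord m) (k : Fin m) :
    line s y + t • Pi.single k.succ.succ 1 = line s (y + t • Pi.single k 1) := by
  funext i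
  refine Fin.cases ?_ (fun i => Fin.cases ?_ (fun j => ?_) i) i
  · simp [line]
  · simp [line, Fin.ext_iff]
  · simp [line, Pi.single_apply]

theorem hasCompactSupport_comp_line {g : Coord (m + 2) → ℝ} (hc : HasCompactSupport g) (s : ℝ) :
    HasCompactSupport (fun y : Coord m => g (line s y)) :=
  hc.comp_isClosedEmbedding (isClosedEmbedding_line s)

theorem integrable_comp_line {g : Coord (m + 2) → ℝ} (hg : Continuous g)
    (hc : HasCompactSupport g) (s : ℝ) : Integrable (fun y : Coord m => g (line s y)) :=
  (hg.comp (continuous_line s)).integrable_of_hasCompactSupport (hasCompactSupport_comp_line hc s)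

theorem hasCompactSupport_integral_line {g : Coord (m + 2) → ℝ} (hc : HasCompactSupport g) :
    HasCompactSupport (fun s => ∫ y : Coord m, g (line s y)) := by
  refine HasCompactSupport.intro (K := (fun x : Coord (m + 2) => x 0) '' tsupport g)
    (hc.isCompact.image (by fun_prop)) fun s hs => ?_
  have : ∀ y : Coord m, g (line s y) = 0 := fun y => by
    by_contra h
    exact hs ⟨line s y, subset_tsupport g h, rfl⟩
  simp [this]

theorem hasDerivAt_comp_line {g : Coord (m + 2) → ℝ} (hg : Differentiable ℝ g) (s : ℝ)
    (y : Coord m) : HasDerivAt (fun s => g (line s y)) (pd g 0 (line s y)) s := by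
  have h := pd_eq_deriv (c := 0) (hg (line s y))
  simp only [line_add_single_zero] at h
  have h2 : HasDerivAt (fun t : ℝ => t - s) 1 s := (hasDerivAt_id s).sub_const s
  have h' : HasDerivAt (fun t : ℝ => g (line (s + t) y)) (pd g 0 (line s y)) (s - s) := by
    simpa using h
  simpa [Function.comp_def] using HasDerivAt.comp (h := fun t => t - s) s h' h2

/-- Differentiation under the integral sign: the points `y` over which `∂_0 g` is nonzero for some
`s` form a subset of one compact set `K`, so a constant times the indicator of `K` dominates
uniformly in `s`. -/
theorem hasDerivAt_integral_line {g : Coord (m + 2) → ℝ} (hg : ContDiff ℝ ∞ g)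
    (hc : HasCompactSupport g) (s : ℝ) :
    HasDerivAt (fun s => ∫ y : Coord m, g (line s y)) (∫ y : Coord m, pd g 0 (line s y)) s := by
  have hp : ContDiff ℝ ∞ (pd g 0) := contDiff_pd hg
  have hpc : HasCompactSupport (pd g 0) := hasCompactSupport_pd hc
  obtain ⟨C, hC⟩ := hpc.exists_bound_of_continuous hp.continuous
  set K : Set (Coord m) := (fun x : Coord (m + 2) => fun k : Fin m => x k.succ.succ) '' tsupport (pd g 0)
  have hK : IsCompact K := hpc.isCompact.image (by fun_prop)
  refine (hasDerivAt_integral_of_dominated_loc_of_deriv_le (bound := K.indicator fun _ => C)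
    (F := fun s y => g (line s y)) (F' := fun s y => pd g 0 (line s y))
    (s := Set.univ) Filter.univ_mem ?_ (integrable_comp_line hg.continuous hc s) ?_ ?_ ?_ ?_).2
  · exact Filter.Eventually.of_forall fun s =>
      (hg.continuous.comp (continuous_line s)).aestronglyMeasurable
  · exact (hp.continuous.comp (continuous_line s)).aestronglyMeasurable
  · refine Filter.Eventually.of_forall fun y s _ => ?_
    by_cases hy : y ∈ K
    · simpa [hy] using hC _
    · have : pd g 0 (line s y) = 0 := by
        by_contra h
        exact hy ⟨line s y, subset_tsupport _ h, rfl⟩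
      simp [hy, this]
  · exact (integrable_indicator_iff hK.measurableSet).2
      (integrableOn_const (hK.measure_lt_top.ne))
  · exact Filter.Eventually.of_forall fun y s _ =>
      hasDerivAt_comp_line (hg.differentiable (by simp)) s y

theorem contDiff_integral_line {g : Coord (m + 2) → ℝ} (hg : ContDiff ℝ ∞ g)
    (hc : HasCompactSupport g) : ContDiff ℝ ∞ (fun s => ∫ y : Coord m, g (line s y)) := by
  rw [contDiff_infty]
  intro k
  induction k generalizing g with
  | zero =>
    exact contDiff_zero.2 (continuous_iff_continuousAt.2 fun s =>
      (hasDerivAt_integral_line hg hc s).continuousAt)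
  | succ k ih =>
    have : ((k + 1 : ℕ) : WithTop ℕ∞) = (k : WithTop ℕ∞) + 1 := by push_cast; rfl
    rw [this, contDiff_succ_iff_deriv]
    refine ⟨fun s => (hasDerivAt_integral_line hg hc s).differentiableAt, by simp, ?_⟩
    have h2 : deriv (fun s => ∫ y : Coord m, g (line s y))
        = fun s => ∫ y : Coord m, pd g 0 (line s y) :=
      funext fun s => (hasDerivAt_integral_line hg hc s).deriv
    rw [h2]
    exact ih (contDiff_pd hg) (hasCompactSupport_pd hc)

theorem integral_pd_eq_zero {g : Coord m → ℝ} (hg : ContDiff ℝ ∞ g)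
    (hc : HasCompactSupport g) (k : Fin m) : ∫ y : Coord m, pd g k y = 0 := by
  have h1 : Integrable (pd g k) :=
    (contDiff_pd hg).continuous.integrable_of_hasCompactSupport (hasCompactSupport_pd hc)
  have h2 : Integrable g := hg.continuous.integrable_of_hasCompactSupport hc
  have h := integral_mul_fderiv_eq_neg_fderiv_mul_of_integrable (μ := (volume : Measure (Coord m)))
    (f := fun _ => (1 : ℝ)) (g := g) (v := Pi.single k 1) (by simp)
    (by simp only [one_mul]; exact h1) (by simpa using h2)
    (fun _ _ => differentiableAt_const _) (fun _ _ => (hg.differentiable (by simp)) _)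
  simpa [pd] using h

theorem pd_comp_line {g : Coord (m + 2) → ℝ} {s : ℝ} {y : Coord m}
    (hg : DifferentiableAt ℝ g (line s y)) (k : Fin m) :
    pd (fun y => g (line s y)) k y = pd g k.succ.succ (line s y) := by
  have hl : Differentiable ℝ (line s : Coord m → Coord (m + 2)) :=
    ((contDiff_line (m := m)).differentiable (by simp)).comp
      (by fun_prop : Differentiable ℝ fun y : Coord m => (s, y))
  have h := pd_eq_deriv (c := k) (hg.comp y (hl y))
  have h' := pd_eq_deriv (c := k.succ.succ) hg
  simp only [line_add_single_succ] at h'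
  exact h.unique h'

theorem integral_line_pd_eq_zero {g : Coord (m + 2) → ℝ} (hg : ContDiff ℝ ∞ g)
    (hc : HasCompactSupport g) (s : ℝ) (k : Fin m) :
    ∫ y : Coord m, pd g k.succ.succ (line s y) = 0 := by
  simp only [← pd_comp_line (hg.differentiable (by simp) _)]
  have hl : ContDiff ℝ ∞ (fun y : Coord m => (s, y)) := contDiff_const.prodMk contDiff_id
  exact integral_pd_eq_zero (g := fun y => g (line s y)) (hg.comp (contDiff_line.comp hl))
    (hasCompactSupport_comp_line hc s) k

/-- The indices `(2, …, n - 1)` of the slices. -/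
def sliceIdx (m : ℕ) : Idx (m + 2) m := fun k => k.succ.succ

/-- The indices `(0, 2, …, n - 1)`. -/
def lineIdx (m : ℕ) : Idx (m + 2) (m + 1) := Fin.cons 0 (sliceIdx m)

/-- Stokes' theorem for the slices of a hyperplane. -/
theorem hasDerivAt_integral_form {α : Coord (m + 2) → Idx (m + 2) m → ℝ}
    (hα : ∀ I, ContDiff ℝ ∞ fun x => α x I) (hc : ∀ I, HasCompactSupport fun x => α x I) (s : ℝ) :
    HasDerivAt (fun s => ∫ y : Coord m, α (line s y) (sliceIdx m))
      (∫ y : Coord m, extD α (line s y) (lineIdx m)) s := by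
  convert hasDerivAt_integral_line (hα (sliceIdx m)) (hc _) s using 1
  unfold extD
  rw [integral_finsetSum]
  -- Only `∂_0 α_{2 … n-1}` survives in the component `0 2 … n-1` of `dα`: the other terms are
  -- derivatives along the slice of compactly supported functions.
  · rw [Fin.sum_univ_succ, Finset.sum_eq_zero, add_zero]
    · simp only [Fin.val_zero, pow_zero, one_mul]
      rfl
    · intro k _
      rw [integral_const_mul]
      have : lineIdx m k.succ = k.succ.succ := rfl
      rw [this, integral_line_pd_eq_zero (hα _) (hc _), mul_zero]
  · intro i _
    exact (integrable_comp_line (contDiff_pd (hα _)).continuous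
      (hasCompactSupport_pd (hc _)) s).const_mul _

end Slices

/-! ## Second order operators on the line whose values have primitives with compact support -/

/-- Suppose that for every smooth `h` the function `h a + h' b + h'' c` has a compactly supported
smooth primitive `F h`.  Then the primitive for `h = 1` is `b - c'`. -/
theorem primitive_eq_of_forall_primitive (F : (ℝ → ℝ) → ℝ → ℝ) (a b c : ℝ → ℝ)
    (hF : ∀ h, ContDiff ℝ ∞ h → ContDiff ℝ ∞ (F h) ∧ HasCompactSupport (F h) ∧
      ∀ s, deriv (F h) s = h s * a s + deriv h s * b s + deriv (deriv h) s * c s) (s : ℝ) :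
    F (fun _ => 1) s = b s - deriv c s := by
  have hd : ∀ {f : ℝ → ℝ}, ContDiff ℝ ∞ f → ContDiff ℝ ∞ (deriv f) := fun hf =>
    (contDiff_infty_iff_deriv.1 hf).2
  -- No regularity of `a`, `b`, `c` is assumed. Testing with `h = 1, t, t ^ 2` expresses them
  -- through derivatives of functions `F h`, so they are smooth with compact support.
  have e0 : ∀ s, a s = deriv (F fun _ => 1) s := fun s => by
    rw [(hF (fun _ => 1) contDiff_const).2.2 s]; simp
  have e1 : ∀ s, b s = deriv (F fun t => t) s - s * a s := fun s => by
    rw [(hF (fun t => t) contDiff_id).2.2 s]; simp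
  have d2 : deriv (fun t : ℝ => t ^ 2) = fun t => 2 * t := by funext t; simp
  have e2 : ∀ s, c s = 1 / 2 * (deriv (F fun t => t ^ 2) s - s ^ 2 * a s - 2 * s * b s) := fun s => by
    rw [(hF (fun t => t ^ 2) (contDiff_id.pow 2)).2.2 s, d2]
    have : deriv (fun t : ℝ => 2 * t) s = 2 := by
      simp
    rw [this]; ring
  have ha : ContDiff ℝ ∞ a := by
    rw [funext e0]; exact hd (hF _ contDiff_const).1
  have hb : ContDiff ℝ ∞ b := by
    rw [funext e1]; exact (hd (hF _ contDiff_id).1).sub (contDiff_id.mul ha)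
  have hc : ContDiff ℝ ∞ c := by
    rw [funext e2]
    exact contDiff_const.mul (((hd (hF _ (contDiff_id.pow 2)).1).sub
      ((contDiff_id.pow 2).mul ha)).sub ((contDiff_const.mul contDiff_id).mul hb))
  have sa : HasCompactSupport a := by
    rw [funext e0]; exact (hF _ contDiff_const).2.1.deriv
  have sb : HasCompactSupport b := by
    rw [funext e1]; exact (hF _ contDiff_id).2.1.deriv.sub (sa.mul_left)
  have sc : HasCompactSupport c := by
    rw [funext e2]
    exact ((((hF _ (contDiff_id.pow 2)).2.1.deriv).sub sa.mul_left).sub sb.mul_left).mul_left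
  have D : ∀ {f : ℝ → ℝ}, ContDiff ℝ ∞ f → ∀ s, HasDerivAt f (deriv f s) s := fun hf s =>
    (hf.differentiable (by simp) s).hasDerivAt
  -- The formal adjoint of the operator applied to `1`: `h a + h' b + h'' c` is `h k` plus the
  -- derivative of `h (b - c') + h' c`.
  set k : ℝ → ℝ := fun s => a s - deriv b s + deriv (deriv c) s with hkdef
  have hk : ContDiff ℝ ∞ k := (ha.sub (hd hb)).add (hd (hd hc))
  have sk : HasCompactSupport k := (sa.sub sb.deriv).add sc.deriv.deriv
  have key : ∀ h, ContDiff ℝ ∞ h → ∀ s, HasDerivAt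
      (fun s => F h s - (h s * (b s - deriv c s) + deriv h s * c s)) (h s * k s) s := by
    intro h hh s
    have := (D (hF h hh).1 s).sub (((D hh s).mul ((D hb s).sub (D (hd hc) s))).add
      ((D (hd hh) s).mul (D hc s)))
    refine this.congr_deriv ?_
    rw [(hF h hh).2.2 s, hkdef]
    simp only [Pi.sub_apply]
    ring
  have sG : ∀ h, ContDiff ℝ ∞ h → HasCompactSupport
      (fun s => F h s - (h s * (b s - deriv c s) + deriv h s * c s)) := fun h hh =>
    (hF h hh).2.1.sub (((sb.sub sc.deriv).mul_left).add sc.mul_left)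
  -- The function `h = k` is itself a legitimate test function, and the derivative of a compactly
  -- supported function integrates to zero; thus `∫ k ^ 2 = 0`.
  have hk0 : ∀ s, k s = 0 := by
    have hint : ∫ s, k s * k s = 0 := by
      refine integral_eq_zero_of_hasDerivAt_of_integrable (key k hk) ?_ ?_
      · exact (hk.mul hk).continuous.integrable_of_hasCompactSupport sk.mul_left
      · refine Continuous.integrable_of_hasCompactSupport ?_ (sG k hk)
        exact ((hF k hk).1.sub ((hk.mul (hb.sub (hd hc))).add ((hd hk).mul hc))).continuous
    intro s
    by_contra hs
    have := Continuous.integral_pos_of_hasCompactSupport_nonneg_nonzero (μ := volume)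
      (f := fun s => k s * k s) (x := s)
      (hk.mul hk).continuous sk.mul_left (fun s => mul_self_nonneg _) (by simpa using hs)
    exact this.ne' hint
  have h1 := key (fun _ => 1) contDiff_const
  simp only [hk0, mul_zero] at h1
  set G := fun s => F (fun _ => 1) s - ((1 : ℝ) * (b s - deriv c s) + deriv (fun _ : ℝ => (1 : ℝ)) s * c s)
    with hG
  have hcs : HasCompactSupport G := sG _ contDiff_const
  have hconst : ∀ s t, G s = G t := is_const_of_deriv_eq_zero (fun s => (h1 s).differentiableAt)
    fun s => (h1 s).deriv
  -- The difference `G` is now constant, and having compact support on the noncompact line it must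
  -- vanish somewhere, hence everywhere.
  obtain ⟨t, ht⟩ : ∃ t, G t = 0 := by
    by_contra hne
    push Not at hne
    have : tsupport G = Set.univ := by
      rw [tsupport, show Function.support G = Set.univ from Set.eq_univ_of_forall hne, closure_univ]
    have h3 : IsCompact (Set.univ : Set ℝ) := this ▸ hcs.isCompact
    exact noncompact_univ ℝ h3
  have := hconst s t
  rw [ht, hG] at this
  simp at this
  linarith

theorem exists_cutoff {n : ℕ} {K T : Set (Coord n)} (hK : IsCompact K) (hT : IsOpen T)
    (hKT : K ⊆ T) : ∃ χ : Coord n → ℝ, ContDiff ℝ ∞ χ ∧ HasCompactSupport χ ∧ tsupport χ ⊆ T ∧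
      (∀ᶠ x in 𝓝ˢ K, χ x = 1) := by
  obtain ⟨K', hK', hKK', hK'T⟩ := exists_compact_between hK hT hKT
  obtain ⟨f, hf1, hf0, -⟩ := exists_contMDiffMap_one_nhds_of_subset_interior 𝓘(ℝ, Coord n)
    hK.isClosed hKK' (n := ⊤)
  have hsub : tsupport f ⊆ K' := by
    refine closure_minimal (fun x hx => ?_) hK'.isClosed
    by_contra h
    exact hx (hf0 x h)
  exact ⟨f, f.contMDiff.contDiff, HasCompactSupport.of_support_subset_isCompact hK'
    (subset_closure.trans hsub), hsub.trans hK'T, hf1⟩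

/-! ### Slice integrals of local primitives of second order operators -/

section SecondOrder

variable {m : ℕ}

theorem slice_second_derivative {w h : Coord (m + 2) → ℝ} {k : ℝ → ℝ}
    (hk : ContDiff ℝ ∞ k) (hw : ContDiff ℝ ∞ w) (hh : h = fun x => k (x 0) * w x)
    (x : Coord (m + 2)) (b c : Fin (m + 2)) :
    pd h c x = (if (0 : Fin (m + 2)) = c then 1 else 0) * (deriv k (x 0) * w x) + k (x 0) * pd w c x ∧
    pd (pd h c) b x = (if (0 : Fin (m + 2)) = c then 1 else 0) *
        ((if (0 : Fin (m + 2)) = b then 1 else 0) * (deriv (deriv k) (x 0) * w x)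
          + deriv k (x 0) * pd w b x)
      + ((if (0 : Fin (m + 2)) = b then 1 else 0) * (deriv k (x 0) * pd w c x)
          + k (x 0) * pd (pd w c) b x) := by
  have hd : ∀ {f : ℝ → ℝ}, ContDiff ℝ ∞ f → ContDiff ℝ ∞ (deriv f) := fun hf =>
    (contDiff_infty_iff_deriv.1 hf).2
  have comp : ∀ {f : ℝ → ℝ}, ContDiff ℝ ∞ f → ContDiff ℝ ∞ fun x : Coord (m + 2) => f (x 0) :=
    fun hf => hf.comp (contDiff_apply ℝ ℝ (0 : Fin (m + 2)))
  have D : ∀ {f : Coord (m + 2) → ℝ}, ContDiff ℝ ∞ f → ∀ x, DifferentiableAt ℝ f x := fun hf x =>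
    hf.differentiable (by simp) x
  have chain : ∀ {f : ℝ → ℝ}, ContDiff ℝ ∞ f → ∀ (c : Fin (m + 2)) (x : Coord (m + 2)),
      pd (fun y : Coord (m + 2) => f (y 0)) c x
        = (if (0 : Fin (m + 2)) = c then 1 else 0) * deriv f (x 0) := by
    intro f hf c x
    have h1 : HasFDerivAt (fun y : Coord (m + 2) => y 0)
      (ContinuousLinearMap.proj (R := ℝ) (0 : Fin (m + 2))) x := hasFDerivAt_apply 0 x
    have h2 := ((hf.differentiable (by simp) (x 0)).hasDerivAt).comp_hasFDerivAt x h1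
    simp only [Function.comp_def] at h2
    simp [pd, h2.fderiv, Pi.single_apply]
  have first : ∀ {f : ℝ → ℝ} {u : Coord (m + 2) → ℝ}, ContDiff ℝ ∞ f → ContDiff ℝ ∞ u →
      ∀ (c : Fin (m + 2)) (x : Coord (m + 2)), pd (fun x => f (x 0) * u x) c x
        = (if (0 : Fin (m + 2)) = c then 1 else 0) * (deriv f (x 0) * u x) + f (x 0) * pd u c x := by
    intro f u hf hu c x
    rw [pd_mul (D (comp hf) x) (D hu x), chain hf]
    ring
  refine ⟨by rw [hh, first hk hw], ?_⟩
  have : pd h c = fun x => (if (0 : Fin (m + 2)) = c then 1 else 0) * (deriv k (x 0) * w x)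
      + k (x 0) * pd w c x := by
    funext y
    rw [hh, first hk hw]
  rw [this, pd_add (D (contDiff_const.mul ((comp (hd hk)).mul hw)) x)
    (D ((comp hk).mul (contDiff_pd hw)) x), pd_const_mul _ (D ((comp (hd hk)).mul hw) x),
    first (hd hk) hw, first hk (contDiff_pd hw)]

/-- Values of a second order operator on `w`. -/
def secondOrder {n : ℕ} (A : Coord n → Fin n → ℝ) (B : Coord n → Fin n → Fin n → ℝ)
    (E : Coord n → Fin n → Fin n → Fin n → ℝ) (w : Coord n → Fin n → ℝ) (x : Coord n) : ℝ :=
  ∑ a, A x a * w x a + ∑ c, ∑ a, B x c a * pd (fun y => w y a) c x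
    + ∑ a, ∑ b, ∑ c, E x a b c * pd (pd (fun y => w y a) c) b x

/-- Leibniz rule: since `k` depends on `x^0` alone, each derivative falling on it selects the index
`0` in the coefficients. The factors of `k'` and `k''` are what the slice integral will be read off
from. -/
theorem secondOrder_mul (A : Coord (m + 2) → Fin (m + 2) → ℝ)
    (B : Coord (m + 2) → Fin (m + 2) → Fin (m + 2) → ℝ)
    (E : Coord (m + 2) → Fin (m + 2) → Fin (m + 2) → Fin (m + 2) → ℝ)
    {w : Coord (m + 2) → Fin (m + 2) → ℝ} (hw : ContDiff ℝ ∞ w) {k : ℝ → ℝ} (hk : ContDiff ℝ ∞ k)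
    (x : Coord (m + 2)) :
    secondOrder A B E (fun x a => k (x 0) * w x a) x
      = k (x 0) * secondOrder A B E w x
        + deriv k (x 0) * (∑ a, B x 0 a * w x a
          + ∑ a, ∑ c, (E x a c 0 + E x a 0 c) * pd (fun y => w y a) c x)
        + deriv (deriv k) (x 0) * ∑ a, E x a 0 0 * w x a := by
  have hwa : ∀ a, ContDiff ℝ ∞ fun x => w x a := fun a => contDiff_pi.1 hw a
  unfold secondOrder
  have e1 : ∀ a c, pd (fun y => k (y 0) * w y a) c x = _ := fun a c =>
    (slice_second_derivative hk (hwa a) rfl x 0 c).1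
  have e2 : ∀ a b c, pd (pd (fun y => k (y 0) * w y a) c) b x = _ := fun a b c =>
    (slice_second_derivative hk (hwa a) rfl x b c).2
  simp only [e1, e2]
  simp only [mul_add, Finset.sum_add_distrib, add_mul, Finset.mul_sum]
  have s1 : ∑ c, ∑ a, B x c a * ((if (0 : Fin (m + 2)) = c then 1 else 0) * (deriv k (x 0) * w x a))
      = ∑ a, deriv k (x 0) * (B x 0 a * w x a) := by
    rw [Finset.sum_comm]
    refine Finset.sum_congr rfl fun a _ => ?_
    rw [Finset.sum_eq_single 0 (fun c _ hc => by rw [if_neg hc.symm]; ring) (by simp)]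
    simp; ring
  have s2 : ∑ a, ∑ b, ∑ c, E x a b c * ((if (0 : Fin (m + 2)) = c then 1 else 0) *
      ((if (0 : Fin (m + 2)) = b then 1 else 0) * (deriv (deriv k) (x 0) * w x a)))
      = ∑ a, deriv (deriv k) (x 0) * (E x a 0 0 * w x a) := by
    refine Finset.sum_congr rfl fun a _ => ?_
    rw [Finset.sum_eq_single 0 (fun b _ hb => Finset.sum_eq_zero fun c _ => by
        rw [if_neg hb.symm]; ring) (by simp),
      Finset.sum_eq_single 0 (fun c _ hc => by rw [if_neg hc.symm]; ring) (by simp)]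
    simp; ring
  have s3 : ∑ a, ∑ b, ∑ c, E x a b c * ((if (0 : Fin (m + 2)) = c then 1 else 0) *
      (deriv k (x 0) * pd (fun y => w y a) b x))
      = ∑ a, ∑ b, deriv k (x 0) * (E x a b 0 * pd (fun y => w y a) b x) := by
    refine Finset.sum_congr rfl fun a _ => Finset.sum_congr rfl fun b _ => ?_
    rw [Finset.sum_eq_single 0 (fun c _ hc => by rw [if_neg hc.symm]; ring) (by simp)]
    simp; ring
  have s4 : ∑ a, ∑ b, ∑ c, E x a b c * ((if (0 : Fin (m + 2)) = b then 1 else 0) *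
      (deriv k (x 0) * pd (fun y => w y a) c x))
      = ∑ a, ∑ c, deriv k (x 0) * (E x a 0 c * pd (fun y => w y a) c x) := by
    refine Finset.sum_congr rfl fun a _ => ?_
    rw [Finset.sum_eq_single 0 (fun b _ hb => Finset.sum_eq_zero fun c _ => by
        rw [if_neg hb.symm]; ring) (by simp)]
    refine Finset.sum_congr rfl fun c _ => ?_
    simp; ring
  rw [s1, s2, s3, s4]
  have c1 : ∀ a, A x a * (k (x 0) * w x a) = k (x 0) * (A x a * w x a) := fun a => by ring
  have c2 : ∀ c a, B x c a * (k (x 0) * pd (fun y => w y a) c x)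
      = k (x 0) * (B x c a * pd (fun y => w y a) c x) := fun c a => by ring
  have c3 : ∀ a b c, E x a b c * (k (x 0) * pd (pd (fun y => w y a) c) b x)
      = k (x 0) * (E x a b c * pd (pd (fun y => w y a) c) b x) := fun a b c => by ring
  simp only [c1, c2, c3]
  ring

set_option maxHeartbeats 1600000 in
/-- Let `α w` be `(n - 2)`-forms, supported where `w` is, whose exterior derivative is a second order
operator in `w`.  If `w` vanishes on the slice `x^0 = x^1 = 0`, the integral of `α w` over the slice
depends only on the leading symbol of the operator. -/
theorem integral_slice_of_secondOrder {T : Set (Coord (m + 2))} (hT : IsOpen T)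
    (α : (Coord (m + 2) → Fin (m + 2) → ℝ) → Coord (m + 2) → Idx (m + 2) m → ℝ)
    (A : Coord (m + 2) → Fin (m + 2) → ℝ)
    (B : Coord (m + 2) → Fin (m + 2) → Fin (m + 2) → ℝ)
    (E : Coord (m + 2) → Fin (m + 2) → Fin (m + 2) → Fin (m + 2) → ℝ)
    (hα : ∀ w, ContDiff ℝ ∞ w → HasCompactSupport w → tsupport w ⊆ T →
      (∀ I, ContDiff ℝ ∞ fun x => α w x I) ∧ (∀ x ∉ tsupport w, α w x = 0) ∧
        ∀ x ∈ T, extD (α w) x (lineIdx m) = secondOrder A B E w x)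
    {w : Coord (m + 2) → Fin (m + 2) → ℝ} (hw : ContDiff ℝ ∞ w) (hwc : HasCompactSupport w)
    (hwT : tsupport w ⊆ T) (hslice : ∀ y : Coord m, w (slice y) = 0) :
    ∫ y : Coord m, α w (slice y) (sliceIdx m) = ∫ y : Coord m, ∑ a,
      (E (slice y) a 0 0 * pd (fun x => w x a) 0 (slice y)
        + (E (slice y) a 0 1 + E (slice y) a 1 0) * pd (fun x => w x a) 1 (slice y)) := by
  classical
  set W : (ℝ → ℝ) → (Coord (m + 2) → Fin (m + 2) → ℝ) → Coord (m + 2) → Fin (m + 2) → ℝ :=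
    fun k w x a => k (x 0) * w x a with hW
  have hWs : ∀ {k : ℝ → ℝ} {w : Coord (m + 2) → Fin (m + 2) → ℝ}, ContDiff ℝ ∞ k →
      ContDiff ℝ ∞ w → ContDiff ℝ ∞ (W k w) := fun hk hw => contDiff_pi.2 fun a =>
    (hk.comp (contDiff_apply ℝ ℝ (0 : Fin (m + 2)))).mul (contDiff_pi.1 hw a)
  have hWt : ∀ (k : ℝ → ℝ) (w : Coord (m + 2) → Fin (m + 2) → ℝ), tsupport (W k w) ⊆ tsupport w :=
    fun k w => closure_mono fun x hx hx0 => hx (by funext a; simp [hW, hx0])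
  have hWc : ∀ (k : ℝ → ℝ) {w : Coord (m + 2) → Fin (m + 2) → ℝ}, HasCompactSupport w →
      HasCompactSupport (W k w) := fun k w hw =>
    HasCompactSupport.of_support_subset_isCompact hw (subset_closure.trans (hWt k w))
  have hd : ∀ {f : ℝ → ℝ}, ContDiff ℝ ∞ f → ContDiff ℝ ∞ (deriv f) := fun hf =>
    (contDiff_infty_iff_deriv.1 hf).2
  -- smoothness and support of `α` and of its exterior derivative
  have αc : ∀ {w}, ContDiff ℝ ∞ w → HasCompactSupport w → tsupport w ⊆ T →
      ∀ I, HasCompactSupport fun x => α w x I := fun hw hc ht I =>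
    HasCompactSupport.intro hc fun x hx => by rw [(hα _ hw hc ht).2.1 x hx]; rfl
  have dα : ∀ {w}, ContDiff ℝ ∞ w → HasCompactSupport w → tsupport w ⊆ T →
      ContDiff ℝ ∞ fun x => extD (α w) x (lineIdx m) := fun hw hc ht =>
    ContDiff.sum fun i _ => contDiff_const.mul (contDiff_pd ((hα _ hw hc ht).1 _))
  have dα0 : ∀ {w}, ContDiff ℝ ∞ w → HasCompactSupport w → tsupport w ⊆ T →
      ∀ x ∉ tsupport w, extD (α w) x (lineIdx m) = 0 := fun {w} hw hc ht x hx =>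
    Finset.sum_eq_zero fun i _ => by
      rw [pd_eq_zero_of_notMem_tsupport, mul_zero]
      exact fun h => hx (closure_minimal (fun y hy => by
        by_contra hy'
        exact hy (congrFun ((hα _ hw hc ht).2.1 y hy') _)) (isClosed_tsupport w) h)
  -- the coefficients of the operator `k ↦ d α (k w)`
  set a₀ : (Coord (m + 2) → Fin (m + 2) → ℝ) → Coord (m + 2) → ℝ :=
    fun w x => extD (α (W (fun _ => 1) w)) x (lineIdx m) with ha₀
  set b₀ : (Coord (m + 2) → Fin (m + 2) → ℝ) → Coord (m + 2) → ℝ :=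
    fun w x => extD (α (W (fun t => t) w)) x (lineIdx m) - x 0 * a₀ w x with hb₀
  set c₀ : (Coord (m + 2) → Fin (m + 2) → ℝ) → Coord (m + 2) → ℝ :=
    fun w x => 1 / 2 * (extD (α (W (fun t => t ^ 2) w)) x (lineIdx m) - x 0 ^ 2 * a₀ w x
      - 2 * x 0 * b₀ w x) with hc₀
  have hx0 : ContDiff ℝ ∞ fun x : Coord (m + 2) => x 0 := contDiff_apply ℝ ℝ 0
  have smooth : ∀ {w}, ContDiff ℝ ∞ w → HasCompactSupport w → tsupport w ⊆ T →
      ContDiff ℝ ∞ (a₀ w) ∧ ContDiff ℝ ∞ (b₀ w) ∧ ContDiff ℝ ∞ (c₀ w) := by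
    intro w hw hc ht
    have hk : ∀ k : ℝ → ℝ, ContDiff ℝ ∞ k →
        ContDiff ℝ ∞ fun x => extD (α (W k w)) x (lineIdx m) := fun k hk =>
      dα (hWs hk hw) (hWc k hc) ((hWt k w).trans ht)
    have h0 : ContDiff ℝ ∞ (a₀ w) := hk (fun _ => 1) contDiff_const
    have h1 : ContDiff ℝ ∞ (b₀ w) := (hk (fun t => t) contDiff_id).sub (hx0.mul h0)
    exact ⟨h0, h1, contDiff_const.mul (((hk (fun t => t ^ 2) (contDiff_id.pow 2)).sub
      ((hx0.pow 2).mul h0)).sub ((contDiff_const.mul hx0).mul h1))⟩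
  have zero : ∀ {w}, ContDiff ℝ ∞ w → HasCompactSupport w → tsupport w ⊆ T → ∀ x ∉ tsupport w,
      a₀ w x = 0 ∧ b₀ w x = 0 ∧ c₀ w x = 0 := by
    intro w hw hc ht x hx
    have z : ∀ {k : ℝ → ℝ}, ContDiff ℝ ∞ k → extD (α (W k w)) x (lineIdx m) = 0 := fun {k} hk =>
      dα0 (hWs hk hw) (hWc _ hc) ((hWt _ _).trans ht) x fun h => hx (hWt _ _ h)
    have h0 : a₀ w x = 0 := z (k := fun _ => 1) contDiff_const
    have h1 : b₀ w x = 0 := by simp only [hb₀]; rw [z (k := fun t => t) contDiff_id, h0]; ring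
    refine ⟨h0, h1, ?_⟩
    simp only [hc₀]
    rw [z (k := fun t => t ^ 2) (contDiff_id.pow 2), h0, h1]; ring
  have d2 : deriv (fun t : ℝ => t ^ 2) = fun t => 2 * t := by funext t; simp
  have d3 : ∀ s, deriv (fun t : ℝ => 2 * t) s = 2 := fun s => by simp
  -- The same three functions in terms of `A`, `B`, `E`. Defining them through `extD` makes them
  -- smooth on the whole space, whereas the coefficients of the operator are arbitrary functions and
  -- meaningful on `T` only.
  have expl : ∀ {w}, ContDiff ℝ ∞ w → HasCompactSupport w → tsupport w ⊆ T → ∀ x ∈ T,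
      a₀ w x = secondOrder A B E w x ∧
      b₀ w x = ∑ a, B x 0 a * w x a
          + ∑ a, ∑ c, (E x a c 0 + E x a 0 c) * pd (fun y => w y a) c x ∧
      c₀ w x = ∑ a, E x a 0 0 * w x a := by
    intro w hw hc ht x hx
    have e : ∀ {k : ℝ → ℝ}, ContDiff ℝ ∞ k → extD (α (W k w)) x (lineIdx m)
        = secondOrder A B E (W k w) x := fun {k} hk =>
      (hα _ (hWs hk hw) (hWc _ hc) ((hWt _ _).trans ht)).2.2 x hx
    have h0 : a₀ w x = secondOrder A B E w x := by
      simp only [ha₀]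
      rw [e (k := fun _ => 1) contDiff_const, secondOrder_mul A B E hw (k := fun _ => 1) contDiff_const]
      simp
    have h1 : b₀ w x = ∑ a, B x 0 a * w x a
          + ∑ a, ∑ c, (E x a c 0 + E x a 0 c) * pd (fun y => w y a) c x := by
      simp only [hb₀]
      rw [e (k := fun t => t) contDiff_id, secondOrder_mul A B E hw (k := fun t => t) contDiff_id, h0]
      simp only [deriv_id'', deriv_const, one_mul, zero_mul, add_zero, add_sub_cancel_left]
    refine ⟨h0, h1, ?_⟩
    simp only [hc₀]
    rw [e (k := fun t => t ^ 2) (contDiff_id.pow 2), secondOrder_mul A B E hw (k := fun t => t ^ 2) (contDiff_id.pow 2), h0, h1, d2, d3]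
    ring
  -- Off the support of `w` both sides vanish by locality, so the expansion holds at points outside
  -- `T` as well, as integration over entire slices requires.
  have expand : ∀ {w}, ContDiff ℝ ∞ w → HasCompactSupport w → tsupport w ⊆ T →
      ∀ {k : ℝ → ℝ}, ContDiff ℝ ∞ k → ∀ x, extD (α (W k w)) x (lineIdx m)
        = k (x 0) * a₀ w x + deriv k (x 0) * b₀ w x + deriv (deriv k) (x 0) * c₀ w x := by
    intro w hw hc ht k hk x
    by_cases hx : x ∈ tsupport w
    · obtain ⟨h0, h1, h2⟩ := expl hw hc ht x (ht hx)
      rw [(hα _ (hWs hk hw) (hWc _ hc) ((hWt _ _).trans ht)).2.2 x (ht hx),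
        secondOrder_mul A B E hw hk, h0, h1, h2]
    · obtain ⟨h0, h1, h2⟩ := zero hw hc ht x hx
      rw [dα0 (hWs hk hw) (hWc _ hc) ((hWt _ _).trans ht) x fun h => hx (hWt _ _ h), h0, h1, h2]
      ring
  have supp : HasCompactSupport (a₀ w) ∧ HasCompactSupport (b₀ w) ∧ HasCompactSupport (c₀ w) :=
    ⟨HasCompactSupport.intro hwc fun x hx => (zero hw hwc hwT x hx).1,
      HasCompactSupport.intro hwc fun x hx => (zero hw hwc hwT x hx).2.1,
      HasCompactSupport.intro hwc fun x hx => (zero hw hwc hwT x hx).2.2⟩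
  obtain ⟨sa, sb, sc⟩ := smooth hw hwc hwT
  -- By Stokes, the slice integral of `α (k w)` as a function of `s` is a compactly supported
  -- primitive for every `k`; the coefficients are the slice integrals of `a₀ w`, `b₀ w`, `c₀ w`.
  have main := primitive_eq_of_forall_primitive
    (fun k s => ∫ y : Coord m, α (W k w) (line s y) (sliceIdx m))
    (fun s => ∫ y : Coord m, a₀ w (line s y)) (fun s => ∫ y : Coord m, b₀ w (line s y))
    (fun s => ∫ y : Coord m, c₀ w (line s y)) (by
      intro k hk
      have h1 := hα _ (hWs hk hw) (hWc k hwc) ((hWt _ _).trans hwT)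
      have h2 := αc (hWs hk hw) (hWc k hwc) ((hWt _ _).trans hwT)
      refine ⟨contDiff_integral_line (h1.1 _) (h2 _), hasCompactSupport_integral_line (h2 _),
        fun s => ?_⟩
      rw [(hasDerivAt_integral_form h1.1 h2 s).deriv]
      simp only [expand hw hwc hwT hk, line_coord_zero]
      rw [integral_add, integral_add, integral_const_mul, integral_const_mul, integral_const_mul]
      · exact (integrable_comp_line sa.continuous supp.1 s).const_mul _
      · exact (integrable_comp_line sb.continuous supp.2.1 s).const_mul _
      · exact ((integrable_comp_line sa.continuous supp.1 s).const_mul _).add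
          ((integrable_comp_line sb.continuous supp.2.1 s).const_mul _)
      · exact (integrable_comp_line sc.continuous supp.2.2 s).const_mul _) 0
  have hW1 : W (fun _ => 1) w = w := by funext x a; simp [hW]
  simp only [hW1, line_zero] at main
  rw [main, (hasDerivAt_integral_line sc supp.2.2 0).deriv]
  have i1 : Integrable fun y : Coord m => b₀ w (slice y) :=
    integrable_comp_line sb.continuous supp.2.1 0
  have i2 : Integrable fun y : Coord m => pd (c₀ w) 0 (slice y) :=
    integrable_comp_line (contDiff_pd sc).continuous (hasCompactSupport_pd supp.2.2) 0
  simp only [line_zero]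
  rw [← integral_sub i1 i2]
  refine integral_congr_ae (Filter.Eventually.of_forall fun y => ?_)
  -- pointwise evaluation on the slice
  have hwa : ∀ a, ContDiff ℝ ∞ fun x => w x a := fun a => contDiff_pi.1 hw a
  have hwd : ∀ a (x : Coord (m + 2)), DifferentiableAt ℝ (fun x => w x a) x := fun a =>
    (hwa a).differentiable (by simp)
  have hws : ∀ a, tsupport (fun x => w x a) ⊆ tsupport w := fun a =>
    closure_mono fun x hx h => hx (by simp [h])
  change b₀ w (slice y) - pd (c₀ w) 0 (slice y) = _
  by_cases hx : slice y ∈ tsupport w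
  swap
  · have h0 : ∀ a c, pd (fun x => w x a) c (slice y) = 0 := fun a c =>
      pd_eq_zero_of_notMem_tsupport fun h => hx (hws a h)
    have h1 : pd (c₀ w) 0 (slice y) = 0 := pd_eq_zero_of_notMem_tsupport fun h => hx
      (closure_minimal (fun z hz => by
        by_contra hz'
        exact hz (zero hw hwc hwT z hz').2.2) (isClosed_tsupport w) h)
    simp only [(zero hw hwc hwT _ hx).2.1, h1, h0, mul_zero, add_zero, sub_zero, Finset.sum_const_zero]
  -- To differentiate `c₀ w = ∑ E_a^{00} w^a` by the product rule one needs `E_a^{00}` to be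
  -- differentiable, which is not given. Near the support of `w` it coincides with `c₀ (e a)` for
  -- the cut-off coordinate fields `e a`, and that function is smooth.
  obtain ⟨χ, hχ, hχc, hχT, hχ1⟩ := exists_cutoff hwc hT hwT
  set e : Fin (m + 2) → Coord (m + 2) → Fin (m + 2) → ℝ := fun a x => Pi.single a (χ x) with he
  have hes : ∀ a, ContDiff ℝ ∞ (e a) := fun a => contDiff_pi.2 fun d => by
    by_cases h : d = a
    · subst h; simpa [he] using hχ
    · simpa [he, h] using contDiff_const
  have het : ∀ a, tsupport (e a) ⊆ tsupport χ := fun a =>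
    closure_mono fun x hx h => hx (by simp [he, h])
  have hec : ∀ a, HasCompactSupport (e a) := fun a =>
    HasCompactSupport.of_support_subset_isCompact hχc (subset_closure.trans (het a))
  have cw : ∀ x ∈ T, c₀ w x = ∑ a, E x a 0 0 * w x a := fun x hx => (expl hw hwc hwT x hx).2.2
  have ce : ∀ a, ∀ x ∈ T, c₀ (e a) x = E x a 0 0 * χ x := fun a x hx => by
    rw [(expl (hes a) (hec a) ((het a).trans hχT) x hx).2.2,
      Finset.sum_eq_single a (fun d _ hd => by simp [he, hd]) (by simp)]
    simp [he]
  have hχx : ∀ᶠ x in 𝓝 (slice y), χ x = 1 := hχ1.filter_mono (nhds_le_nhdsSet hx)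
  have near : c₀ w =ᶠ[𝓝 (slice y)] fun x => ∑ a, c₀ (e a) x * w x a := by
    filter_upwards [hχx, hT.mem_nhds (hwT hx)] with x h1 h2
    rw [cw x h2]
    exact Finset.sum_congr rfl fun a _ => by rw [ce a x h2, h1, mul_one]
  have hce : ∀ a, ContDiff ℝ ∞ (c₀ (e a)) := fun a =>
    (smooth (hes a) (hec a) ((het a).trans hχT)).2.2
  have hw0 : ∀ a, w (slice y) a = 0 := fun a => by rw [hslice]; rfl
  have h1 : pd (c₀ w) 0 (slice y) = ∑ a, E (slice y) a 0 0 * pd (fun x => w x a) 0 (slice y) := by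
    rw [pd_congr near, pd_sum _ fun a _ =>
      (((hce a).mul (hwa a)).differentiable (by simp)).differentiableAt]
    refine Finset.sum_congr rfl fun a _ => ?_
    rw [pd_mul ((hce a).differentiable (by simp)).differentiableAt (hwd a _), hw0, mul_zero,
      zero_add, ce a _ (hwT hx), hχx.self_of_nhds, mul_one]
  have htan : ∀ a (k : Fin m), pd (fun x => w x a) k.succ.succ (slice y) = 0 := fun a k => by
    have := pd_comp_line (s := 0) (y := y) (hwd a _) k
    rw [line_zero] at this
    rw [← this]
    have h2 : (fun y : Coord m => w (line 0 y) a) = fun _ => 0 := by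
      funext y; rw [line_zero, hslice]; rfl
    rw [h2, pd_const]
  -- On the slice `b₀` is `2 E^{00} ∂_0 w + (E^{01} + E^{10}) ∂_1 w`, and `∂_0 c₀` removes one of
  -- the two copies of `E^{00} ∂_0 w`.
  rw [h1, (expl hw hwc hwT _ (hwT hx)).2.1, Finset.sum_eq_zero (f := fun a => B _ 0 a * w _ a)
    (fun a _ => by rw [hw0, mul_zero]), zero_add, ← Finset.sum_sub_distrib]
  refine Finset.sum_congr rfl fun a _ => ?_
  rw [Fin.sum_univ_succ, Fin.sum_univ_succ, Finset.sum_eq_zero (fun k _ => by rw [htan, mul_zero])]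
  simp only [Fin.succ_zero_eq_one]
  ring

end SecondOrder

/-! ## The action of `gl(n)` on tensor densities -/

section FrameAction

variable {n : ℕ} {κ : Type} [DecidableEq κ]

/-- The action of a matrix on one index. -/
def indexAct (k : κ) (C : Matrix (Fin n) (Fin n) ℝ) (T : (κ → Fin n) → ℝ) (I : κ → Fin n) : ℝ :=
  ∑ d, C (I k) d * T (Function.update I k d)

theorem indexAct_comm {k l : κ} (h : k ≠ l) (C D : Matrix (Fin n) (Fin n) ℝ)
    (T : (κ → Fin n) → ℝ) : indexAct k C (indexAct l D T) = indexAct l D (indexAct k C T) := by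
  funext I
  simp only [indexAct, Finset.mul_sum]
  rw [Finset.sum_comm]
  refine Finset.sum_congr rfl fun d _ => Finset.sum_congr rfl fun d' _ => ?_
  rw [Function.update_of_ne h.symm, Function.update_of_ne h, Function.update_comm h]
  ring

theorem indexAct_indexAct (k : κ) (C D : Matrix (Fin n) (Fin n) ℝ) (T : (κ → Fin n) → ℝ) :
    indexAct k C (indexAct k D T) = indexAct k (C * D) T := by
  funext I
  simp only [indexAct, Finset.mul_sum, Function.update_self, Function.update_idem,
    Matrix.mul_apply, Finset.sum_mul]
  rw [Finset.sum_comm]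
  exact Finset.sum_congr rfl fun d _ => Finset.sum_congr rfl fun d' _ => by ring

theorem indexAct_sum (k : κ) (C : Matrix (Fin n) (Fin n) ℝ) {ι : Type*} (s : Finset ι)
    (T : ι → (κ → Fin n) → ℝ) : indexAct k C (∑ i ∈ s, T i) = ∑ i ∈ s, indexAct k C (T i) := by
  funext I
  simp only [indexAct, Finset.sum_apply, Finset.mul_sum]
  exact Finset.sum_comm

theorem indexAct_add (k : κ) (C : Matrix (Fin n) (Fin n) ℝ) (T S : (κ → Fin n) → ℝ) :
    indexAct k C (T + S) = indexAct k C T + indexAct k C S := by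
  funext I
  simp only [indexAct, Pi.add_apply, mul_add, Finset.sum_add_distrib]

theorem indexAct_smul (k : κ) (C : Matrix (Fin n) (Fin n) ℝ) (r : ℝ) (T : (κ → Fin n) → ℝ) :
    indexAct k C (r • T) = r • indexAct k C T := by
  funext I
  simp only [indexAct, Pi.smul_apply, smul_eq_mul, Finset.mul_sum]
  exact Finset.sum_congr rfl fun d _ => by ring

theorem indexAct_sub_left (k : κ) (C D : Matrix (Fin n) (Fin n) ℝ) (T : (κ → Fin n) → ℝ) :
    indexAct k (C - D) T = indexAct k C T - indexAct k D T := by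
  funext I
  simp only [indexAct, Pi.sub_apply, Matrix.sub_apply, sub_mul, Finset.sum_sub_distrib]

variable [Fintype κ]

/-- The infinitesimal version of `transformArr`. -/
def frameAct (up : κ → Bool) (w : ℤ) (M : Matrix (Fin n) (Fin n) ℝ) (T : (κ → Fin n) → ℝ)
    (I : κ → Fin n) : ℝ :=
  ∑ k, ∑ d, (if up k = true then M (I k) d else -M d (I k)) * T (Function.update I k d)
    + (w : ℝ) * M.trace * T I

variable (up : κ → Bool) (w : ℤ)

theorem frameAct_add_left (M N : Matrix (Fin n) (Fin n) ℝ) (T : (κ → Fin n) → ℝ) :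
    frameAct up w (M + N) T = frameAct up w M T + frameAct up w N T := by
  funext I
  simp only [frameAct, Pi.add_apply, Matrix.add_apply, Matrix.trace_add]
  have : ∀ (k : κ) (d : Fin n), (if up k = true then M (I k) d + N (I k) d
      else -(M d (I k) + N d (I k))) * T (Function.update I k d)
      = (if up k = true then M (I k) d else -M d (I k)) * T (Function.update I k d)
        + (if up k = true then N (I k) d else -N d (I k)) * T (Function.update I k d) := by
    intro k d; split_ifs <;> ring
  simp only [this, Finset.sum_add_distrib]
  ring

theorem frameAct_smul_left (r : ℝ) (M : Matrix (Fin n) (Fin n) ℝ) (T : (κ → Fin n) → ℝ) :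
    frameAct up w (r • M) T = r • frameAct up w M T := by
  funext I
  simp only [frameAct, Pi.smul_apply, Matrix.smul_apply, Matrix.trace_smul, smul_eq_mul, mul_add,
    Finset.mul_sum]
  congr 1
  · refine Finset.sum_congr rfl fun k _ => Finset.sum_congr rfl fun d _ => ?_
    split_ifs <;> ring
  · ring

theorem frameAct_add_right (M : Matrix (Fin n) (Fin n) ℝ) (T S : (κ → Fin n) → ℝ) :
    frameAct up w M (T + S) = frameAct up w M T + frameAct up w M S := by
  funext I
  simp only [frameAct, Pi.add_apply, mul_add, Finset.sum_add_distrib]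
  ring

theorem frameAct_smul_right (r : ℝ) (M : Matrix (Fin n) (Fin n) ℝ) (T : (κ → Fin n) → ℝ) :
    frameAct up w M (r • T) = r • frameAct up w M T := by
  funext I
  simp only [frameAct, Pi.smul_apply, smul_eq_mul, mul_add, Finset.mul_sum]
  congr 1
  · refine Finset.sum_congr rfl fun k _ => Finset.sum_congr rfl fun d _ => ?_
    ring
  · ring

/-- `frameAct` as a bilinear map. -/
def frameActₗ : Matrix (Fin n) (Fin n) ℝ →ₗ[ℝ] ((κ → Fin n) → ℝ) →ₗ[ℝ] ((κ → Fin n) → ℝ) :=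
  LinearMap.mk₂ ℝ (frameAct up w) (frameAct_add_left up w) (frameAct_smul_left up w)
    (frameAct_add_right up w) (frameAct_smul_right up w)

theorem frameActₗ_apply (M : Matrix (Fin n) (Fin n) ℝ) (T : (κ → Fin n) → ℝ) :
    frameActₗ up w M T = frameAct up w M T := rfl

/-- The matrix by which `M` acts on an upper or lower index. -/
def indexMatrix (b : Bool) (M : Matrix (Fin n) (Fin n) ℝ) : Matrix (Fin n) (Fin n) ℝ :=
  if b = true then M else -M.transpose

theorem frameAct_eq (M : Matrix (Fin n) (Fin n) ℝ) (T : (κ → Fin n) → ℝ) :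
    frameAct up w M T = ∑ k, indexAct k (indexMatrix (up k) M) T + ((w : ℝ) * M.trace) • T := by
  funext I
  simp only [frameAct, indexAct, indexMatrix, Finset.sum_apply, Pi.add_apply, Pi.smul_apply,
    smul_eq_mul]
  congr 1
  refine Finset.sum_congr rfl fun k _ => Finset.sum_congr rfl fun d _ => ?_
  split_ifs <;> rfl

/-- Actions on different indices commute, so only the terms in which both matrices act on the same
index remain; these give the matrix commutator, also for lower indices, where `M` acts by `-Mᵀ`. The
weight term is scalar and drops out, as a commutator has trace zero. -/
theorem frameAct_commutator (M N : Matrix (Fin n) (Fin n) ℝ) (T : (κ → Fin n) → ℝ) :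
    frameAct up w M (frameAct up w N T) - frameAct up w N (frameAct up w M T)
      = frameAct up w (M * N - N * M) T := by
  have key : ∀ k l, indexAct k (indexMatrix (up k) M) (indexAct l (indexMatrix (up l) N) T)
      - indexAct l (indexMatrix (up l) N) (indexAct k (indexMatrix (up k) M) T)
      = if k = l then indexAct k (indexMatrix (up k) (M * N - N * M)) T else 0 := by
    intro k l
    split_ifs with h
    · subst h
      rw [indexAct_indexAct, indexAct_indexAct, ← indexAct_sub_left]
      congr 1
      unfold indexMatrix
      split_ifs
      · rfl
      · simp [Matrix.transpose_mul, Matrix.transpose_sub]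
    · rw [indexAct_comm h, sub_self]
  have htr : (M * N - N * M).trace = 0 := by
    rw [Matrix.trace_sub, Matrix.trace_mul_comm, sub_self]
  rw [frameAct_eq up w (M * N - N * M), htr, mul_zero, zero_smul, add_zero]
  simp only [frameAct_eq up w M, frameAct_eq up w N, indexAct_add, indexAct_sum, indexAct_smul,
    smul_add, Finset.smul_sum, Finset.sum_add_distrib]
  have : ∑ k, ∑ l, indexAct k (indexMatrix (up k) M) (indexAct l (indexMatrix (up l) N) T)
      - ∑ l, ∑ k, indexAct l (indexMatrix (up l) N) (indexAct k (indexMatrix (up k) M) T)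
      = ∑ k, indexAct k (indexMatrix (up k) (M * N - N * M)) T := by
    rw [Finset.sum_comm (f := fun l k => indexAct l (indexMatrix (up l) N)
      (indexAct k (indexMatrix (up k) M) T)), ← Finset.sum_sub_distrib]
    refine Finset.sum_congr rfl fun k _ => ?_
    rw [← Finset.sum_sub_distrib]
    simp [key]
  rw [← this]
  module

/-- Splitting off a lower index. -/
theorem frameAct_join {κ' : Type} [Fintype κ'] [DecidableEq κ'] (up' : κ' → Bool) (k₀ : κ')
    (s : κ → κ') (hsum : ∀ f : κ' → ℝ, ∑ k, f k = f k₀ + ∑ k, f (s k)) (hs : Function.Injective s)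
    (hne : ∀ k, s k ≠ k₀) (h₀ : up' k₀ = false) (hup : ∀ k, up' (s k) = up k)
    (M : Matrix (Fin n) (Fin n) ℝ) (S : Fin n → (κ → Fin n) → ℝ) (J : κ' → Fin n) :
    frameAct up' w M (fun J => S (J k₀) (J ∘ s)) J
      = frameAct up w M (S (J k₀)) (J ∘ s) - ∑ d, M d (J k₀) * S d (J ∘ s) := by
  unfold frameAct
  rw [hsum]
  have e1 : ∀ d, (Function.update J k₀ d) ∘ s = J ∘ s := fun d => by
    funext k; simp [Function.update_of_ne (hne k)]
  have e2 : ∀ k d, (Function.update J (s k) d) ∘ s = Function.update (J ∘ s) k d := fun k d => by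
    funext l
    by_cases h : l = k
    · subst h; simp
    · simp [Function.update_of_ne h, Function.update_of_ne (fun h' => h (hs h'))]
  have e3 : ∀ k d, Function.update J (s k) d k₀ = J k₀ := fun k d =>
    Function.update_of_ne (hne k).symm _ _
  simp only [e1, e2, e3, hup, h₀, Function.update_self, Function.comp_apply]
  simp
  ring

end FrameAction

/-! ## Derivatives of matrix-valued functions -/

section MatrixDerivatives

variable {n : ℕ}

/-- The coordinate derivative of a matrix-valued function. -/
def mpd (F : Coord n → Matrix (Fin n) (Fin n) ℝ) (c : Fin n) (x : Coord n) :
    Matrix (Fin n) (Fin n) ℝ :=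
  Matrix.of fun a b => pd (fun y => F y a b) c x

/-- Smooth matrix-valued functions on `T`. -/
def MSmooth (T : Set (Coord n)) (F : Coord n → Matrix (Fin n) (Fin n) ℝ) : Prop :=
  ∀ a b, ContDiffOn ℝ ∞ (fun y => F y a b) T

variable {T : Set (Coord n)} {F G : Coord n → Matrix (Fin n) (Fin n) ℝ} {x : Coord n} {c : Fin n}

theorem differentiableAt_of_contDiffOn {f : Coord n → ℝ} (hT : IsOpen T)
    (hf : ContDiffOn ℝ ∞ f T) (hx : x ∈ T) : DifferentiableAt ℝ f x :=
  (hf.contDiffAt (hT.mem_nhds hx)).differentiableAt (by simp)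

theorem MSmooth.add (hF : MSmooth T F) (hG : MSmooth T G) : MSmooth T fun y => F y + G y :=
  fun a b => (hF a b).add (hG a b)

theorem MSmooth.sub (hF : MSmooth T F) (hG : MSmooth T G) : MSmooth T fun y => F y - G y :=
  fun a b => (hF a b).sub (hG a b)

theorem MSmooth.mul (hF : MSmooth T F) (hG : MSmooth T G) : MSmooth T fun y => F y * G y :=
  fun a b => by
    simp only [Matrix.mul_apply]
    exact ContDiffOn.sum fun d _ => (hF a d).mul (hG d b)

theorem MSmooth.smul {f : Coord n → ℝ} (hf : ContDiffOn ℝ ∞ f T) (hG : MSmooth T G) :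
    MSmooth T fun y => f y • G y :=
  fun a b => hf.mul (hG a b)

theorem MSmooth.sum {ι : Type*} {s : Finset ι} {F : ι → Coord n → Matrix (Fin n) (Fin n) ℝ}
    (hF : ∀ i ∈ s, MSmooth T (F i)) : MSmooth T fun y => ∑ i ∈ s, F i y := fun a b => by
  simp only [Matrix.sum_apply]
  exact ContDiffOn.sum fun i hi => hF i hi a b

theorem MSmooth.mpd (hT : IsOpen T) (hF : MSmooth T F) : MSmooth T (mpd F c) :=
  fun a b => contDiffOn_pd hT (hF a b)

theorem mpd_add (hT : IsOpen T) (hx : x ∈ T) (hF : MSmooth T F) (hG : MSmooth T G) :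
    mpd (fun y => F y + G y) c x = mpd F c x + mpd G c x := by
  ext a b
  exact pd_add (differentiableAt_of_contDiffOn hT (hF a b) hx)
    (differentiableAt_of_contDiffOn hT (hG a b) hx)

theorem mpd_sub (hT : IsOpen T) (hx : x ∈ T) (hF : MSmooth T F) (hG : MSmooth T G) :
    mpd (fun y => F y - G y) c x = mpd F c x - mpd G c x := by
  ext a b
  exact pd_sub (differentiableAt_of_contDiffOn hT (hF a b) hx)
    (differentiableAt_of_contDiffOn hT (hG a b) hx)

theorem mpd_mul (hT : IsOpen T) (hx : x ∈ T) (hF : MSmooth T F) (hG : MSmooth T G) :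
    mpd (fun y => F y * G y) c x = mpd F c x * G x + F x * mpd G c x := by
  ext a b
  simp only [mpd, Matrix.of_apply, Matrix.mul_apply, Matrix.add_apply]
  rw [pd_sum _ fun d _ => (differentiableAt_of_contDiffOn hT ((hF a d).mul (hG d b)) hx),
    ← Finset.sum_add_distrib]
  exact Finset.sum_congr rfl fun d _ => pd_mul (differentiableAt_of_contDiffOn hT (hF a d) hx)
    (differentiableAt_of_contDiffOn hT (hG d b) hx)

theorem mpd_smul {f : Coord n → ℝ} (hT : IsOpen T) (hx : x ∈ T) (hf : ContDiffOn ℝ ∞ f T)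
    (hG : MSmooth T G) :
    mpd (fun y => f y • G y) c x = pd f c x • G x + f x • mpd G c x := by
  ext a b
  exact pd_mul (differentiableAt_of_contDiffOn hT hf hx)
    (differentiableAt_of_contDiffOn hT (hG a b) hx)

theorem mpd_sum {ι : Type*} {s : Finset ι} {F : ι → Coord n → Matrix (Fin n) (Fin n) ℝ}
    (hT : IsOpen T) (hx : x ∈ T) (hF : ∀ i ∈ s, MSmooth T (F i)) :
    mpd (fun y => ∑ i ∈ s, F i y) c x = ∑ i ∈ s, mpd (F i) c x := by
  ext a b
  simp only [mpd, Matrix.of_apply, Matrix.sum_apply]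
  exact pd_sum _ fun i hi => differentiableAt_of_contDiffOn hT (hF i hi a b) hx

theorem mpd_comm {d : Fin n} (hT : IsOpen T) (hx : x ∈ T) (hF : MSmooth T F) :
    mpd (mpd F c) d x = mpd (mpd F d) c x := by
  ext a b
  exact pd_pd_comm ((hF a b).contDiffAt (hT.mem_nhds hx))

variable {κ : Type} [Fintype κ] [DecidableEq κ] {up : κ → Bool} {w : ℤ}
  {A : Coord n → (κ → Fin n) → ℝ}

theorem contDiffOn_frameAct {E : Type*} [NormedAddCommGroup E] [NormedSpace ℝ E] {U : Set E}
    {F : E → Matrix (Fin n) (Fin n) ℝ} {A : E → (κ → Fin n) → ℝ}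
    (hF : ∀ a b, ContDiffOn ℝ ∞ (fun y => F y a b) U) (hA : ∀ J, ContDiffOn ℝ ∞ (fun y => A y J) U)
    (I : κ → Fin n) : ContDiffOn ℝ ∞ (fun y => frameAct up w (F y) (A y) I) U := by
  unfold frameAct
  refine ContDiffOn.add (ContDiffOn.sum fun k _ => ContDiffOn.sum fun d _ => ?_)
    ((contDiffOn_const.mul (ContDiffOn.sum fun d _ => hF d d)).mul (hA I))
  refine ContDiffOn.mul ?_ (hA _)
  split_ifs
  · exact hF _ _
  · exact (hF _ _).neg

theorem hasDerivAt_frameAct {M : ℝ → Matrix (Fin n) (Fin n) ℝ} {M' : Matrix (Fin n) (Fin n) ℝ}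
    {S : ℝ → (κ → Fin n) → ℝ} {S' : (κ → Fin n) → ℝ} {t : ℝ}
    (hM : ∀ a d, HasDerivAt (fun t => M t a d) (M' a d) t)
    (hS : ∀ J, HasDerivAt (fun t => S t J) (S' J) t) (I : κ → Fin n) :
    HasDerivAt (fun t => frameAct up w (M t) (S t) I)
      (frameAct up w M' (S t) I + frameAct up w (M t) S' I) t := by
  unfold frameAct
  have h1 : ∀ k d, HasDerivAt (fun t => (if up k = true then M t (I k) d else -M t d (I k)))
      (if up k = true then M' (I k) d else -M' d (I k)) t := by
    intro k d
    split_ifs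
    · exact hM _ _
    · exact (hM _ _).neg
  have h2 : HasDerivAt (fun t => (w : ℝ) * (M t).trace) ((w : ℝ) * M'.trace) t :=
    (HasDerivAt.fun_sum fun d _ => hM d d).const_mul _
  have h3 := (HasDerivAt.fun_sum (u := Finset.univ) fun k _ => HasDerivAt.fun_sum (u := Finset.univ)
    fun d _ => (h1 k d).mul (hS (Function.update I k d))).add (h2.mul (hS I))
  refine h3.congr_deriv ?_
  simp only [Finset.sum_add_distrib]
  ring

theorem pd_frameAct (hT : IsOpen T) (hx : x ∈ T) (hF : MSmooth T F)
    (hA : ∀ J, ContDiffOn ℝ ∞ (fun y => A y J) T) (I : κ → Fin n) :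
    pd (fun y => frameAct up w (F y) (A y) I) c x
      = frameAct up w (mpd F c x) (A x) I + frameAct up w (F x) (fun J => pd (fun y => A y J) c x) I := by
  have h1 := pd_eq_deriv (c := c)
    (differentiableAt_of_contDiffOn hT (contDiffOn_frameAct (up := up) (w := w) hF hA I) hx)
  have h2 := hasDerivAt_frameAct (up := up) (w := w) (M := fun t => F (x + t • Pi.single c 1))
    (M' := mpd F c x) (S := fun t => A (x + t • Pi.single c 1)) (t := 0)
    (fun a d => pd_eq_deriv (c := c) (differentiableAt_of_contDiffOn hT (hF a d) hx))
    (fun J => pd_eq_deriv (c := c) (differentiableAt_of_contDiffOn hT (hA J) hx)) I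
  simpa using h1.unique h2

end MatrixDerivatives

/-! ## Lie derivatives and covariant derivatives -/

section Lie

variable {n : ℕ} {κ : Type} [Fintype κ] [DecidableEq κ]

/-- The matrices `(Γ_c)^a_d = Γ^a_{cd}`. -/
def connMatrix (Γ : ConnCoeff n) (c : Fin n) (x : Coord n) : Matrix (Fin n) (Fin n) ℝ :=
  Matrix.of fun a d => Γ x a c d

/-- The matrix `∂_d V^a`. -/
def jacMatrix (V : Coord n → Fin n → ℝ) (x : Coord n) : Matrix (Fin n) (Fin n) ℝ :=
  Matrix.of fun a d => pd (fun y => V y a) d x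

/-- The Lie derivative of a tensor density with indices labelled by `κ`. -/
def lieArr (V : Coord n → Fin n → ℝ) (up : κ → Bool) (w : ℤ) (A : Coord n → (κ → Fin n) → ℝ)
    (x : Coord n) (I : κ → Fin n) : ℝ :=
  ∑ d, V x d * pd (fun y => A y I) d x - frameAct up w (jacMatrix V x) (A x) I

theorem lieTensor_eq_lieArr (V : Coord n → Fin n → ℝ) (τ : TensorType)
    (A : Coord n → Idx n τ.rank → ℝ) : lieTensor V τ A = lieArr V τ.up τ.weight A := by
  funext x I
  unfold lieTensor lieArr frameAct
  have : ∀ (k : Fin τ.rank) (d : Fin n), (if τ.up k = true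
      then -(pd (fun y => V y (I k)) d x * A x (Function.update I k d))
      else pd (fun y => V y d) (I k) x * A x (Function.update I k d))
      = -((if τ.up k = true then jacMatrix V x (I k) d else -jacMatrix V x d (I k))
        * A x (Function.update I k d)) := by
    intro k d; simp only [jacMatrix, Matrix.of_apply]; split_ifs <;> ring
  simp only [this, Finset.sum_neg_distrib]
  have h2 : (jacMatrix V x).trace = ∑ d, pd (fun y => V y d) d x := rfl
  rw [h2]
  ring

theorem covD_eq {Γ : ConnCoeff n} {x : Coord n} (hΓ : ∀ a b c, Γ x a b c = Γ x a c b)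
    (up : κ → Bool) (w : ℤ) (A : Coord n → (κ → Fin n) → ℝ) (c : Fin n) (I : κ → Fin n) :
    covD Γ up w A x c I = pd (fun y => A y I) c x + frameAct up w (connMatrix Γ c x) (A x) I := by
  unfold covD frameAct
  have : ∀ (k : κ) (d : Fin n), (if up k = true then Γ x (I k) c d * A x (Function.update I k d)
        else -(Γ x d c (I k) * A x (Function.update I k d)))
      = (if up k = true then connMatrix Γ c x (I k) d else -connMatrix Γ c x d (I k))
        * A x (Function.update I k d) := by
    intro k d; simp only [connMatrix, Matrix.of_apply]; split_ifs <;> ring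
  simp only [this]
  -- The weight term of `covD` contracts the first lower index of `Γ`, the trace contracts the
  -- second one; torsion-freeness identifies them.
  have h2 : (connMatrix Γ c x).trace = ∑ d, Γ x d d c :=
    Finset.sum_congr rfl fun d _ => hΓ d c d
  rw [h2]
  ring

variable {T : Set (Coord n)} {V : Coord n → Fin n → ℝ} {Γ : ConnCoeff n}
  {up : κ → Bool} {w : ℤ} {A : Coord n → (κ → Fin n) → ℝ} {x : Coord n}

theorem mSmooth_jacMatrix (hT : IsOpen T) (hV : ∀ a, ContDiffOn ℝ ∞ (fun y => V y a) T) :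
    MSmooth T (jacMatrix V) := fun a _ => contDiffOn_pd hT (hV a)

theorem mSmooth_connMatrix (hΓ : ∀ a b c, ContDiffOn ℝ ∞ (fun y => Γ y a b c) T) (c : Fin n) :
    MSmooth T (connMatrix Γ c) := fun a d => hΓ a c d

/-- With `Γ_c` regarded as a matrix-valued one-form and `N = ∂V`, the variation is the Lie
derivative of a one-form, taken entrywise, plus the gauge variation `∂_c N + [Γ_c, N]`. In this form
the naturality identities reduce to noncommutative algebra. -/
theorem connMatrix_lieConn (V : Coord n → Fin n → ℝ) (Γ : ConnCoeff n) (c : Fin n) (x : Coord n) :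
    connMatrix (lieConn V Γ) c x = ∑ d, V x d • mpd (connMatrix Γ c) d x
      + ∑ d, pd (fun y => V y d) c x • connMatrix Γ d x + mpd (jacMatrix V) c x
      + connMatrix Γ c x * jacMatrix V x - jacMatrix V x * connMatrix Γ c x := by
  ext a b
  simp only [connMatrix, lieConn, mpd, jacMatrix, Matrix.of_apply, Matrix.add_apply,
    Matrix.sub_apply, Matrix.sum_apply, Matrix.smul_apply, Matrix.mul_apply, smul_eq_mul,
    Finset.sum_add_distrib, Finset.sum_sub_distrib]
  have h1 : ∑ d, Γ x a d b * pd (fun y => V y d) c x = ∑ d, pd (fun y => V y d) c x * Γ x a d b :=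
    Finset.sum_congr rfl fun d _ => mul_comm _ _
  have h2 : ∑ d, Γ x d c b * pd (fun y => V y a) d x = ∑ d, pd (fun y => V y a) d x * Γ x d c b :=
    Finset.sum_congr rfl fun d _ => mul_comm _ _
  have h3 : pd (pd (fun y => V y a) b) c x = pd (fun y => pd (fun y => V y a) b y) c x := rfl
  rw [h1, h2, h3]
  ring

theorem contDiffOn_lieArr (hT : IsOpen T) (hV : ∀ a, ContDiffOn ℝ ∞ (fun y => V y a) T)
    (hA : ∀ J, ContDiffOn ℝ ∞ (fun y => A y J) T) (I : κ → Fin n) :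
    ContDiffOn ℝ ∞ (fun y => lieArr V up w A y I) T :=
  (ContDiffOn.sum fun d _ => (hV d).mul (contDiffOn_pd hT (hA I))).sub
    (contDiffOn_frameAct (mSmooth_jacMatrix hT hV) hA I)

/-- The commutator of the Lie derivative and the covariant derivative. -/
theorem lie_covD (hT : IsOpen T) (hV : ∀ a, ContDiffOn ℝ ∞ (fun y => V y a) T)
    (hΓ : ∀ a b c, ContDiffOn ℝ ∞ (fun y => Γ y a b c) T)
    (hΓs : ∀ x ∈ T, ∀ a b c, Γ x a b c = Γ x a c b)
    (hA : ∀ J, ContDiffOn ℝ ∞ (fun y => A y J) T) (hx : x ∈ T) (c : Fin n) (I : κ → Fin n) :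
    covD Γ up w (lieArr V up w A) x c I
        + frameAct up w (connMatrix (lieConn V Γ) c x) (A x) I
      = ∑ d, V x d * pd (fun y => covD Γ up w A y c I) d x
        - frameAct up w (jacMatrix V x) (fun J => covD Γ up w A x c J) I
        + ∑ d, pd (fun y => V y d) c x * covD Γ up w A x d I := by
  have hN := mSmooth_jacMatrix hT hV
  have hG := mSmooth_connMatrix hΓ
  have hD : ∀ {f : Coord n → ℝ}, ContDiffOn ℝ ∞ f T → DifferentiableAt ℝ f x := fun hf =>
    differentiableAt_of_contDiffOn hT hf hx
  -- derivatives of the ingredients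
  have e1 : ∀ d J, pd (fun y => covD Γ up w A y c J) d x
      = pd (pd (fun y => A y J) c) d x + (frameAct up w (mpd (connMatrix Γ c) d x) (A x) J
        + frameAct up w (connMatrix Γ c x) (fun J => pd (fun y => A y J) d x) J) := by
    intro d J
    rw [pd_congr (g := fun y => pd (fun y => A y J) c y
      + frameAct up w (connMatrix Γ c y) (A y) J), pd_add (hD (contDiffOn_pd hT (hA J)))
      (hD (contDiffOn_frameAct (hG c) hA J)), pd_frameAct hT hx (hG c) hA]
    filter_upwards [hT.mem_nhds hx] with y hy
    exact covD_eq (hΓs y hy) up w A c J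
  have e2 : pd (fun y => lieArr V up w A y I) c x
      = ∑ d, (pd (fun y => V y d) c x * pd (fun y => A y I) d x
          + V x d * pd (pd (fun y => A y I) c) d x)
        - (frameAct up w (mpd (jacMatrix V) c x) (A x) I
          + frameAct up w (jacMatrix V x) (fun J => pd (fun y => A y J) c x) I) := by
    unfold lieArr
    rw [pd_sub (hD (ContDiffOn.sum fun d _ => (hV d).mul (contDiffOn_pd hT (hA I))))
      (hD (contDiffOn_frameAct hN hA I)), pd_frameAct hT hx hN hA,
      pd_sum _ fun d _ => hD ((hV d).mul (contDiffOn_pd hT (hA I)))]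
    congr 1
    refine Finset.sum_congr rfl fun d _ => ?_
    rw [pd_mul (hD (hV d)) (hD (contDiffOn_pd hT (hA I))),
      pd_pd_comm ((hA I).contDiffAt (hT.mem_nhds hx))]
  -- passing to vectors
  set ρ := frameActₗ (n := n) up w with hρ
  set t : (κ → Fin n) → ℝ := A x
  set p : Fin n → (κ → Fin n) → ℝ := fun d J => pd (fun y => A y J) d x with hp
  have e3 : (fun J => covD Γ up w A x c J) = p c + ρ (connMatrix Γ c x) t :=
    funext fun J => covD_eq (hΓs x hx) up w A c J
  have e4 : lieArr V up w A x = ∑ d, V x d • p d - ρ (jacMatrix V x) t := by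
    funext J
    simp [lieArr, hp, hρ, frameActₗ_apply, t]
  rw [covD_eq (hΓs x hx), e2, e4, e3]
  simp only [e1, covD_eq (hΓs x hx)]
  -- The second derivatives of `A` already agree. What is left is the commutator of the actions of
  -- `Γ_c` and `∂V`, supplied by the commutator term of `ℒ_V Γ`.
  have comm : ρ (connMatrix Γ c x) (ρ (jacMatrix V x) t) - ρ (jacMatrix V x) (ρ (connMatrix Γ c x) t)
      = ρ (connMatrix Γ c x * jacMatrix V x - jacMatrix V x * connMatrix Γ c x) t :=
    frameAct_commutator up w _ _ _
  have comm' := congrFun comm I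
  rw [connMatrix_lieConn]
  simp only [← frameActₗ_apply, ← hρ]
  change _ + ρ (connMatrix Γ c x) _ I + ρ _ t I = _
  simp only [map_add, map_sub, map_sum, map_smul, LinearMap.add_apply, LinearMap.sub_apply,
    LinearMap.sum_apply, LinearMap.smul_apply, Pi.add_apply, Pi.sub_apply, Finset.sum_apply,
    Pi.smul_apply, smul_eq_mul, mul_add, Finset.sum_add_distrib] at comm' ⊢
  linear_combination -comm'

end Lie

/-! ## One-parameter families -/

section Families

variable {n : ℕ} {T : Set (Coord n)} {u : ℝ → Coord n → ℝ}

/-- Families of functions on `T`, smooth in the parameter and the point. -/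
def JointSmooth (T : Set (Coord n)) (u : ℝ → Coord n → ℝ) : Prop :=
  ContDiffOn ℝ ∞ (fun p : ℝ × Coord n => u p.1 p.2) (Set.univ ×ˢ T)

theorem JointSmooth.contDiffAt (hT : IsOpen T) (hu : JointSmooth T u) (t : ℝ) {x : Coord n}
    (hx : x ∈ T) : ContDiffAt ℝ ∞ (fun p : ℝ × Coord n => u p.1 p.2) (t, x) :=
  ContDiffOn.contDiffAt hu ((isOpen_univ.prod hT).mem_nhds ⟨Set.mem_univ _, hx⟩)

theorem JointSmooth.pd_eq (hT : IsOpen T) (hu : JointSmooth T u) (t : ℝ) {x : Coord n}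
    (hx : x ∈ T) (c : Fin n) :
    pd (u t) c x = fderiv ℝ (fun p : ℝ × Coord n => u p.1 p.2) (t, x) (0, Pi.single c 1) := by
  have h := ((hu.contDiffAt hT t hx).differentiableAt (by simp)).hasFDerivAt
  have h2 : HasFDerivAt (fun y : Coord n => (t, y))
      ((0 : Coord n →L[ℝ] ℝ).prod (ContinuousLinearMap.id ℝ (Coord n))) x :=
    (hasFDerivAt_const t x).prodMk (hasFDerivAt_id x)
  have h3 := HasFDerivAt.comp (g := fun p : ℝ × Coord n => u p.1 p.2) (f := fun y => (t, y)) x h h2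
  change HasFDerivAt (u t) _ x at h3
  simp [pd, h3.fderiv]

theorem JointSmooth.hasDerivAt (hT : IsOpen T) (hu : JointSmooth T u) (t : ℝ) {x : Coord n}
    (hx : x ∈ T) : HasDerivAt (fun t => u t x)
      (fderiv ℝ (fun p : ℝ × Coord n => u p.1 p.2) (t, x) (1, 0)) t := by
  have h := ((hu.contDiffAt hT t hx).differentiableAt (by simp)).hasFDerivAt
  have h2 : HasDerivAt (fun s : ℝ => (s, x)) ((1 : ℝ), (0 : Coord n)) t :=
    (hasDerivAt_id t).prodMk (hasDerivAt_const t x)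
  exact h.comp_hasDerivAt t h2

theorem JointSmooth.pd (hT : IsOpen T) (hu : JointSmooth T u) (c : Fin n) :
    JointSmooth T (fun t => pd (u t) c) := by
  have : ContDiffOn ℝ ∞ (fun p : ℝ × Coord n =>
      fderiv ℝ (fun p : ℝ × Coord n => u p.1 p.2) p (0, Pi.single c 1)) (Set.univ ×ˢ T) :=
    (ContDiffOn.fderiv_of_isOpen hu (isOpen_univ.prod hT) (m := ∞) (by simp)).clm_apply
      contDiffOn_const
  exact this.congr fun p hp => hu.pd_eq hT p.1 hp.2 c

theorem JointSmooth.slice (hu : JointSmooth T u) (t : ℝ) : ContDiffOn ℝ ∞ (u t) T :=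
  ContDiffOn.comp hu (g := fun p : ℝ × Coord n => u p.1 p.2) (f := fun y => (t, y))
    (contDiff_const.prodMk contDiff_id).contDiffOn fun _ hy => ⟨Set.mem_univ _, hy⟩

/-- The parameter derivative and the coordinate derivative commute because the second derivative of
the joint function of `(t, x)` is symmetric. -/
theorem JointSmooth.hasDerivAt_pd (hT : IsOpen T) (hu : JointSmooth T u) (t : ℝ) {x : Coord n}
    (hx : x ∈ T) (c : Fin n) : HasDerivAt (fun t => Palatini.pd (u t) c x)
      (Palatini.pd (fun y => deriv (fun t => u t y) t) c x) t := by
  have hs := (hu.contDiffAt hT t hx).isSymmSndFDerivAt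
    (by simpa using WithTop.coe_le_coe.2 (OrderTop.le_top (2 : ℕ∞)))
  have hd := (((hu.contDiffAt hT t hx).fderiv_right (m := 1) (by norm_cast)).differentiableAt
      (by norm_num)).hasFDerivAt
  have ht := fun s => hu.pd_eq hT s hx c
  have hy := fun y (hy : y ∈ T) => (hu.hasDerivAt hT t hy).deriv
  generalize (fun p : ℝ × Coord n => u p.1 p.2) = U at hs hd ht hy
  have hd' : ∀ v, HasFDerivAt (fun p => fderiv ℝ U p v) ((fderiv ℝ (fderiv ℝ U) (t, x)).flip v)
      (t, x) := fun v =>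
    ((ContinuousLinearMap.apply ℝ ℝ v).hasFDerivAt.comp (t, x) hd).congr_fderiv (by ext <;> simp)
  have hl : HasDerivAt (fun s : ℝ => (s, x)) ((1 : ℝ), (0 : Coord n)) t :=
    (hasDerivAt_id t).prodMk (hasDerivAt_const t x)
  have hr : HasFDerivAt (fun y : Coord n => (t, y))
      ((0 : Coord n →L[ℝ] ℝ).prod (ContinuousLinearMap.id ℝ (Coord n))) x :=
    (hasFDerivAt_const t x).prodMk (hasFDerivAt_id x)
  have h1 := (hd' (0, Pi.single c 1)).comp_hasDerivAt t hl
  have h2 := HasFDerivAt.comp (g := fun p => fderiv ℝ U p (1, 0)) (f := fun y => (t, y)) x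
    (hd' (1, 0)) hr
  have h3 : Palatini.pd (fun y => deriv (fun t => u t y) t) c x
      = fderiv ℝ (fderiv ℝ U) (t, x) (0, Pi.single c 1) (1, 0) := by
    rw [pd_congr (g := (fun p => fderiv ℝ U p (1, 0)) ∘ fun y => (t, y))]
    · simp [Palatini.pd, h2.fderiv]
    · filter_upwards [hT.mem_nhds hx] with y hyT using hy y hyT
  rw [h3, funext ht]
  exact h1.congr_deriv (hs _ _)

theorem JointSmooth.affine {f h : Coord n → ℝ} (hf : ContDiffOn ℝ ∞ f T)
    (hh : ContDiffOn ℝ ∞ h T) : JointSmooth T (fun t x => f x + t * h x) := by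
  have hm : Set.MapsTo (Prod.snd : ℝ × Coord n → Coord n) (Set.univ ×ˢ T) T := fun p hp => hp.2
  exact (hf.comp contDiff_snd.contDiffOn hm).add
    (contDiff_fst.contDiffOn.mul (hh.comp contDiff_snd.contDiffOn hm))

theorem deriv_affine (f h : ℝ) (t : ℝ) : deriv (fun t : ℝ => f + t * h) t = h := by
  simp

end Families

/-! ## Variations along a vector field -/

section Variation

variable {n : ℕ} {T : Set (Coord n)} {V : Coord n → Fin n → ℝ} {Γ : ConnCoeff n}

theorem contDiffOn_lieConn (hT : IsOpen T) (hV : ∀ a, ContDiffOn ℝ ∞ (fun y => V y a) T)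
    (hΓ : ∀ a b c, ContDiffOn ℝ ∞ (fun y => Γ y a b c) T) (a b c : Fin n) :
    ContDiffOn ℝ ∞ (fun y => lieConn V Γ y a b c) T := by
  have h1 : ∀ d a, ContDiffOn ℝ ∞ (pd (fun y => V y a) d) T := fun d a => contDiffOn_pd hT (hV a)
  refine (ContDiffOn.sum fun d _ => ?_).add (contDiffOn_pd hT (h1 c a))
  exact ((((hV d).mul (contDiffOn_pd hT (hΓ a b c))).sub ((hΓ d b c).mul (h1 d a))).add
    ((hΓ a d c).mul (h1 b d))).add ((hΓ a b d).mul (h1 c d))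

theorem lieConn_symm (hT : IsOpen T) (hV : ∀ a, ContDiffOn ℝ ∞ (fun y => V y a) T)
    (hΓs : ∀ x ∈ T, ∀ a b c, Γ x a b c = Γ x a c b) {x : Coord n} (hx : x ∈ T) (a b c : Fin n) :
    lieConn V Γ x a b c = lieConn V Γ x a c b := by
  unfold lieConn
  rw [pd_pd_comm ((hV a).contDiffAt (hT.mem_nhds hx))]
  congr 1
  refine Finset.sum_congr rfl fun d _ => ?_
  have h : pd (fun y => Γ y a b c) d x = pd (fun y => Γ y a c b) d x :=
    pd_congr (by filter_upwards [hT.mem_nhds hx] with y hy using hΓs y hy a b c)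
  rw [h, hΓs x hx d b c, hΓs x hx a d c, hΓs x hx a b d]
  ring

/-- The connection `Γ + t ℒ_V Γ`. -/
def flowConn (V : Coord n → Fin n → ℝ) (Γ : ConnCoeff n) (t : ℝ) : ConnCoeff n :=
  fun x a b c => Γ x a b c + t * lieConn V Γ x a b c

theorem flowConn_zero : flowConn V Γ 0 = Γ := by
  funext x a b c; simp [flowConn]

/-- Families of tensor densities whose derivative at `t = 0` is the Lie derivative along `V`. -/
structure LieVariation {κ : Type} [Fintype κ] [DecidableEq κ] (T : Set (Coord n))
    (V : Coord n → Fin n → ℝ) (up : κ → Bool) (w : ℤ) (F : ℝ → Coord n → (κ → Fin n) → ℝ) :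
    Prop where
  smooth : ∀ J, JointSmooth T fun t x => F t x J
  deriv_eq : ∀ x ∈ T, ∀ J, deriv (fun t => F t x J) 0 = lieArr V up w (F 0) x J

variable {κ : Type} [Fintype κ] [DecidableEq κ] {up : κ → Bool} {w : ℤ}
  {F : ℝ → Coord n → (κ → Fin n) → ℝ}

theorem jointSmooth_covD (hT : IsOpen T) {G : ℝ → ConnCoeff n}
    (hG : ∀ a b c, JointSmooth T fun t x => G t x a b c)
    (hGs : ∀ t, ∀ x ∈ T, ∀ a b c, G t x a b c = G t x a c b)
    (hF : ∀ J, JointSmooth T fun t x => F t x J) (c : Fin n) (I : κ → Fin n) :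
    JointSmooth T (fun t x => covD (G t) up w (F t) x c I) := by
  have h1 : ContDiffOn ℝ ∞ (fun p : ℝ × Coord n =>
      frameAct up w (connMatrix (G p.1) c p.2) (F p.1 p.2) I) (Set.univ ×ˢ T) :=
    contDiffOn_frameAct (fun a d => hG a c d) hF I
  exact (ContDiffOn.add ((hF I).pd hT c) h1).congr fun p hp =>
    covD_eq (hGs p.1 p.2 hp.2) up w (F p.1) c I

variable (hT : IsOpen T) (hV : ∀ a, ContDiffOn ℝ ∞ (fun y => V y a) T)
  (hΓ : ∀ a b c, ContDiffOn ℝ ∞ (fun y => Γ y a b c) T)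
  (hΓs : ∀ x ∈ T, ∀ a b c, Γ x a b c = Γ x a c b)

include hT hV hΓ hΓs

omit hΓs in
theorem jointSmooth_flowConn (a b c : Fin n) : JointSmooth T fun t x => flowConn V Γ t x a b c :=
  JointSmooth.affine (hΓ a b c) (contDiffOn_lieConn hT hV hΓ a b c)

omit hΓ in
theorem flowConn_symm (t : ℝ) (x : Coord n) (hx : x ∈ T) (a b c : Fin n) :
    flowConn V Γ t x a b c = flowConn V Γ t x a c b := by
  simp only [flowConn]
  rw [hΓs x hx a b c, lieConn_symm hT hV hΓs hx a b c]

/-- By the product rule the variation is `∇_c (ℒ_V F) + (ℒ_V Γ)_c · F`, which `lie_covD` turns into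
the Lie derivative of `∇F`. The second derivatives of `V` in the two summands thereby cancel. -/
theorem LieVariation.deriv_covD (hF : LieVariation T V up w F) {x : Coord n} (hx : x ∈ T)
    (c : Fin n) (I : κ → Fin n) :
    deriv (fun t => covD (flowConn V Γ t) up w (F t) x c I) 0
      = ∑ d, V x d * pd (fun y => covD Γ up w (F 0) y c I) d x
        - frameAct up w (jacMatrix V x) (fun J => covD Γ up w (F 0) x c J) I
        + ∑ d, pd (fun y => V y d) c x * covD Γ up w (F 0) x d I := by
  rw [← lie_covD hT hV hΓ hΓs (fun J => (hF.smooth J).slice 0) hx c I]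
  have e : (fun t => covD (flowConn V Γ t) up w (F t) x c I)
      = fun t => pd (fun y => F t y I) c x
        + frameAct up w (connMatrix (flowConn V Γ t) c x) (F t x) I :=
    funext fun t => covD_eq (flowConn_symm hT hV hΓs t x hx) up w (F t) c I
  have h1 := (hF.smooth I).hasDerivAt_pd hT 0 hx c
  have h2 := hasDerivAt_frameAct (up := up) (w := w) (t := 0)
    (M := fun t => connMatrix (flowConn V Γ t) c x) (M' := connMatrix (lieConn V Γ) c x)
    (S := fun t => F t x) (S' := lieArr V up w (F 0) x)
    (fun a d => by
      have := ((hasDerivAt_id (0 : ℝ)).mul_const (lieConn V Γ x a c d)).const_add (Γ x a c d)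
      simpa [connMatrix, flowConn] using this)
    (fun J => by
      rw [← hF.deriv_eq x hx J]
      exact ((hF.smooth J).hasDerivAt hT 0 hx).differentiableAt.hasDerivAt) I
  rw [e, (h1.fun_add h2).deriv, covD_eq (hΓs x hx), flowConn_zero,
    pd_congr (g := fun y => lieArr V up w (F 0) y I)]
  · ring
  · filter_upwards [hT.mem_nhds hx] with y hy using hF.deriv_eq y hy I

/-- Covariant differentiation preserves variations along `V`. -/
theorem LieVariation.join (hF : LieVariation T V up w F) {κ' : Type} [Fintype κ'] [DecidableEq κ']
    {up' : κ' → Bool} {k₀ : κ'} {s : κ → κ'} (hsum : ∀ f : κ' → ℝ, ∑ k, f k = f k₀ + ∑ k, f (s k))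
    (hs : Function.Injective s) (hne : ∀ k, s k ≠ k₀) (h₀ : up' k₀ = false)
    (hup : ∀ k, up' (s k) = up k) :
    LieVariation T V up' w
      (fun t x J => covD (flowConn V Γ t) up w (F t) x (J k₀) (J ∘ s)) where
  smooth J := jointSmooth_covD hT (jointSmooth_flowConn hT hV hΓ)
    (flowConn_symm hT hV hΓs) hF.smooth _ _
  deriv_eq x hx J := by
    rw [hF.deriv_covD hT hV hΓ hΓs hx, flowConn_zero]
    unfold lieArr
    rw [frameAct_join up w up' k₀ s hsum hs hne h₀ hup (jacMatrix V x)
      (fun c J => covD Γ up w (F 0) x c J) J]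
    simp only [jacMatrix, Matrix.of_apply]
    ring

theorem LieVariation.nablaIter {τ : TensorType} {F : ℝ → Coord n → Idx n τ.rank → ℝ}
    (hF : LieVariation T V τ.up τ.weight F) (i : ℕ) :
    LieVariation T V (Sum.elim (fun _ : Fin i => false) τ.up) τ.weight
      (fun t x J => nablaIter (flowConn V Γ t) τ (F t) i x (J ∘ Sum.inl) (J ∘ Sum.inr)) := by
  induction i with
  | zero =>
    refine ⟨fun J => hF.smooth _, fun x hx J => ?_⟩
    change deriv (fun t => F t x (J ∘ Sum.inr)) 0 = _
    rw [hF.deriv_eq x hx]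
    unfold lieArr
    congr 1
    unfold frameAct
    rw [Fintype.sum_sum_type]
    have e : ∀ k d, Function.update J (Sum.inr k) d ∘ Sum.inr
        = Function.update (J ∘ Sum.inr) k d := fun k d => by
      funext l
      by_cases h : l = k
      · subst h; simp
      · simp [Function.update_of_ne h]
    simp only [Finset.univ_eq_empty, Finset.sum_empty, zero_add, Sum.elim_inr, Palatini.nablaIter, e]
    rfl
  | succ i ih =>
    -- The newest derivative index is the first one, `Sum.inl 0`; the older derivative indices are
    -- shifted by `Fin.succ` and the tensor indices stay in place.
    have h := ih.join hT hV hΓ hΓs (κ' := Fin (i + 1) ⊕ Fin τ.rank)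
      (up' := Sum.elim (fun _ : Fin (i + 1) => false) τ.up) (k₀ := Sum.inl 0)
      (s := Sum.map Fin.succ id)
      (fun f => by
        simp only [Fintype.sum_sum_type, Fin.sum_univ_succ, Sum.map_inl, Sum.map_inr, id]
        ring)
      (Function.Injective.sumMap (Fin.succ_injective _) Function.injective_id)
      (fun k => by rcases k with k | k <;> simp [Fin.succ_ne_zero]) rfl
      (fun k => by rcases k with k | k <;> rfl)
    convert! h using 1
    funext t x J
    have : (J ∘ Sum.map Fin.succ id : Fin i ⊕ Fin τ.rank → Fin n)
        = Sum.elim (Fin.tail (J ∘ Sum.inl)) (J ∘ Sum.inr) := by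
      funext k; rcases k with k | k <;> rfl
    rw [this]
    rfl

omit hT hV hΓ hΓs in
/-- The curvature as a matrix-valued two-form. -/
theorem curvature_eq (Γ : ConnCoeff n) (x : Coord n) (I : Idx n 4) :
    curvature Γ x I = (mpd (connMatrix Γ (I 3)) (I 2) x - mpd (connMatrix Γ (I 2)) (I 3) x
      + connMatrix Γ (I 2) x * connMatrix Γ (I 3) x
      - connMatrix Γ (I 3) x * connMatrix Γ (I 2) x) (I 0) (I 1) := by
  simp only [curvature, mpd, connMatrix, Matrix.of_apply, Matrix.add_apply, Matrix.sub_apply,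
    Matrix.mul_apply, Finset.sum_sub_distrib]
  ring

/-- The curvature matrix `(R_{cd})^a_b`. -/
def curvMatrix (Γ : ConnCoeff n) (c d : Fin n) (x : Coord n) : Matrix (Fin n) (Fin n) ℝ :=
  mpd (connMatrix Γ d) c x - mpd (connMatrix Γ c) d x
      + connMatrix Γ c x * connMatrix Γ d x - connMatrix Γ d x * connMatrix Γ c x

omit hΓs in
-- Naturality of the curvature two-form `dΓ + Γ ∧ Γ`, linearized along `V`. The third derivatives of
-- `V`, and the terms in which `∂_c ∂_d V^e` multiplies `Γ_e`, are symmetric in `c, d` and drop out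
-- of the antisymmetrization; the remainder is matrix algebra.
theorem lie_curvMatrix {x : Coord n} (hx : x ∈ T) (c d : Fin n) :
    mpd (connMatrix (lieConn V Γ) d) c x - mpd (connMatrix (lieConn V Γ) c) d x
      + (connMatrix (lieConn V Γ) c x * connMatrix Γ d x
        + connMatrix Γ c x * connMatrix (lieConn V Γ) d x)
      - (connMatrix (lieConn V Γ) d x * connMatrix Γ c x
        + connMatrix Γ d x * connMatrix (lieConn V Γ) c x)
      = ∑ e, V x e • mpd (curvMatrix Γ c d) e x
        - (jacMatrix V x * curvMatrix Γ c d x - curvMatrix Γ c d x * jacMatrix V x)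
        + ∑ e, pd (fun y => V y e) c x • curvMatrix Γ e d x
        + ∑ e, pd (fun y => V y e) d x • curvMatrix Γ c e x := by
  have hN := mSmooth_jacMatrix hT hV
  have hG := mSmooth_connMatrix hΓ
  have hdG : ∀ c e, MSmooth T (mpd (connMatrix Γ c) e) := fun c e => (hG c).mpd hT
  have hdV : ∀ c e, ContDiffOn ℝ ∞ (pd (fun y => V y e) c) T := fun c e => contDiffOn_pd hT (hV e)
  have dη : ∀ c d, mpd (connMatrix (lieConn V Γ) d) c x
      = ∑ e, (pd (fun y => V y e) c x • mpd (connMatrix Γ d) e x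
          + V x e • mpd (mpd (connMatrix Γ d) c) e x)
        + ∑ e, (pd (pd (fun y => V y e) d) c x • connMatrix Γ e x
          + pd (fun y => V y e) d x • mpd (connMatrix Γ e) c x)
        + mpd (mpd (jacMatrix V) d) c x
        + (mpd (connMatrix Γ d) c x * jacMatrix V x + connMatrix Γ d x * mpd (jacMatrix V) c x)
        - (mpd (jacMatrix V) c x * connMatrix Γ d x
          + jacMatrix V x * mpd (connMatrix Γ d) c x) := by
    intro c d
    have m1 : ∀ e ∈ Finset.univ, MSmooth T fun y => V y e • mpd (connMatrix Γ d) e y :=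
      fun e _ => MSmooth.smul (hV e) (hdG d e)
    have m2 : ∀ e ∈ Finset.univ, MSmooth T fun y => pd (fun y => V y e) d y • connMatrix Γ e y :=
      fun e _ => MSmooth.smul (hdV d e) (hG e)
    rw [funext (connMatrix_lieConn V Γ d), mpd_sub hT hx
        ((((MSmooth.sum m1).add (MSmooth.sum m2)).add (hN.mpd hT)).add ((hG d).mul hN))
        (hN.mul (hG d)),
      mpd_add hT hx (((MSmooth.sum m1).add (MSmooth.sum m2)).add (hN.mpd hT)) ((hG d).mul hN),
      mpd_add hT hx ((MSmooth.sum m1).add (MSmooth.sum m2)) (hN.mpd hT),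
      mpd_add hT hx (MSmooth.sum m1) (MSmooth.sum m2), mpd_sum hT hx m1, mpd_sum hT hx m2,
      mpd_mul hT hx (hG d) hN, mpd_mul hT hx hN (hG d)]
    have s1 : ∀ e, mpd (fun y => V y e • mpd (connMatrix Γ d) e y) c x
        = pd (fun y => V y e) c x • mpd (connMatrix Γ d) e x
          + V x e • mpd (mpd (connMatrix Γ d) c) e x := fun e => by
      rw [mpd_smul hT hx (hV e) (hdG d e), mpd_comm hT hx (hG d)]
    have s2 : ∀ e, mpd (fun y => pd (fun y => V y e) d y • connMatrix Γ e y) c x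
        = pd (pd (fun y => V y e) d) c x • connMatrix Γ e x
          + pd (fun y => V y e) d x • mpd (connMatrix Γ e) c x := fun e =>
      mpd_smul hT hx (hdV d e) (hG e)
    simp only [s1, s2]
  have dR : ∀ e, mpd (curvMatrix Γ c d) e x
      = mpd (mpd (connMatrix Γ d) c) e x - mpd (mpd (connMatrix Γ c) d) e x
        + (mpd (connMatrix Γ c) e x * connMatrix Γ d x + connMatrix Γ c x * mpd (connMatrix Γ d) e x)
        - (mpd (connMatrix Γ d) e x * connMatrix Γ c x
          + connMatrix Γ d x * mpd (connMatrix Γ c) e x) := by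
    intro e
    unfold curvMatrix
    rw [mpd_sub hT hx (((hdG d c).sub (hdG c d)).add ((hG c).mul (hG d))) ((hG d).mul (hG c)),
      mpd_add hT hx ((hdG d c).sub (hdG c d)) ((hG c).mul (hG d)),
      mpd_sub hT hx (hdG d c) (hdG c d), mpd_mul hT hx (hG c) (hG d), mpd_mul hT hx (hG d) (hG c)]
  have sV : ∀ e, pd (pd (fun y => V y e) d) c x = pd (pd (fun y => V y e) c) d x := fun e =>
    pd_pd_comm ((hV e).contDiffAt (hT.mem_nhds hx))
  rw [dη c d, dη d c, connMatrix_lieConn V Γ c, connMatrix_lieConn V Γ d, mpd_comm hT hx hN (c := d)]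
  simp only [dR, sV, curvMatrix, smul_add, smul_sub, Finset.sum_add_distrib, Finset.sum_sub_distrib,
    add_mul, sub_mul, mul_add, mul_sub, Finset.sum_mul, Finset.mul_sum, smul_mul_assoc,
    mul_smul_comm, mul_assoc]
  abel

omit hΓs in
theorem lieVariation_curvature :
    LieVariation T V curvatureType.up 0 (fun t => curvature (flowConn V Γ t)) where
  smooth J := by
    have hG := jointSmooth_flowConn hT hV hΓ
    exact ((((hG _ _ _).pd hT _).sub ((hG _ _ _).pd hT _)).add
      (ContDiffOn.sum fun e _ => ((hG _ _ _).mul (hG _ _ _)).sub ((hG _ _ _).mul (hG _ _ _))) :)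
  deriv_eq x hx J := by
    have hG := jointSmooth_flowConn hT hV hΓ
    have d0 : ∀ a b c, HasDerivAt (fun t => flowConn V Γ t x a b c) (lieConn V Γ x a b c) 0 :=
      fun a b c => by
        have := ((hasDerivAt_id (0 : ℝ)).mul_const (lieConn V Γ x a b c)).const_add (Γ x a b c)
        simpa [flowConn] using this
    have d1 : ∀ a b c e, HasDerivAt (fun t => pd (fun y => flowConn V Γ t y a b c) e x)
        (pd (fun y => lieConn V Γ y a b c) e x) 0 := fun a b c e => by
      have := (hG a b c).hasDerivAt_pd hT 0 hx e
      simpa only [flowConn, deriv_affine] using this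
    have d2 := ((d1 (J 0) (J 3) (J 1) (J 2)).sub (d1 (J 0) (J 2) (J 1) (J 3))).add
      (HasDerivAt.fun_sum (u := Finset.univ) fun e _ =>
        ((d0 (J 0) (J 2) e).mul (d0 e (J 3) (J 1))).sub ((d0 (J 0) (J 3) e).mul (d0 e (J 2) (J 1))))
    have d3 : deriv (fun t => curvature (flowConn V Γ t) x J) 0 = _ := d2.deriv
    rw [d3, flowConn_zero]
    have key := congrFun (congrFun (lie_curvMatrix hT hV hΓ hx (J 2) (J 3)) (J 0)) (J 1)
    have hR : ∀ (y : Coord n) (I : Idx n 4), curvature Γ y I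
        = curvMatrix Γ (I 2) (I 3) y (I 0) (I 1) := curvature_eq Γ
    unfold lieArr frameAct
    simp only [hR, Fin.sum_univ_four]
    simp only [mpd, connMatrix, Matrix.of_apply, Matrix.add_apply, Matrix.sub_apply,
      Matrix.mul_apply, Matrix.sum_apply, Matrix.smul_apply, smul_eq_mul] at key
    simp [jacMatrix, Function.update, Fin.ext_iff]
    simp only [Finset.sum_add_distrib, jacMatrix, Matrix.of_apply] at key ⊢
    have c1 : ∑ e, curvMatrix Γ (J 2) (J 3) x (J 0) e * pd (fun y => V y e) (J 1) x
        = ∑ e, pd (fun y => V y e) (J 1) x * curvMatrix Γ (J 2) (J 3) x (J 0) e :=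
      Finset.sum_congr rfl fun e _ => mul_comm _ _
    rw [c1] at key
    linear_combination key

theorem lieVariation_nonmetricity {g : ℝ → Coord n → Idx n 2 → ℝ}
    (hg : LieVariation T V (covariantType 2).up 0 g) :
    LieVariation T V (covariantType 3).up 0
      (fun t => nonmetricity (g t) (flowConn V Γ t)) := by
  have h := hg.join hT hV hΓ hΓs (κ' := Fin 3) (up' := fun _ => false) (k₀ := 0) (s := Fin.succ)
    (fun f => Fin.sum_univ_succ f) (Fin.succ_injective _) Fin.succ_ne_zero rfl (fun _ => rfl)
  convert! h using 1
  funext t x J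
  have : (J ∘ Fin.succ : Fin 2 → Fin n) = ![J 1, J 2] := by
    funext k; fin_cases k <;> rfl
  rw [this]
  rfl

omit hΓ hΓs in
theorem lieVariation_affine {τ : TensorType} {A : Coord n → Idx n τ.rank → ℝ}
    (hA : ∀ J, ContDiffOn ℝ ∞ (fun y => A y J) T) :
    LieVariation T V τ.up τ.weight (fun t x I => A x I + t * lieTensor V τ A x I) where
  smooth J := by
    refine JointSmooth.affine (hA J) ?_
    rw [lieTensor_eq_lieArr]
    exact contDiffOn_lieArr hT hV hA J
  deriv_eq x hx J := by
    rw [deriv_affine, lieTensor_eq_lieArr]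
    simp

end Variation

/-! ## The Noether current as a differential operator -/

section FirstOrder

variable {n : ℕ} {T : Set (Coord n)}

/-- First order differential operators on vector fields. -/
def FirstOrder (T : Set (Coord n)) (G : (Coord n → Fin n → ℝ) → Coord n → ℝ) : Prop :=
  ∃ (A : Coord n → Fin n → ℝ) (B : Coord n → Fin n → Fin n → ℝ), ∀ V : Coord n → Fin n → ℝ,
    (∀ a, ContDiffOn ℝ ∞ (fun y => V y a) T) → ∀ x ∈ T,
      G V x = ∑ a, A x a * V x a + ∑ c, ∑ a, B x c a * pd (fun y => V y a) c x

variable {G H : (Coord n → Fin n → ℝ) → Coord n → ℝ}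

theorem FirstOrder.congr (hG : FirstOrder T G)
    (h : ∀ V : Coord n → Fin n → ℝ, (∀ a, ContDiffOn ℝ ∞ (fun y => V y a) T) → ∀ x ∈ T,
      H V x = G V x) : FirstOrder T H := by
  obtain ⟨A, B, hAB⟩ := hG
  exact ⟨A, B, fun V hV x hx => by rw [h V hV x hx, hAB V hV x hx]⟩

theorem FirstOrder.add (hG : FirstOrder T G) (hH : FirstOrder T H) :
    FirstOrder T fun V x => G V x + H V x := by
  obtain ⟨A, B, hAB⟩ := hG
  obtain ⟨A', B', hAB'⟩ := hH
  refine ⟨fun x a => A x a + A' x a, fun x c a => B x c a + B' x c a, fun V hV x hx => ?_⟩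
  simp only [hAB V hV x hx, hAB' V hV x hx, add_mul, Finset.sum_add_distrib]
  ring

theorem FirstOrder.mul_left (r : Coord n → ℝ) (hG : FirstOrder T G) :
    FirstOrder T fun V x => r x * G V x := by
  obtain ⟨A, B, hAB⟩ := hG
  refine ⟨fun x a => r x * A x a, fun x c a => r x * B x c a, fun V hV x hx => ?_⟩
  simp only [hAB V hV x hx, mul_add, Finset.mul_sum, mul_assoc]

theorem FirstOrder.zero : FirstOrder T fun _ _ => 0 :=
  ⟨fun _ _ => 0, fun _ _ _ => 0, by simp⟩

theorem FirstOrder.sum {ι : Type*} (s : Finset ι) {G : ι → (Coord n → Fin n → ℝ) → Coord n → ℝ}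
    (hG : ∀ i, FirstOrder T (G i)) : FirstOrder T fun V x => ∑ i ∈ s, G i V x := by
  classical
  induction s using Finset.induction_on with
  | empty => simpa using FirstOrder.zero
  | insert i s hi ih => simpa [Finset.sum_insert hi] using (hG i).add ih

theorem FirstOrder.value (a : Fin n) : FirstOrder T fun V x => V x a :=
  ⟨fun _ b => if b = a then 1 else 0, fun _ _ _ => 0, by simp⟩

theorem FirstOrder.derivative (a c : Fin n) : FirstOrder T fun V x => pd (fun y => V y a) c x :=
  ⟨fun _ _ => 0, fun _ d b => if d = c then (if b = a then 1 else 0) else 0, by simp⟩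

theorem FirstOrder.lieArr {κ : Type} [Fintype κ] [DecidableEq κ] (up : κ → Bool) (w : ℤ)
    (A : Coord n → (κ → Fin n) → ℝ) (I : κ → Fin n) :
    FirstOrder T fun V x => lieArr V up w A x I := by
  have h1 : FirstOrder T fun V x => ∑ d, pd (fun y => A y I) d x * V x d :=
    FirstOrder.sum _ fun d => (FirstOrder.value d).mul_left _
  have h2 : FirstOrder T fun V x => ∑ k, ∑ d, (-A x (Function.update I k d)) *
      (if up k = true then pd (fun y => V y (I k)) d x else -1 * pd (fun y => V y d) (I k) x) :=
    FirstOrder.sum _ fun k => FirstOrder.sum _ fun d => FirstOrder.mul_left _ (by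
      split_ifs
      · exact FirstOrder.derivative _ _
      · exact (FirstOrder.derivative _ _).mul_left fun _ => -1)
  have h3 : FirstOrder T fun V x => ∑ d, (-(w : ℝ) * A x I) * pd (fun y => V y d) d x :=
    FirstOrder.sum _ fun d => (FirstOrder.derivative d d).mul_left _
  refine ((h1.add h2).add h3).congr fun V _ x _ => ?_
  unfold Palatini.lieArr frameAct
  have e2 : ∀ k d, (-A x (Function.update I k d)) *
      (if up k = true then pd (fun y => V y (I k)) d x else -1 * pd (fun y => V y d) (I k) x)
      = -((if up k = true then jacMatrix V x (I k) d else -jacMatrix V x d (I k))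
        * A x (Function.update I k d)) := fun k d => by
    simp only [jacMatrix, Matrix.of_apply]; split_ifs <;> ring
  simp only [e2, Finset.sum_neg_distrib, ← Finset.mul_sum]
  have e3 : (jacMatrix V x).trace = ∑ d, pd (fun y => V y d) d x := rfl
  have e4 : ∑ d, pd (fun y => A y I) d x * V x d = ∑ d, V x d * pd (fun y => A y I) d x :=
    Finset.sum_congr rfl fun d _ => mul_comm _ _
  rw [e3, e4]
  ring

theorem FirstOrder.thetaTensor {Γ : ConnCoeff n} {τ : TensorType} {K : ℕ}
    {P : (m : ℕ) → Coord n → Idx n m → Idx n τ.rank → ℝ}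
    {δT : (Coord n → Fin n → ℝ) → (i : ℕ) → Coord n → Idx n i → Idx n τ.rank → ℝ}
    (h : ∀ i a I, FirstOrder T fun V x => δT V i x a I) (c : Fin n) :
    FirstOrder T fun V x => thetaTensor Γ τ K P (fun i a I => δT V i x a I) x c := by
  unfold Palatini.thetaTensor
  exact FirstOrder.sum _ fun i => FirstOrder.sum _ fun a => FirstOrder.sum _ fun I =>
    (h i a I).mul_left _

end FirstOrder

/-! ### The Noether current is of second order with principal symbol `2 E_R` -/

section Current

variable {n : ℕ} {L : Theory n} {φ : LocalFields L} {T : Set (Coord n)}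

/-- The variation is the Lie derivative of the fixed tensor `∇⋯∇F₀`. The condition `hF₀` makes the
unvaried field independent of `V`, so that the coefficients of the operator are too. -/
theorem FirstOrder.nablaIter {Γ : ConnCoeff n} (hT : IsOpen T)
    (hΓ : ∀ a b c, ContDiffOn ℝ ∞ (fun y => Γ y a b c) T)
    (hΓs : ∀ x ∈ T, ∀ a b c, Γ x a b c = Γ x a c b) {τ : TensorType}
    {F : (Coord n → Fin n → ℝ) → ℝ → Coord n → Idx n τ.rank → ℝ} {F₀ : Coord n → Idx n τ.rank → ℝ}
    (hF : ∀ V : Coord n → Fin n → ℝ, (∀ a, ContDiffOn ℝ ∞ (fun y => V y a) T) →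
      LieVariation T V τ.up τ.weight (F V)) (hF₀ : ∀ V, F V 0 = F₀) (i : ℕ) (a : Idx n i)
    (I : Idx n τ.rank) :
    FirstOrder T fun V x => deriv (fun t => nablaIter (flowConn V Γ t) τ (F V t) i x a I) 0 := by
  refine (FirstOrder.lieArr (T := T) (Sum.elim (fun _ : Fin i => false) τ.up) τ.weight
    (fun y J => Palatini.nablaIter Γ τ F₀ i y (J ∘ Sum.inl) (J ∘ Sum.inr)) (Sum.elim a I)).congr
    fun V hV x hx => ?_
  have h := ((hF V hV).nablaIter hT hV hΓ hΓs i).deriv_eq x hx (Sum.elim a I)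
  simp only [hF₀, flowConn_zero] at h
  exact h

/-- Second derivatives of `V` enter only through `∂_b ∂_c V^a` in `ℒ_V Γ`; all other variations in
`theta` are Lie derivatives of fixed tensors. The lower coefficients are left unspecified, without
any regularity, since they do not contribute on a surface where `V` vanishes. -/
theorem noether_secondOrder (hT : IsOpen T)
    (hg : ∀ I, ContDiffOn ℝ ∞ (fun y => φ.g y I) T)
    (hΓ : ∀ a b c, ContDiffOn ℝ ∞ (fun y => φ.Γ y a b c) T)
    (hΓs : ∀ x ∈ T, ∀ a b c, φ.Γ x a b c = φ.Γ x a c b)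
    (hΨ : ∀ j I, ContDiffOn ℝ ∞ (fun y => φ.Ψ j y I) T) (d : Fin n) :
    ∃ (A : Coord n → Fin n → ℝ) (B : Coord n → Fin n → Fin n → ℝ), ∀ V : Coord n → Fin n → ℝ,
      (∀ a, ContDiffOn ℝ ∞ (fun y => V y a) T) → ∀ x ∈ T,
        theta φ (lieFields V φ) x d - V x d * φ.density x
          = secondOrder A B (fun x a b c => 2 * eulerR φ x ![a, c, d, b]) V x := by
  -- the part of the variation of the connection that is of first order
  have h1 : FirstOrder T fun V x => 2 * ∑ a, ∑ b, ∑ c, eulerR φ x ![a, c, d, b]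
      * (lieConn V φ.Γ x a b c - pd (pd (fun y => V y a) c) b x) := by
    refine FirstOrder.mul_left (fun _ => 2) (FirstOrder.sum _ fun a => FirstOrder.sum _ fun b =>
      FirstOrder.sum _ fun c => FirstOrder.mul_left _ ?_)
    have : FirstOrder T fun V x => ∑ e, (pd (fun y => φ.Γ y a b c) e x * V x e
        + (-φ.Γ x e b c) * pd (fun y => V y a) e x + φ.Γ x a e c * pd (fun y => V y e) b x
        + φ.Γ x a b e * pd (fun y => V y e) c x) :=
      FirstOrder.sum _ fun e => ((((FirstOrder.value e).mul_left _).add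
        ((FirstOrder.derivative a e).mul_left _)).add ((FirstOrder.derivative e b).mul_left _)).add
        ((FirstOrder.derivative e c).mul_left _)
    refine this.congr fun V _ x _ => ?_
    unfold lieConn
    rw [add_sub_cancel_right]
    exact Finset.sum_congr rfl fun e _ => by ring
  have h2 : FirstOrder T fun V x => ∑ a, ∑ b, eulerQ φ x ![d, a, b]
      * lieTensor V (covariantType 2) φ.g x ![a, b] := by
    refine FirstOrder.sum _ fun a => FirstOrder.sum _ fun b => FirstOrder.mul_left _ ?_
    simp only [lieTensor_eq_lieArr]
    exact FirstOrder.lieArr _ _ _ _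
  have vg : ∀ V : Coord n → Fin n → ℝ, (∀ a, ContDiffOn ℝ ∞ (fun y => V y a) T) →
      LieVariation T V (covariantType 2).up 0
        (fun t x I => φ.g x I + t * lieTensor V (covariantType 2) φ.g x I) := fun V hV =>
    lieVariation_affine (τ := covariantType 2) hT hV hg
  have h3 := FirstOrder.thetaTensor (Γ := φ.Γ) (K := L.kR) (P := momentumR φ)
    (fun i a I => FirstOrder.nablaIter hT hΓ hΓs (τ := curvatureType) (F₀ := curvature φ.Γ)
      (fun V hV => lieVariation_curvature hT hV hΓ) (fun V => by rw [flowConn_zero]) i a I) d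
  have h4 := FirstOrder.thetaTensor (Γ := φ.Γ) (K := L.kQ) (P := momentumQ φ)
    (fun i a I => FirstOrder.nablaIter hT hΓ hΓs (τ := covariantType 3)
      (F₀ := nonmetricity φ.g φ.Γ)
      (fun V hV => lieVariation_nonmetricity hT hV hΓ hΓs (vg V hV))
      (fun V => by simp [flowConn_zero]) i a I) d
  have h5 : ∀ j, _ := fun j => FirstOrder.thetaTensor (Γ := φ.Γ) (K := L.kM j) (P := momentumM φ j)
    (fun i a I => FirstOrder.nablaIter hT hΓ hΓs (τ := L.typ j) (F₀ := φ.Ψ j)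
      (fun V hV => lieVariation_affine hT hV (hΨ j)) (fun V => by simp) i a I) d
  have h6 : FirstOrder T fun V x => (-φ.density x) * V x d := (FirstOrder.value d).mul_left _
  obtain ⟨A, B, hAB⟩ := ((((h1.add h2).add h3).add h4).add (FirstOrder.sum Finset.univ h5)).add h6
  refine ⟨A, B, fun V hV x hx => ?_⟩
  have h := hAB V hV x hx
  unfold secondOrder
  rw [← h]
  have split : ∑ a, ∑ b, ∑ c, eulerR φ x ![a, c, d, b] * lieConn V φ.Γ x a b c
      = ∑ a, ∑ b, ∑ c, eulerR φ x ![a, c, d, b]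
          * (lieConn V φ.Γ x a b c - pd (pd (fun y => V y a) c) b x)
        + ∑ a, ∑ b, ∑ c, eulerR φ x ![a, c, d, b] * pd (pd (fun y => V y a) c) b x := by
    simp only [← Finset.sum_add_distrib]
    refine Finset.sum_congr rfl fun a _ => Finset.sum_congr rfl fun b _ =>
      Finset.sum_congr rfl fun c _ => by ring
  -- Definitional: the connection of `φ.vary (lieFields V φ) t` is `flowConn V φ.Γ t`.
  have e : theta φ (lieFields V φ) x d
      = 2 * ∑ a, ∑ b, ∑ c, eulerR φ x ![a, c, d, b] * lieConn V φ.Γ x a b c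
      + ∑ a, ∑ b, eulerQ φ x ![d, a, b] * lieTensor V (covariantType 2) φ.g x ![a, b]
      + thetaTensor φ.Γ curvatureType L.kR (momentumR φ)
        (fun i a I => deriv (fun t => nablaIter (flowConn V φ.Γ t) curvatureType
          (curvature (flowConn V φ.Γ t)) i x a I) 0) x d
      + thetaTensor φ.Γ (covariantType 3) L.kQ (momentumQ φ)
        (fun i a I => deriv (fun t => nablaIter (flowConn V φ.Γ t) (covariantType 3)
          (nonmetricity (fun x I => φ.g x I + t * lieTensor V (covariantType 2) φ.g x I)
            (flowConn V φ.Γ t)) i x a I) 0) x d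
      + ∑ j, thetaTensor φ.Γ (L.typ j) (L.kM j) (momentumM φ j)
        (fun i a I => deriv (fun t => nablaIter (flowConn V φ.Γ t) (L.typ j)
          (fun x I => φ.Ψ j x I + t * lieTensor V (L.typ j) (φ.Ψ j) x I) i x a I) 0) x d := rfl
  rw [e, split]
  simp only [mul_assoc, ← Finset.mul_sum]
  ring

end Current

/-! ## Symmetry of the Euler-Lagrange derivative -/

section Antisymmetry

variable {n : ℕ} {L : Theory n}

/-- Covariant differentiation treats indices of the same kind alike, so antisymmetry under a
permutation that respects upper and lower positions is inherited by the derivative. -/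
theorem covD_comp_perm {κ : Type} [Fintype κ] [DecidableEq κ] (Γ : ConnCoeff n) (up : κ → Bool)
    (w : ℤ) {A : Coord n → (κ → Fin n) → ℝ} (π : Equiv.Perm κ) (hup : ∀ k, up (π k) = up k)
    (hA : ∀ y J, A y (J ∘ π) = -A y J) (x : Coord n) (c : Fin n) (I : κ → Fin n) :
    covD Γ up w A x c (I ∘ π) = -covD Γ up w A x c I := by
  unfold covD
  have e : ∀ k d, Function.update (I ∘ π) k d = Function.update I (π k) d ∘ π := fun k d => by
    funext l
    by_cases h : l = k
    · subst h; simp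
    · simp [Function.update_of_ne h, Function.update_of_ne (fun h' => h (π.injective h'))]
  simp only [hA, e, pd_neg]
  have s : ∑ k, ∑ d, (if up k = true
        then Γ x ((I ∘ π) k) c d * -A x (Function.update I (π k) d)
        else -(Γ x d c ((I ∘ π) k) * -A x (Function.update I (π k) d)))
      = ∑ k, ∑ d, (if up k = true then Γ x (I k) c d * -A x (Function.update I k d)
        else -(Γ x d c (I k) * -A x (Function.update I k d))) := by
    rw [← Equiv.sum_comp π (fun k => ∑ d, (if up k = true
        then Γ x (I k) c d * -A x (Function.update I k d)
        else -(Γ x d c (I k) * -A x (Function.update I k d))))]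
    refine Finset.sum_congr rfl fun k _ => Finset.sum_congr rfl fun d _ => ?_
    rw [hup]
    rfl
  have s2 : ∑ k, ∑ d, (if up k = true then Γ x (I k) c d * -A x (Function.update I k d)
        else -(Γ x d c (I k) * -A x (Function.update I k d)))
      = -∑ k, ∑ d, (if up k = true then Γ x (I k) c d * A x (Function.update I k d)
        else -(Γ x d c (I k) * A x (Function.update I k d))) := by
    simp only [← Finset.sum_neg_distrib]
    refine Finset.sum_congr rfl fun k _ => Finset.sum_congr rfl fun d _ => ?_
    split_ifs <;> ring
  rw [s, s2]
  ring

theorem reduced_comp_swap (Γ : ConnCoeff n)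
    {P : (m : ℕ) → Coord n → Idx n m → Idx n curvatureType.rank → ℝ}
    (hP : ∀ m x a I, P m x a (I ∘ Equiv.swap (2 : Fin 4) 3) = -P m x a I) (r i : ℕ)
    (x : Coord n) (a : Idx n i) (I : Idx n 4) :
    reduced Γ curvatureType P r i x a (I ∘ Equiv.swap (2 : Fin 4) 3)
      = -reduced Γ curvatureType P r i x a I := by
  induction r generalizing i x I with
  | zero => exact hP i x a I
  | succ r ih =>
    simp only [reduced, hP, divMomentum]
    rw [neg_sub', ← Finset.sum_neg_distrib]
    congr 1
    refine Finset.sum_congr rfl fun c _ => ?_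
    rw [← covD_comp_perm _ _ _
      (Equiv.sumCongr (Equiv.refl (Fin (i + 1))) (Equiv.swap (2 : Fin 4) 3))]
    · congr 1
      funext k
      rcases k with k | k <;> rfl
    · rintro (k | k)
      · rfl
      · fin_cases k <;> rfl
    · intro y J
      exact ih (i + 1) y _ (J ∘ Sum.inr)

theorem curvatureSym_comp_swap (P : Idx n 4 → ℝ) (I : Idx n 4) :
    curvatureSym P (I ∘ Equiv.swap (2 : Fin 4) 3) = -curvatureSym P I := by
  have h0 : Equiv.swap (2 : Fin 4) 3 0 = 0 := rfl
  have h1 : Equiv.swap (2 : Fin 4) 3 1 = 1 := rfl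
  have h2 : Equiv.swap (2 : Fin 4) 3 2 = 3 := rfl
  have h3 : Equiv.swap (2 : Fin 4) 3 3 = 2 := rfl
  simp only [curvatureSym, Function.comp_apply, h0, h1, h2, h3]
  ring

/-- The projection `curvatureSym` builds the antisymmetry into the momenta; symmetrizing derivative
indices and taking divergences preserve it. -/
theorem eulerR_antisymm (φ : LocalFields L) (x : Coord n) (a b c d : Fin n) :
    eulerR φ x ![a, b, d, c] = -eulerR φ x ![a, b, c, d] := by
  have h := reduced_comp_swap φ.Γ (P := momentumR φ) (fun m x a' I => by
    unfold momentumR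
    split_ifs
    · simp only [symmetrize, curvatureSym_comp_swap, Finset.sum_neg_distrib, mul_neg]
    · simp) L.kR 0 x ![] ![a, b, c, d]
  have e : (![a, b, c, d] ∘ Equiv.swap (2 : Fin 4) 3 : Idx n 4) = ![a, b, d, c] := by
    funext k; fin_cases k <;> rfl
  rwa [e] at h

end Antisymmetry

/-! ## The Killing field at the bifurcation surface -/

section LeviCivita

variable {n : ℕ}

theorem contDiffOn_det {E : Type*} [NormedAddCommGroup E] [NormedSpace ℝ E] {U : Set E} {k : ℕ}
    {F : E → Matrix (Fin k) (Fin k) ℝ} (hF : ∀ a b, ContDiffOn ℝ ∞ (fun y => F y a b) U) :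
    ContDiffOn ℝ ∞ (fun y => (F y).det) U := by
  simp only [Matrix.det_apply']
  exact ContDiffOn.sum fun σ _ => contDiffOn_const.mul (contDiffOn_prod fun i _ => hF _ _)

/-- Cramer's rule writes each entry as a quotient of two determinants. -/
theorem contDiffOn_inv_matrix {T : Set (Coord n)} {F : Coord n → Matrix (Fin n) (Fin n) ℝ}
    (hF : MSmooth T F) (hdet : ∀ x ∈ T, (F x).det ≠ 0) : MSmooth T fun x => (F x)⁻¹ := by
  intro a b
  have h1 : ContDiffOn ℝ ∞ (fun y => ((F y).updateRow b (Pi.single a 1)).det) T := by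
    refine contDiffOn_det fun i j => ?_
    by_cases h : i = b
    · subst h
      simpa using contDiffOn_const
    · simpa [Matrix.updateRow_ne h] using hF i j
  refine (((contDiffOn_det hF).inv hdet).mul h1).congr fun y _ => ?_
  change (F y)⁻¹ a b = (F y).det⁻¹ * _
  rw [Matrix.inv_def, Matrix.smul_apply, Matrix.adjugate_apply, Ring.inverse_eq_inv', smul_eq_mul]

theorem contDiffOn_leviCivita {T : Set (Coord n)} (hT : IsOpen T) {g : Coord n → Idx n 2 → ℝ}
    (hg : ∀ I, ContDiffOn ℝ ∞ (fun y => g y I) T) (hdet : ∀ x ∈ T, (gramMatrix (g x)).det ≠ 0)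
    (a b c : Fin n) : ContDiffOn ℝ ∞ (fun y => leviCivita g y a b c) T :=
  contDiffOn_const.mul (ContDiffOn.sum fun d _ =>
    (contDiffOn_inv_matrix (F := fun y => gramMatrix (g y)) (fun i j => hg ![i, j]) hdet a d).mul
    (((contDiffOn_pd hT (hg _)).add (contDiffOn_pd hT (hg _))).sub (contDiffOn_pd hT (hg _))))

end LeviCivita

section Horizon

variable {m : ℕ} {M : Type*} [TopologicalSpace M] [ChartedSpace (Coord (m + 2)) M]

theorem LorentzMetric.det_ne_zero (g : LorentzMetric m M) (e : OChart (m + 2) M)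
    {x : Coord (m + 2)} (hx : x ∈ e.1.target) : (gramMatrix (g.comp e x)).det ≠ 0 := by
  obtain ⟨B, -, hB⟩ := g.lorentzian e x hx
  intro h
  have := congrArg Matrix.det hB
  rw [Matrix.det_mul, Matrix.det_mul, h, Matrix.det_diagonal] at this
  simp only [mul_zero, zero_mul] at this
  refine (Finset.prod_ne_zero_iff.2 fun i _ => ?_) this.symm
  split_ifs <;> norm_num

/-- A function vanishing on `H` has, trivially, a local extremum at `x` on the level set of `f`, so
Lagrange multipliers apply. The multiplier of `dG` cannot be zero because `df ≠ 0`. -/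
theorem IsLocalEquation.exists_fderiv_eq {H : Set M} {e : OChart (m + 2) M} {x : Coord (m + 2)}
    {f : Coord (m + 2) → ℝ} (hf : IsLocalEquation H e x f) (hx : e.1.symm x ∈ H)
    {G : Coord (m + 2) → ℝ} (hG : ContDiffAt ℝ ∞ G x)
    (hG0 : ∀ᶠ y in 𝓝 x, e.1.symm y ∈ H → G y = 0) :
    ∃ μ : ℝ, ∀ c, pd G c x = μ * pd f c x := by
  have hfx : f x = 0 := hf.2.2.self_of_nhds.1 hx
  have hGx : G x = 0 := hG0.self_of_nhds hx
  have hext : IsLocalExtrOn G {y | f y = f x} x := by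
    refine Or.inl ?_
    change ∀ᶠ y in 𝓝[{y | f y = f x}] x, G x ≤ G y
    rw [eventually_nhdsWithin_iff]
    filter_upwards [hG0, hf.2.2] with y h1 h2 h3
    rw [hGx, h1 (h2.2 (by rw [← hfx]; exact h3))]
  obtain ⟨a, b, hab, h⟩ := hext.exists_multipliers_of_hasStrictFDerivAt_1d
    (hf.1.hasStrictFDerivAt (by simp)) (hG.hasStrictFDerivAt (by simp))
  have hb : b ≠ 0 := by
    rintro rfl
    rw [zero_smul, add_zero, smul_eq_zero] at h
    rcases h with h | h
    · exact hab (by simp [h])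
    · exact hf.2.1 h
  refine ⟨-a / b, fun c => ?_⟩
  have hc := DFunLike.congr_fun h (Pi.single c 1)
  simp only [add_apply, smul_apply, smul_eq_mul, zero_apply] at hc
  unfold pd
  field_simp
  linarith

theorem pd_slice_eq_zero {f : Coord (m + 2) → ℝ} {y : Coord m}
    (hf : DifferentiableAt ℝ f (slice y)) (h0 : ∀ᶠ y' in 𝓝 y, f (slice y') = 0) (k : Fin m) :
    pd f k.succ.succ (slice y) = 0 := by
  have h1 := pd_eq_deriv (c := k.succ.succ) hf
  have ht : Filter.Tendsto (fun t : ℝ => y + t • (Pi.single k 1 : Coord m)) (𝓝 0) (𝓝 y) := by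
    have : Continuous fun t : ℝ => y + t • (Pi.single k 1 : Coord m) := by fun_prop
    simpa using this.tendsto 0
  refine h1.unique ((hasDerivAt_const (0 : ℝ) (0 : ℝ)).congr_of_eventuallyEq ?_)
  filter_upwards [ht.eventually h0] with t ht
  rw [← line_zero, line_add_single_succ, line_zero, ht]

/-- At the bifurcation surface the gradient of the Killing field is `κ` times the binormal. -/
theorem killing_gradient {g : LorentzMetric m M} {V : VectorField (m + 2) M} {HA HB S : Set M}
    {κ : ℝ} (hκ : κ ≠ 0) (hV : IsBifurcateKillingHorizon g V HA HB S κ)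
    {b : OChart (m + 2) M → Coord (m + 2) → Fin (m + 2) → Fin (m + 2) → ℝ}
    (hb : IsBinormal g HA HB S b) (e : OChart (m + 2) M)
    (hslice : ∀ p ∈ e.1.source, (p ∈ S ↔ e.1 p 0 = 0 ∧ e.1 p 1 = 0)) {y : Coord m}
    (hy : slice y ∈ e.1.target) (c a : Fin (m + 2)) :
    ∑ d, g.comp e (slice y) ![a, d] * pd (fun x => vec V e x d) c (slice y)
      = κ * b e (slice y) c a := by
  set x : Coord (m + 2) := slice y with hx
  have hT : IsOpen e.1.target := e.1.open_target
  have hTx : ∀ᶠ z in 𝓝 x, z ∈ e.1.target := hT.mem_nhds hy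
  have memS : ∀ z ∈ e.1.target, (e.1.symm z ∈ S ↔ z 0 = 0 ∧ z 1 = 0) := fun z hz => by
    rw [hslice _ (e.1.map_target hz), e.1.right_inv hz]
  have hsl : ∀ᶠ y' in 𝓝 y, (slice y' : Coord (m + 2)) ∈ e.1.target :=
    (continuous_line (m := m) 0).continuousAt.eventually hTx
  have sliceS : ∀ᶠ y' in 𝓝 y, e.1.symm (slice y') ∈ S := by
    filter_upwards [hsl] with y' h
    exact (memS _ h).2 ⟨rfl, rfl⟩
  have hxS : e.1.symm x ∈ S := sliceS.self_of_nhds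
  have hSA : S ⊆ HA := hV.inter ▸ Set.inter_subset_left
  have hSB : S ⊆ HB := hV.inter ▸ Set.inter_subset_right
  have gs : ∀ p q, g.comp e x ![p, q] = g.comp e x ![q, p] := g.symm e x hy
  -- the components of the Killing field
  set v : Coord (m + 2) → Fin (m + 2) → ℝ := vec V e with hv
  have vs : ∀ d, ContDiffOn ℝ ∞ (fun z => v z d) e.1.target := fun d => V.smooth e ![d]
  have vsx : ∀ d, ContDiffAt ℝ ∞ (fun z => v z d) x := fun d => (vs d).contDiffAt hTx
  have v0 : v x = 0 := hV.vanishes e x hy hxS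
  set D : Fin (m + 2) → Fin (m + 2) → ℝ := fun c d => pd (fun z => v z d) c x with hD
  set F : Fin (m + 2) → Fin (m + 2) → ℝ := fun c a => ∑ d, g.comp e x ![a, d] * D c d with hF
  change F c a = _
  -- Where `V` vanishes, Killing's equation loses its term `V^d ∂_d g` and says only this.
  have F_antisymm : ∀ c a, F c a = -F a c := by
    intro c a
    have h := congrFun (hV.killing e x hy) ![a, c]
    unfold lieTensor at h
    have z : ∑ d, vec V e x d * pd (fun z => g.comp e z ![a, c]) d x = 0 :=
      Finset.sum_eq_zero fun d _ => by rw [← hv, v0]; simp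
    rw [z] at h
    have u0 : ∀ d, (Function.update ![a, c] 0 d : Idx (m + 2) 2) = ![d, c] := fun d => by
      funext k; fin_cases k <;> rfl
    have u1 : ∀ d, (Function.update ![a, c] 1 d : Idx (m + 2) 2) = ![a, d] := fun d => by
      funext k; fin_cases k <;> rfl
    simp [Fin.sum_univ_two, u0, u1] at h
    simp only [hF, hD]
    have : ∑ d, g.comp e x ![c, d] * pd (fun z => v z d) a x
        = ∑ d, pd (fun z => v z d) a x * g.comp e x ![d, c] :=
      Finset.sum_congr rfl fun d _ => by rw [gs]; ring
    rw [this]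
    have : ∑ d, g.comp e x ![a, d] * pd (fun z => v z d) c x
        = ∑ d, pd (fun z => v z d) c x * g.comp e x ![a, d] :=
      Finset.sum_congr rfl fun d _ => by ring
    rw [this]
    linarith
  have D_tangent : ∀ (k : Fin m) d, D k.succ.succ d = 0 := fun k d =>
    pd_slice_eq_zero ((vsx d).differentiableAt (by simp)) (by
      filter_upwards [hsl, sliceS] with y' h1 h2
      exact congrFun (hV.vanishes e _ h1 h2) d) k
  have F_tangent : ∀ (k : Fin m) a, F k.succ.succ a = 0 := fun k a => by
    simp [hF, D_tangent]
  -- the null normals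
  obtain ⟨k, l, hk, hl, hkl, hbx⟩ := hb e x hy hxS
  have normal_tangent : ∀ {H : Set M} {k : Fin (m + 2) → ℝ}, S ⊆ H → IsNormal g H e x k →
      ∀ j : Fin m, g.lower e x k j.succ.succ = 0 := by
    rintro H k hSH ⟨f, hf, r, hr⟩ j
    rw [hr, pd_slice_eq_zero (hf.1.differentiableAt (by simp)), mul_zero]
    have := (continuous_line (m := m) 0).continuousAt.eventually hf.2.2
    filter_upwards [this, sliceS] with y' h1 h2 using h1.1 (hSH h2)
  set k' := g.lower e x k with hk'
  set l' := g.lower e x l with hl'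
  have kt : ∀ j : Fin m, k' j.succ.succ = 0 := normal_tangent hSA hk
  have lt : ∀ j : Fin m, l' j.succ.succ = 0 := normal_tangent hSB hl
  have dot_eq : ∀ p q, g.dot e x p q = ∑ a, g.lower e x p a * q a := fun p q => by
    unfold LorentzMetric.dot LorentzMetric.lower
    rw [Finset.sum_comm]
    refine Finset.sum_congr rfl fun a _ => ?_
    rw [Finset.sum_mul]
    exact Finset.sum_congr rfl fun d _ => by rw [gs]
  have kk : ∑ a, k' a * k a = 0 := by
    rw [← dot_eq]; exact hV.horizonA.null e x hy (hSA hxS) k hk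
  have kl : ∑ a, k' a * l a = -1 := by rw [← dot_eq]; exact hkl
  have lk : ∑ a, l' a * k a = -1 := by
    rw [← dot_eq, ← hkl]
    unfold LorentzMetric.dot
    rw [Finset.sum_comm]
    exact Finset.sum_congr rfl fun a _ => Finset.sum_congr rfl fun d _ => by rw [gs]; ring
  have two : ∀ f : Fin (m + 2) → ℝ, (∀ j : Fin m, f j.succ.succ = 0) → ∑ a, f a = f 0 + f 1 :=
    fun f hf => by
      rw [Fin.sum_univ_succ, Fin.sum_univ_succ, Finset.sum_eq_zero fun j _ => hf j, add_zero]; rfl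
  -- The covectors `k'` and `l'` are independent: if not, `k'(k) = 0` and `l'(k) = -1` would force
  -- `k' = 0`, against `k'(l) = -1`.
  have b01 : k' 0 * l' 1 - l' 0 * k' 1 ≠ 0 := by
    intro h0
    rw [two _ fun j => by rw [kt, zero_mul]] at kk kl
    rw [two _ fun j => by rw [lt, zero_mul]] at lk
    have e0 : k' 0 * (l' 0 * k 0 + l' 1 * k 1) = 0 := by linear_combination l' 0 * kk + k 1 * h0
    have e1 : k' 1 * (l' 0 * k 0 + l' 1 * k 1) = 0 := by linear_combination l' 1 * kk - k 0 * h0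
    rw [lk] at e0 e1
    have f0 : k' 0 = 0 := by linarith
    have f1 : k' 1 = 0 := by linarith
    rw [f0, f1] at kl
    norm_num at kl
  -- Both sides are antisymmetric and vanish as soon as one index is tangent to the slice, so each
  -- is determined by its component `0 1`.
  obtain ⟨lam, hlam⟩ : ∃ lam : ℝ, ∀ c a, F c a = lam * (k' c * l' a - l' c * k' a) := by
    refine ⟨F 0 1 / (k' 0 * l' 1 - l' 0 * k' 1), fun c a => ?_⟩
    have diag : ∀ c, F c c = 0 := fun c => by linarith [F_antisymm c c]
    have F' : ∀ (j : Fin m) c, F c j.succ.succ = 0 := fun j c => by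
      rw [F_antisymm, F_tangent, neg_zero]
    refine Fin.cases ?_ (fun c => Fin.cases ?_ (fun j => ?_) c) c
    · refine Fin.cases ?_ (fun a => Fin.cases ?_ (fun j => ?_) a) a
      · rw [diag]; ring
      · simp only [Fin.succ_zero_eq_one]; field_simp
      · rw [F', kt, lt]; ring
    · refine Fin.cases ?_ (fun a => Fin.cases ?_ (fun j => ?_) a) a
      · simp only [Fin.succ_zero_eq_one]; rw [F_antisymm]; field_simp; ring
      · rw [diag]; ring
      · rw [F', kt, lt]; ring
    · rw [F_tangent, kt, lt]; ring
  -- nondegeneracy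
  have nondeg : ∀ u u' : Fin (m + 2) → ℝ, (∀ a, ∑ d, g.comp e x ![a, d] * u d
      = ∑ d, g.comp e x ![a, d] * u' d) → u = u' := fun u u' h => by
    have hdet := g.det_ne_zero e hy
    have : (gramMatrix (g.comp e x)).mulVec u = (gramMatrix (g.comp e x)).mulVec u' :=
      funext fun a => h a
    exact Matrix.mulVec_injective_of_isUnit
      ((Matrix.isUnit_iff_isUnit_det _).2 (isUnit_iff_ne_zero.2 hdet)) this
  -- the surface gravity equation as a matrix equation along the horizon
  set Γ := leviCivita (g.comp e) with hΓ
  have Γs : ∀ a b c, ContDiffOn ℝ ∞ (fun z => Γ z a b c) e.1.target :=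
    contDiffOn_leviCivita hT (g.smooth e) fun z hz => g.det_ne_zero e hz
  set N : Coord (m + 2) → Matrix (Fin (m + 2)) (Fin (m + 2)) ℝ := fun z =>
    Matrix.of fun a b => pd (fun z => v z a) b z + ∑ d, Γ z a b d * v z d with hN
  have Ns : ∀ a b, ContDiffOn ℝ ∞ (fun z => N z a b) e.1.target := fun a b =>
    (contDiffOn_pd hT (vs a)).add (ContDiffOn.sum fun d _ => (Γs a b d).mul (vs d))
  have Nx : ∀ a b, N x a b = D b a := fun a b => by simp [hN, hD, v0]
  have grav : ∀ z ∈ e.1.target, e.1.symm z ∈ HA → ∀ a, ∑ b, v z b * N z a b = κ * v z a := by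
    intro z hz hzA a
    rw [← hV.surfaceGravity e z hz hzA a]
    refine Finset.sum_congr rfl fun b _ => ?_
    congr 1
    have u0 : ∀ d, (Function.update ![a] 0 d : Idx (m + 2) 1) = ![d] := fun d => by
      funext k; fin_cases k; rfl
    simp only [covD, hN, Matrix.of_apply, Fin.sum_univ_one, u0]
    simp [hv, vec]
    rfl
  obtain ⟨f, hf, r, hr_lower⟩ := hk
  have hr : ∀ a, k' a = r * pd f a x := hr_lower
  have hr0 : r ≠ 0 := by
    intro h0
    have : ∀ a, k' a = 0 := fun a => by rw [hr, h0, zero_mul]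
    simp [this] at kl
  -- A null normal is tangent to its hypersurface.
  have df_k : ∑ c, k c * pd f c x = 0 := by
    have : r * ∑ c, k c * pd f c x = 0 := by
      rw [← kk, Finset.mul_sum]
      exact Finset.sum_congr rfl fun c _ => by rw [hr]; ring
    exact (mul_eq_zero.1 this).resolve_left hr0
  -- `k` is an eigenvector
  have Dk : ∀ d, ∑ c, k c * D c d = lam * k d := by
    refine congrFun (nondeg (fun d => ∑ c, k c * D c d) (fun d => lam * k d) fun a => ?_)
    have e1 : ∑ d, g.comp e x ![a, d] * ∑ c, k c * D c d = ∑ c, k c * F c a := by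
      simp only [hF, Finset.mul_sum]
      rw [Finset.sum_comm]
      exact Finset.sum_congr rfl fun c _ => Finset.sum_congr rfl fun d _ => by ring
    have e2 : ∑ d, g.comp e x ![a, d] * (lam * k d) = lam * k' a := by
      rw [hk', LorentzMetric.lower, Finset.mul_sum]
      exact Finset.sum_congr rfl fun d _ => by ring
    have e3 : ∑ c, k c * (k' c * l' a - l' c * k' a)
        = (∑ c, k' c * k c) * l' a - (∑ c, l' c * k c) * k' a := by
      rw [Finset.sum_mul, Finset.sum_mul, ← Finset.sum_sub_distrib]
      exact Finset.sum_congr rfl fun c _ => by ring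
    have e4 : ∑ c, k c * F c a = lam * ∑ c, k c * (k' c * l' a - l' c * k' a) := by
      rw [Finset.mul_sum]
      exact Finset.sum_congr rfl fun c _ => by rw [hlam]; ring
    rw [e1, e2, e4, e3, kk, lk]
    ring
  -- The surface gravity equation holds along `HA` and may be differentiated in the tangent
  -- direction `k`. As `V` vanishes at `x`, only products of first derivatives of `V` remain, and
  -- they are evaluated on the eigenvector `k`.
  have lam_sq : lam * lam = κ * lam := by
    have step : ∀ a, lam * lam * k a = κ * lam * k a := by
      intro a
      set G : Coord (m + 2) → ℝ := fun z => ∑ b, v z b * N z a b - κ * v z a with hG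
      have hGs : ContDiffAt ℝ ∞ G x := ContDiffOn.contDiffAt ((ContDiffOn.sum fun b _ =>
        (vs b).mul (Ns a b)).sub (contDiffOn_const.mul (vs a))) hTx
      obtain ⟨μ, hμ⟩ := hf.exists_fderiv_eq (hSA hxS) hGs (by
        filter_upwards [hTx] with z hz hzA
        simp only [hG, grav z hz hzA a, sub_self])
      have dG : ∀ c, pd G c x = ∑ b, D c b * D b a - κ * D c a := by
        intro c
        have hd : ∀ b, DifferentiableAt ℝ (fun z => v z b) x := fun b =>
          (vsx b).differentiableAt (by simp)
        have hNd : ∀ b, DifferentiableAt ℝ (fun z => N z a b) x := fun b =>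
          differentiableAt_of_contDiffOn hT (Ns a b) hy
        have hvN : ∀ b, DifferentiableAt ℝ (fun z => v z b * N z a b) x := fun b =>
          (hd b).mul (hNd b)
        rw [hG, pd_sub (DifferentiableAt.fun_sum fun b _ => hvN b) ((hd a).const_mul κ),
          pd_sum _ fun b _ => hvN b, pd_const_mul _ (hd a)]
        congr 1
        refine Finset.sum_congr rfl fun b _ => ?_
        rw [pd_mul (hd b) (hNd b), v0, Nx]
        simp [hD]
      have h0 : ∑ c, k c * pd G c x = 0 := by
        have : ∑ c, k c * pd G c x = μ * ∑ c, k c * pd f c x := by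
          rw [Finset.mul_sum]
          exact Finset.sum_congr rfl fun c _ => by rw [hμ]; ring
        rw [this, df_k, mul_zero]
      simp only [dG, mul_sub, Finset.sum_sub_distrib, Finset.mul_sum] at h0
      rw [Finset.sum_comm] at h0
      have e1 : ∑ b, ∑ c, k c * (D c b * D b a) = lam * (lam * k a) := by
        rw [← Dk a, Finset.mul_sum]
        refine Finset.sum_congr rfl fun b _ => ?_
        rw [← mul_assoc, ← Dk b, Finset.sum_mul]
        exact Finset.sum_congr rfl fun c _ => by ring
      have e2 : ∑ c, k c * (κ * D c a) = κ * (lam * k a) := by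
        rw [← Dk a, Finset.mul_sum]
        exact Finset.sum_congr rfl fun c _ => by ring
      rw [e1, e2] at h0
      linear_combination h0
    obtain ⟨a, ha⟩ : ∃ a, k a ≠ 0 := by
      by_contra h
      push Not at h
      simp [h] at lk
    exact mul_right_cancel₀ ha (step a)
  -- the gradient does not vanish
  have lam_ne : lam ≠ 0 := by
    intro h0
    have D0 : ∀ c d, D c d = 0 := fun c => by
      refine congrFun (nondeg (D c) 0 fun a => ?_)
      have : F c a = 0 := by rw [hlam, h0, zero_mul]
      simpa [hF] using this
    have hdet : ContinuousAt (fun z => (Matrix.scalar (Fin (m + 2)) κ - N z).det) x := by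
      refine (ContDiffOn.contDiffAt (contDiffOn_det (U := e.1.target) fun a b => ?_) hTx).continuousAt
      exact contDiffOn_const.sub (Ns a b)
    have hx0 : (Matrix.scalar (Fin (m + 2)) κ - N x).det ≠ 0 := by
      have : N x = 0 := by ext a b; rw [Nx, D0]; rfl
      rw [this, sub_zero]
      simp [hκ]
    -- With vanishing gradient `κ - N` is invertible near `x`, so `N V = κ V` on `HA` gives `V = 0`
    -- there. Then `HA` is contained in the bifurcation surface near `x`.
    have near : ∀ᶠ z in 𝓝 x, e.1.symm z ∈ HA → z 0 = 0 ∧ z 1 = 0 := by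
      filter_upwards [hTx, hdet.eventually_ne hx0] with z hz hzdet hzA
      rw [← memS z hz]
      by_contra hzS
      refine hV.horizonA.ne_zero e z hz ⟨hzA, hzS⟩ ?_
      refine Matrix.eq_zero_of_mulVec_eq_zero hzdet (funext fun a => ?_)
      have := grav z hz hzA a
      rw [Matrix.sub_mulVec, Matrix.scalar_apply, Pi.sub_apply, Matrix.mulVec_diagonal, Pi.zero_apply,
        sub_eq_zero, ← hv, ← this]
      exact Finset.sum_congr rfl fun b _ => mul_comm _ _
    have hco : ∀ i : Fin (m + 2), ContDiffAt ℝ ∞ (fun z : Coord (m + 2) => z i) x := fun i =>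
      (contDiff_apply ℝ ℝ i).contDiffAt
    -- Both `x^0` and `x^1` would vanish on the hypersurface, making their independent differentials
    -- multiples of the single covector `df`.
    obtain ⟨μ₀, h₀⟩ := hf.exists_fderiv_eq (hSA hxS) (hco 0) (near.mono fun z h hz => (h hz).1)
    obtain ⟨μ₁, h₁⟩ := hf.exists_fderiv_eq (hSA hxS) (hco 1) (near.mono fun z h hz => (h hz).2)
    have a0 := h₀ 0
    have a1 := h₀ 1
    have c0 := h₁ 0
    have c1 := h₁ 1
    rw [pd_coord] at a0 a1 c0 c1
    simp only [if_true, zero_ne_one, one_ne_zero, if_false] at a0 a1 c0 c1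
    have hμ : μ₀ ≠ 0 := by rintro rfl; simp at a0
    have p1 : pd f 1 x = 0 := (mul_eq_zero.1 a1.symm).resolve_left hμ
    rw [p1] at c1
    simp at c1
  have : lam = κ := mul_right_cancel₀ lam_ne lam_sq
  rw [hlam, this, hbx]

end Horizon

/-! ## Charts and vector fields -/

section Charts

variable {n : ℕ} {M : Type*} [TopologicalSpace M] [ChartedSpace (Coord n) M]

theorem mem_transition_source {e e' : OChart n M} {x : Coord n} :
    x ∈ (transition e e').source ↔ x ∈ e.1.target ∧ e.1.symm x ∈ e'.1.source := by
  simp [transition]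

theorem transition_apply (e e' : OChart n M) (x : Coord n) :
    transition e e' x = e'.1 (e.1.symm x) := rfl

theorem symm_transition {e e' : OChart n M} {x : Coord n} (hx : x ∈ (transition e e').source) :
    e'.1.symm (transition e e' x) = e.1.symm x :=
  e'.1.left_inv (mem_transition_source.1 hx).2

theorem transition_mem_source {e e' : OChart n M} {x : Coord n}
    (hx : x ∈ (transition e e').source) : transition e e' x ∈ (transition e' e).source := by
  rw [mem_transition_source, symm_transition hx]
  have h := mem_transition_source.1 hx
  exact ⟨e'.1.map_source h.2, e.1.map_target h.1⟩

theorem transition_transition {e e' : OChart n M} {x : Coord n}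
    (hx : x ∈ (transition e e').source) (e'' : OChart n M) :
    transition e' e'' (transition e e' x) = transition e e'' x := by
  rw [transition_apply e' e'', symm_transition hx, transition_apply e e'']

theorem transition_self {e : OChart n M} {x : Coord n} (hx : x ∈ e.1.target) :
    transition e e x = x := e.1.right_inv hx

theorem contDiffOn_transition (e e' : OChart n M) :
    ContDiffOn ℝ ∞ (transition e e') (transition e e').source := by
  rw [← contMDiffOn_iff_contDiffOn]
  have h1 := contMDiffOn_symm_of_mem_maximalAtlas e.2.1
  have h2 := contMDiffOn_of_mem_maximalAtlas e'.2.1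
  exact h2.comp (h1.mono fun x hx => (mem_transition_source.1 hx).1)
    fun x hx => (mem_transition_source.1 hx).2

theorem contDiffOn_transition_apply (e e' : OChart n M) (a : Fin n) :
    ContDiffOn ℝ ∞ (fun x => transition e e' x a) (transition e e').source :=
  contDiffOn_pi.1 (contDiffOn_transition e e') a

theorem contDiffOn_jacobian (e e' : OChart n M) (a b : Fin n) :
    ContDiffOn ℝ ∞ (fun x => jacobian e e' x a b) (transition e e').source :=
  contDiffOn_pd (transition e e').open_source (contDiffOn_transition_apply e e' a)

theorem jacobian_self {e : OChart n M} {x : Coord n} (hx : x ∈ e.1.target) :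
    jacobian e e x = 1 := by
  ext a b
  simp only [jacobian, Matrix.of_apply]
  rw [pd_congr (g := fun y => y a), pd_coord, Matrix.one_apply]
  filter_upwards [e.1.open_target.mem_nhds hx] with y hy
  rw [transition_self hy]

theorem jacobian_comp {e e' e'' : OChart n M} {x : Coord n} (hx : x ∈ (transition e e').source)
    (hx' : e.1.symm x ∈ e''.1.source) :
    jacobian e e'' x = jacobian e' e'' (transition e e' x) * jacobian e e' x := by
  have hy : transition e e' x ∈ (transition e' e'').source :=
    mem_transition_source.2 ⟨(mem_transition_source.1 (transition_mem_source hx)).1, by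
      rwa [symm_transition hx]⟩
  have h1 : HasFDerivAt (transition e e') _ x := (((contDiffOn_transition e e').contDiffAt
    ((transition e e').open_source.mem_nhds hx)).differentiableAt (by simp)).hasFDerivAt
  ext a b
  have h2 : HasFDerivAt (fun z => transition e' e'' z a) _ (transition e e' x) :=
    (differentiableAt_of_contDiffOn (transition e' e'').open_source
      (contDiffOn_transition_apply e' e'' a) hy).hasFDerivAt
  have h3 := HasFDerivAt.comp x h2 h1
  have near : (fun y => transition e e'' y a)
      =ᶠ[𝓝 x] (fun z => transition e' e'' z a) ∘ transition e e' := by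
    filter_upwards [(transition e e').open_source.mem_nhds hx] with y hy
    rw [Function.comp_apply, transition_transition hy]
  simp only [jacobian, Matrix.of_apply, Matrix.mul_apply]
  rw [pd_congr near, pd, h3.fderiv, ContinuousLinearMap.comp_apply, fderiv_apply_eq_sum_pd]
  refine Finset.sum_congr rfl fun d _ => ?_
  rw [mul_comm]
  congr 1
  have h4 := (ContinuousLinearMap.proj (R := ℝ) (φ := fun _ : Fin n => ℝ) d).hasFDerivAt.comp x h1
  have h5 : (fun y => transition e e' y d)
      = (ContinuousLinearMap.proj (R := ℝ) (φ := fun _ : Fin n => ℝ) d) ∘ transition e e' := rfl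
  rw [pd, h5, h4.fderiv]
  rfl

theorem jacobian_inv {e e' : OChart n M} {x : Coord n} (hx : x ∈ (transition e e').source) :
    (jacobian e' e (transition e e' x))⁻¹ = jacobian e e' x := by
  have h := mem_transition_source.1 hx
  refine Matrix.inv_eq_right_inv ?_
  rw [← jacobian_comp hx (e.1.map_target h.1), jacobian_self h.1]

omit [ChartedSpace (Coord n) M] [TopologicalSpace M] in
theorem transformArr_vector (A : Matrix (Fin n) (Fin n) ℝ) (v : Idx n 1 → ℝ) (I : Idx n 1) :
    transformArr A vectorType.up vectorType.weight v I = ∑ b, A (I 0) b * v ![b] := by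
  simp only [transformArr, zpow_zero, one_mul, if_true]
  refine Fintype.sum_equiv (Equiv.funUnique (Fin 1) (Fin n)) _ _ fun I' => ?_
  have : I' = ![I' 0] := by funext k; fin_cases k; rfl
  simp only [Fin.prod_univ_one]
  congr 2

theorem contDiffOn_comp_symm {χ : M → ℝ} (hχ : ContMDiff 𝓘(ℝ, Coord n) 𝓘(ℝ, ℝ) ∞ χ)
    (e : OChart n M) : ContDiffOn ℝ ∞ (fun x => χ (e.1.symm x)) e.1.target := by
  rw [← contMDiffOn_iff_contDiffOn]
  exact hχ.comp_contMDiffOn (contMDiffOn_symm_of_mem_maximalAtlas e.2.1)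

/-- The product of a vector field with a function. -/
def VectorField.mul {χ : M → ℝ} (hχ : ContMDiff 𝓘(ℝ, Coord n) 𝓘(ℝ, ℝ) ∞ χ)
    (V : VectorField n M) : VectorField n M where
  comp e x := χ (e.1.symm x) • V.comp e x
  smooth e I := (contDiffOn_comp_symm hχ e).mul (V.smooth e I)
  transform e e' x hx := by
    funext I
    rw [symm_transition hx, V.transform e e' x hx, Pi.smul_apply, transformArr_vector,
      transformArr_vector, smul_eq_mul, Finset.mul_sum]
    exact Finset.sum_congr rfl fun b _ => by simp only [Pi.smul_apply, smul_eq_mul]; ring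

open Classical in
/-- The vector field on `M` with given components in a chart, extended by zero. -/
def VectorField.ofChart [T2Space M] (e : OChart n M) (w : Coord n → Fin n → ℝ)
    (hw : ContDiff ℝ ∞ w) (hc : HasCompactSupport w) (ht : tsupport w ⊆ e.1.target) :
    VectorField n M where
  comp e' x I := if e'.1.symm x ∈ e.1.source
    then ∑ b, jacobian e e' (transition e' e x) (I 0) b * w (transition e' e x) b else 0
  smooth e' I := by
    intro x hx
    refine ContDiffAt.contDiffWithinAt ?_
    by_cases h : e'.1.symm x ∈ e.1.source
    · have hx' : x ∈ (transition e' e).source := mem_transition_source.2 ⟨hx, h⟩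
      have ho := (transition e' e).open_source
      have key : ContDiffOn ℝ ∞ (fun x => ∑ b, jacobian e e' (transition e' e x) (I 0) b
          * w (transition e' e x) b) (transition e' e).source :=
        ContDiffOn.sum fun b _ =>
          ((contDiffOn_jacobian e e' (I 0) b).comp (contDiffOn_transition e' e)
            fun y hy => transition_mem_source hy).mul
          ((contDiff_pi.1 hw b).comp_contDiffOn (contDiffOn_transition e' e))
      refine (key.contDiffAt (ho.mem_nhds hx')).congr_of_eventuallyEq ?_
      filter_upwards [ho.mem_nhds hx'] with y hy
      rw [if_pos (mem_transition_source.1 hy).2]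
    -- In a Hausdorff space this compact image is closed, so at points outside the domain of `e` the
    -- extended field vanishes in a whole neighbourhood.
    · have hK : IsClosed (e.1.symm '' tsupport w) :=
        (IsCompact.image_of_continuousOn hc (e.1.continuousOn_symm.mono ht)).isClosed
      have hx' : e'.1.symm x ∉ e.1.symm '' tsupport w := by
        rintro ⟨z, hz, hzx⟩
        exact h (hzx ▸ e.1.map_target (ht hz))
      refine contDiffAt_const (c := (0 : ℝ)) |>.congr_of_eventuallyEq ?_
      have hcont : ContinuousAt e'.1.symm x := e'.1.continuousAt_symm hx
      filter_upwards [hcont.eventually (hK.isOpen_compl.mem_nhds hx')] with y hy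
      split_ifs with h'
      · refine Finset.sum_eq_zero fun b _ => ?_
        have : w (transition e' e y) = 0 := by
          by_contra h0
          exact hy ⟨_, subset_tsupport w h0, e.1.left_inv h'⟩
        rw [this, Pi.zero_apply, mul_zero]
      · rfl
  transform e₁ e₂ x hx := by
    funext I
    rw [transformArr_vector]
    have hx1 := mem_transition_source.1 hx
    simp only [symm_transition hx, transition_transition hx]
    split_ifs with h
    · have hp : x ∈ (transition e₁ e).source := mem_transition_source.2 ⟨hx1.1, h⟩
      have hq := transition_mem_source hp
      have hq2 : e.1.symm (transition e₁ e x) ∈ e₂.1.source := by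
        rw [symm_transition hp]; exact hx1.2
      rw [jacobian_comp hq hq2, transition_transition hp, transition_self hx1.1]
      simp only [Matrix.mul_apply, Finset.sum_mul, Finset.mul_sum]
      rw [Finset.sum_comm]
      refine Finset.sum_congr rfl fun b _ => Finset.sum_congr rfl fun d _ => ?_
      simp [mul_assoc]
    · simp

theorem VectorField.ofChart_comp [T2Space M] (e : OChart n M) (w : Coord n → Fin n → ℝ)
    (hw : ContDiff ℝ ∞ w) (hc : HasCompactSupport w) (ht : tsupport w ⊆ e.1.target)
    {x : Coord n} (hx : x ∈ e.1.target) (I : Idx n 1) :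
    (VectorField.ofChart e w hw hc ht).comp e x I = w x (I 0) := by
  simp only [VectorField.ofChart]
  rw [if_pos (e.1.map_target hx), transition_self hx, jacobian_self hx]
  simp [Matrix.one_apply]

end Charts

/-! ## Noether charges -/

section Charge

variable {m : ℕ} {M : Type*} [TopologicalSpace M] [ChartedSpace (Coord (m + 2)) M]
  {L : Theory (m + 2)} {φ : Config M L} {Q : VectorField (m + 2) M → DiffForm (m + 2) M m}

theorem IsNoetherCharge.comp_congr (hQ : IsNoetherCharge φ Q) {e : OChart (m + 2) M}
    {O : Set (Coord (m + 2))} (hO : IsOpen O) (hOe : O ⊆ e.1.target) {U V : VectorField (m + 2) M}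
    (h : ∀ x ∈ O, U.comp e x = V.comp e x) {x : Coord (m + 2)} (hx : x ∈ O) :
    (Q U).comp e x = (Q V).comp e x := by
  simpa using hQ.local_linear e O hO hOe 1 0 U V V (by simpa using h) x hx

theorem IsNoetherCharge.comp_eq_zero (hQ : IsNoetherCharge φ Q) {e : OChart (m + 2) M}
    {O : Set (Coord (m + 2))} (hO : IsOpen O) (hOe : O ⊆ e.1.target) {U : VectorField (m + 2) M}
    (h : ∀ x ∈ O, U.comp e x = 0) {x : Coord (m + 2)} (hx : x ∈ O) : (Q U).comp e x = 0 := by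
  simpa using hQ.local_linear e O hO hOe 0 0 U U U (by simpa using h) x hx

theorem eps_eq_zero {n : ℕ} {a : Idx n n} {i j : Fin n} (hij : i ≠ j) (h : a i = a j) :
    eps a = 0 := by
  unfold eps
  exact Matrix.det_zero_of_row_eq hij (by funext k; simp [h])

theorem eps_cons_cons_sliceIdx (p q : Fin (m + 2)) :
    eps (Fin.cons p (Fin.cons q (sliceIdx m) : Idx (m + 2) (m + 1)) : Idx (m + 2) (m + 2))
      = if p = 0 ∧ q = 1 then 1 else if p = 1 ∧ q = 0 then -1 else 0 := by
  have rep : ∀ k : Fin (m + 2), k ≠ 0 → k ≠ 1 → ∃ l : Fin m, k = l.succ.succ := by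
    intro k h0 h1
    obtain ⟨l, rfl⟩ := Fin.exists_succ_eq.2 h0
    obtain ⟨l', rfl⟩ := Fin.exists_succ_eq.2 (fun h : l = 0 => h1 (by rw [h]; rfl))
    exact ⟨l', rfl⟩
  by_cases hpq : p = q
  · subst hpq
    rw [eps_eq_zero (i := 0) (j := 1) (by simp) rfl, if_neg, if_neg]
    · rintro ⟨rfl, h⟩; simp at h
    · rintro ⟨rfl, h⟩; simp at h
  by_cases hp : p ≠ 0 ∧ p ≠ 1
  · obtain ⟨l, rfl⟩ := rep p hp.1 hp.2
    rw [eps_eq_zero (i := 0) (j := l.succ.succ) (Fin.succ_ne_zero _).symm (by simp [sliceIdx]),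
      if_neg (fun h => hp.1 h.1), if_neg (fun h => hp.2 h.1)]
  by_cases hq : q ≠ 0 ∧ q ≠ 1
  · obtain ⟨l, rfl⟩ := rep q hq.1 hq.2
    rw [eps_eq_zero (i := 1) (j := l.succ.succ) (fun h => Fin.succ_ne_zero l
      (Fin.succ_injective _ h.symm)) (by simp [sliceIdx]),
      if_neg (fun h => hq.2 h.2), if_neg (fun h => hq.1 h.2)]
  have h01 : (p = 0 ∧ q = 1) ∨ (p = 1 ∧ q = 0) := by
    by_cases p0 : p = 0 <;> by_cases p1 : p = 1 <;> by_cases q0 : q = 0 <;> by_cases q1 : q = 1 <;>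
      simp_all
  have h1 : eps (id : Idx (m + 2) (m + 2)) = 1 := by
    have : (Matrix.of fun i j : Fin (m + 2) => if (id i : Fin (m + 2)) = j then (1 : ℝ) else 0)
        = 1 := by
      ext i j
      simp [Matrix.one_apply]
    rw [eps, this, Matrix.det_one]
  have hid : (Fin.cons 0 (Fin.cons 1 (sliceIdx m) : Idx (m + 2) (m + 1)) : Idx (m + 2) (m + 2))
      = id := by
    funext k
    refine Fin.cases rfl (fun k => Fin.cases rfl (fun k => rfl) k) k
  rcases h01 with ⟨rfl, rfl⟩ | ⟨rfl, rfl⟩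
  · rw [hid, h1, if_pos ⟨rfl, rfl⟩]
  · have hs : (Fin.cons 1 (Fin.cons 0 (sliceIdx m) : Idx (m + 2) (m + 1)) : Idx (m + 2) (m + 2))
        = Equiv.swap 0 1 := by
      funext k
      refine Fin.cases (by simp) (fun k => Fin.cases ?_ (fun k => ?_) k) k
      · simp only [Fin.cons_succ, Fin.cons_zero]
        exact (Equiv.swap_apply_right 0 1).symm
      · exact (Equiv.swap_apply_of_ne_of_ne (Fin.succ_ne_zero _)
          (fun h => Fin.succ_ne_zero k (Fin.succ_injective _ h))).symm
    rw [hs, if_neg (by simp), if_pos ⟨rfl, rfl⟩]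
    have := Matrix.det_permute (Equiv.swap (0 : Fin (m + 2)) 1)
      (Matrix.of fun i j : Fin (m + 2) => if (id i : Fin (m + 2)) = j then (1 : ℝ) else 0)
    rw [eps] at h1 ⊢
    rw [h1, Equiv.Perm.sign_swap (by simp)] at this
    simpa [Matrix.submatrix] using this

theorem eps_cons_lineIdx (a : Fin (m + 2)) :
    eps (Fin.cons a (lineIdx m) : Idx (m + 2) (m + 2)) = if a = 1 then -1 else 0 := by
  have : lineIdx m = (Fin.cons 0 (sliceIdx m) : Idx (m + 2) (m + 1)) := by
    funext k
    refine Fin.cases rfl (fun k => rfl) k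
  rw [this, eps_cons_cons_sliceIdx]
  simp

end Charge

theorem secondOrder_congr {n : ℕ} {A : Coord n → Fin n → ℝ} {B : Coord n → Fin n → Fin n → ℝ}
    {E : Coord n → Fin n → Fin n → Fin n → ℝ} {v w : Coord n → Fin n → ℝ} {x : Coord n}
    (h : v =ᶠ[𝓝 x] w) : secondOrder A B E v x = secondOrder A B E w x := by
  have h1 : ∀ a, (fun y => v y a) =ᶠ[𝓝 x] fun y => w y a := fun a => h.mono fun y hy => by
    simp only [hy]
  have h2 : ∀ a c, pd (fun y => v y a) c =ᶠ[𝓝 x] pd (fun y => w y a) c := fun a c =>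
    (h1 a).eventuallyEq_nhds.mono fun y hy => pd_congr hy
  simp only [secondOrder, h.eq_of_nhds, fun a c => (h2 a c).eq_of_nhds, fun a b c =>
    pd_congr (c := b) (h2 a c)]

theorem secondOrder_neg {n : ℕ} (A : Coord n → Fin n → ℝ) (B : Coord n → Fin n → Fin n → ℝ)
    (E : Coord n → Fin n → Fin n → Fin n → ℝ) (w : Coord n → Fin n → ℝ) (x : Coord n) :
    secondOrder (fun x a => -A x a) (fun x c a => -B x c a) (fun x a b c => -E x a b c) w x
      = -secondOrder A B E w x := by
  simp only [secondOrder, neg_mul, Finset.sum_neg_distrib, neg_add]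

/-! ### Slice integrals of Noether charges -/

section Charge

variable {m : ℕ} {M : Type*} [TopologicalSpace M] [ChartedSpace (Coord (m + 2)) M]
  {L : Theory (m + 2)} {φ : Config M L} {Q : VectorField (m + 2) M → DiffForm (m + 2) M m}

/-- Among `ε_{a 0 2 … n-1}` only `a = 1` contributes, and the transposition of `0` and `1` gives the
sign `-1`. -/
theorem IsNoetherCharge.extD_lineIdx (hQ : IsNoetherCharge φ Q) (V : VectorField (m + 2) M)
    (e : OChart (m + 2) M) {x : Coord (m + 2)} (hx : x ∈ e.1.target) :
    extD ((Q V).comp e) x (lineIdx m) = -(theta (φ.loc e) (lieFields (vec V e) (φ.loc e)) x 1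
      - vec V e x 1 * (φ.loc e).density x) := by
  rw [hQ.potential V e x hx]
  simp only [noetherCurrent]
  rw [Finset.sum_eq_single (1 : Fin (m + 2))]
  · rw [eps_cons_lineIdx, if_pos rfl, neg_one_mul]
  · intro a _ ha
    rw [eps_cons_lineIdx, if_neg ha, zero_mul]
  · simp

open Classical in
/-- The integral over a coordinate slice of the Noether charge of a vector field that vanishes
there. -/
theorem IsNoetherCharge.integral_slice [T2Space M] (hQ : IsNoetherCharge φ Q)
    (e : OChart (m + 2) M) {w : Coord (m + 2) → Fin (m + 2) → ℝ} (hw : ContDiff ℝ ∞ w)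
    (hc : HasCompactSupport w) (ht : tsupport w ⊆ e.1.target)
    (hslice : ∀ y : Coord m, w (slice y) = 0) {W : VectorField (m + 2) M}
    (hW : ∀ x ∈ e.1.target, ∀ I, W.comp e x I = w x (I 0)) :
    ∫ y in {y : Coord m | slice y ∈ e.1.target}, (Q W).comp e (slice y) (sliceIdx m)
      = ∫ y in {y : Coord m | slice y ∈ e.1.target}, ∑ a, ∑ c,
        2 * eulerR (φ.loc e) (slice y) ![a, c, 0, 1] * pd (fun x => w x a) c (slice y) := by
  have hT : IsOpen e.1.target := e.1.open_target
  obtain ⟨A, B, hAB⟩ := noether_secondOrder (φ := φ.loc e) hT (φ.g.smooth e) (φ.Γ.smooth e)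
    (φ.Γ.torsionFree e) (fun j => (φ.Ψ j).smooth e) 1
  -- The charge as an operation on compactly supported component functions. Components of a form are
  -- controlled on the chart only; by locality they vanish off the support of `w`, so the value zero
  -- elsewhere gives a smooth extension.
  set α : (Coord (m + 2) → Fin (m + 2) → ℝ) → Coord (m + 2) → Idx (m + 2) m → ℝ := fun w x I =>
    if h : ContDiff ℝ ∞ w ∧ HasCompactSupport w ∧ tsupport w ⊆ e.1.target then
      if x ∈ e.1.target then (Q (VectorField.ofChart e w h.1 h.2.1 h.2.2)).comp e x I else 0
    else 0 with hα
  have hαw : ∀ w (hw : ContDiff ℝ ∞ w) (hc : HasCompactSupport w) (ht : tsupport w ⊆ e.1.target),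
      ∀ x ∈ e.1.target, α w x = (Q (VectorField.ofChart e w hw hc ht)).comp e x := by
    intro w hw hc ht x hx
    funext I
    simp only [hα]
    rw [dif_pos ⟨hw, hc, ht⟩, if_pos hx]
  have hα0 : ∀ w, ContDiff ℝ ∞ w → HasCompactSupport w → tsupport w ⊆ e.1.target →
      ∀ x ∉ tsupport w, α w x = 0 := by
    intro w hw hc ht x hx
    by_cases hxT : x ∈ e.1.target
    · rw [hαw w hw hc ht x hxT]
      refine hQ.comp_eq_zero (hT.sdiff (isClosed_tsupport w)) Set.sdiff_subset (fun z hz => ?_)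
        ⟨hxT, hx⟩
      funext I
      rw [VectorField.ofChart_comp e w hw hc ht hz.1, image_eq_zero_of_notMem_tsupport hz.2]
      rfl
    · funext I
      simp only [hα]
      rw [dif_pos ⟨hw, hc, ht⟩, if_neg hxT]
      rfl
  have main := integral_slice_of_secondOrder (m := m) hT α (fun x a => -A x a)
    (fun x c a => -B x c a) (fun x a b c => -(2 * eulerR (φ.loc e) x ![a, c, 1, b])) ?_ hw hc ht hslice
  · have hD : MeasurableSet {y : Coord m | (slice y : Coord (m + 2)) ∈ e.1.target} :=
      (hT.preimage (continuous_line (m := m) 0)).measurableSet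
    have h1 : ∀ y ∈ {y : Coord m | (slice y : Coord (m + 2)) ∈ e.1.target},
        (Q W).comp e (slice y) (sliceIdx m) = α w (slice y) (sliceIdx m) := by
      intro y hy
      rw [hαw w hw hc ht _ hy, hQ.comp_congr hT subset_rfl (fun x hx => ?_) hy]
      funext I
      rw [hW x hx, VectorField.ofChart_comp e w hw hc ht hx]
    rw [setIntegral_congr_fun hD h1, setIntegral_eq_integral_of_forall_compl_eq_zero,
      setIntegral_eq_integral_of_forall_compl_eq_zero, main]
    · refine integral_congr_ae (Filter.Eventually.of_forall fun y => ?_)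
      simp only []
      refine Finset.sum_congr rfl fun a _ => ?_
      -- The symbol here is `E_a^{bc} = -2 E_{R a}^{c1b}`. Antisymmetry turns `E^{00}` and `E^{01}`
      -- into `2 E_R^{001}` and `2 E_R^{101}` and annihilates `E^{10}`; derivatives of `w` along the
      -- slice vanish.
      rw [Fin.sum_univ_succ, Fin.sum_univ_succ, Finset.sum_eq_zero, eulerR_antisymm _ _ a 0 0 1,
        eulerR_antisymm _ _ a 1 0 1]
      · have := eulerR_antisymm (φ.loc e) (slice y) a 0 1 1
        rw [Fin.succ_zero_eq_one]
        linear_combination -pd (fun x => w x a) 1 (slice y) * this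
      · intro k _
        rw [pd_slice_eq_zero, mul_zero]
        · exact (contDiff_pi.1 hw a).differentiable (by simp) _
        · exact Filter.Eventually.of_forall fun y => by rw [hslice y]; rfl
    · intro y hy
      refine Finset.sum_eq_zero fun a _ => Finset.sum_eq_zero fun c _ => ?_
      rw [pd_eq_zero_of_notMem_tsupport, mul_zero]
      refine fun h => hy (ht (closure_mono (fun z (hz : w z a ≠ 0) => ?_) h))
      exact fun h0 => hz (by rw [h0]; rfl)
    · intro y hy
      rw [hα0 w hw hc ht _ fun h => hy (ht h)]
      rfl
  · intro w hw hc ht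
    refine ⟨fun I => contDiff_iff_contDiffAt.2 fun x => ?_, hα0 w hw hc ht, fun x hx => ?_⟩
    · by_cases hxT : x ∈ e.1.target
      · refine (((Q (VectorField.ofChart e w hw hc ht)).smooth e I).contDiffAt
          (hT.mem_nhds hxT)).congr_of_eventuallyEq ?_
        filter_upwards [hT.mem_nhds hxT] with z hz
        rw [hαw w hw hc ht z hz]
      · refine contDiffAt_const (c := (0 : ℝ)) |>.congr_of_eventuallyEq ?_
        filter_upwards [(isClosed_tsupport w).isOpen_compl.mem_nhds fun h => hxT (ht h)] with z hz
        rw [hα0 w hw hc ht z hz]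
        rfl
    · have hvec : vec (VectorField.ofChart e w hw hc ht) e =ᶠ[𝓝 x] w := by
        filter_upwards [hT.mem_nhds hx] with z hz
        funext a
        rw [vec, VectorField.ofChart_comp e w hw hc ht hz]
        rfl
      have hext : extD (α w) x (lineIdx m)
          = extD ((Q (VectorField.ofChart e w hw hc ht)).comp e) x (lineIdx m) := by
        refine Finset.sum_congr rfl fun i _ => ?_
        congr 1
        refine pd_congr ?_
        filter_upwards [hT.mem_nhds hx] with z hz
        rw [hαw w hw hc ht z hz]
      rw [hext, hQ.extD_lineIdx _ e hx,
        hAB (vec (VectorField.ofChart e w hw hc ht) e) (fun a => (VectorField.ofChart e w hw hc ht).smooth e ![a]) x hx,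
        secondOrder_congr hvec, ← secondOrder_neg]

end Charge

/-! ## Sums of vector fields -/

/-- Finite sums of vector fields. -/
def VectorField.sum {n : ℕ} {M : Type*} [TopologicalSpace M] [ChartedSpace (Coord n) M] {ι : Type*}
    (s : Finset ι) (W : ι → VectorField n M) : VectorField n M where
  comp e x := ∑ j ∈ s, (W j).comp e x
  smooth e I := by
    simp only [Finset.sum_apply]
    exact ContDiffOn.sum fun j _ => (W j).smooth e I
  transform e e' x hx := by
    funext I
    rw [transformArr_vector]
    simp only [Finset.sum_apply, Finset.mul_sum]
    rw [Finset.sum_comm]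
    refine Finset.sum_congr rfl fun j _ => ?_
    rw [(W j).transform e e' x hx, transformArr_vector]

section Charge

variable {m : ℕ} {M : Type*} [TopologicalSpace M] [ChartedSpace (Coord (m + 2)) M]
  {L : Theory (m + 2)} {φ : Config M L} {Q : VectorField (m + 2) M → DiffForm (m + 2) M m}

theorem IsNoetherCharge.comp_sum (hQ : IsNoetherCharge φ Q) {e : OChart (m + 2) M}
    {ι : Type*} (s : Finset ι) (W : ι → VectorField (m + 2) M) {x : Coord (m + 2)}
    (hx : x ∈ e.1.target) :
    (Q (VectorField.sum s W)).comp e x = ∑ j ∈ s, (Q (W j)).comp e x := by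
  classical
  induction s using Finset.induction_on with
  | empty =>
    rw [Finset.sum_empty]
    exact hQ.comp_eq_zero e.1.open_target subset_rfl (fun z _ => by simp [VectorField.sum]) hx
  | insert j s hj ih =>
    rw [Finset.sum_insert hj, ← ih]
    simpa using hQ.local_linear e _ e.1.open_target subset_rfl 1 1 (VectorField.sum (insert j s) W)
      (W j) (VectorField.sum s W) (fun z _ => by simp [VectorField.sum, Finset.sum_insert hj]) x hx

theorem IsNoetherCharge.comp_mul_eq_zero (hQ : IsNoetherCharge φ Q) {χ : M → ℝ}
    (hχ : ContMDiff 𝓘(ℝ, Coord (m + 2)) 𝓘(ℝ, ℝ) ∞ χ) (V : VectorField (m + 2) M)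
    {e : OChart (m + 2) M} {x : Coord (m + 2)} (hx : x ∈ e.1.target)
    (h : e.1.symm x ∉ tsupport χ) : (Q (VectorField.mul hχ V)).comp e x = 0 := by
  refine hQ.comp_eq_zero (O := e.1.target ∩ e.1.symm ⁻¹' (tsupport χ)ᶜ)
    (e.1.isOpen_inter_preimage_symm (isClosed_tsupport χ).isOpen_compl) Set.inter_subset_left
    (fun z hz => ?_) ⟨hx, h⟩
  simp only [VectorField.mul]
  rw [image_eq_zero_of_notMem_tsupport hz.2, zero_smul]

end Charge

/-! ## Forms on the surface -/

section Surface

variable {m : ℕ} {M : Type*} [TopologicalSpace M] [ChartedSpace (Coord (m + 2)) M]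

/-- The coordinate change on the surface. -/
def sliceTransition (e e' : OChart (m + 2) M) (y : Coord m) : Coord m :=
  fun k => transition e e' (slice y) k.succ.succ

theorem contDiff_slice : ContDiff ℝ ∞ (slice (m := m)) :=
  (contDiff_line (m := m)).comp (contDiff_const.prodMk contDiff_id : ContDiff ℝ ∞ fun y => ((0 : ℝ), y))

theorem eq_slice {x : Coord (m + 2)} (h0 : x 0 = 0) (h1 : x 1 = 0) :
    x = slice fun k => x k.succ.succ := by
  funext k
  refine Fin.cases h0 (fun k => Fin.cases h1 (fun k => rfl) k) k

/-- A chart in which the set `S` is given by `x^0 = x^1 = 0`. -/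
def IsSliceChart (S : Set M) (e : OChart (m + 2) M) : Prop :=
  ∀ p ∈ e.1.source, (p ∈ S ↔ e.1 p 0 = 0 ∧ e.1 p 1 = 0)

variable {S : Set M} {e e' : OChart (m + 2) M}

theorem IsSliceChart.symm_slice_mem (he : IsSliceChart S e) {y : Coord m}
    (hy : slice y ∈ e.1.target) : e.1.symm (slice y) ∈ S := by
  rw [he _ (e.1.map_target hy), e.1.right_inv hy]
  exact ⟨rfl, rfl⟩

theorem slice_sliceTransition (he : IsSliceChart S e) (he' : IsSliceChart S e') {y : Coord m}
    (hy : slice y ∈ (transition e e').source) :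
    slice (sliceTransition e e' y) = transition e e' (slice y) := by
  have h := mem_transition_source.1 hy
  have := (he' _ h.2).1 (he.symm_slice_mem h.1)
  exact (eq_slice this.1 this.2).symm

theorem isOpen_slice_preimage {T : Set (Coord (m + 2))} (hT : IsOpen T) :
    IsOpen {y : Coord m | slice y ∈ T} := hT.preimage contDiff_slice.continuous

theorem contDiffOn_sliceTransition (e e' : OChart (m + 2) M) :
    ContDiffOn ℝ ∞ (sliceTransition e e') {y | slice y ∈ (transition e e').source} :=
  contDiffOn_pi.2 fun k => (contDiffOn_transition_apply e e' k.succ.succ).comp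
    contDiff_slice.contDiffOn fun _ hy => hy

theorem hasFDerivAt_sliceTransition {y : Coord m} (hy : slice y ∈ (transition e e').source) :
    HasFDerivAt (sliceTransition e e') (fderiv ℝ (sliceTransition e e') y) y :=
  (((contDiffOn_sliceTransition e e').contDiffAt
    ((isOpen_slice_preimage (transition e e').open_source).mem_nhds hy)).differentiableAt
      (by simp)).hasFDerivAt

theorem det_fderiv_sliceTransition {y : Coord m} (hy : slice y ∈ (transition e e').source) :
    (fderiv ℝ (sliceTransition e e') y).det
      = (Matrix.of fun k l : Fin m => jacobian e e' (slice y) k.succ.succ l.succ.succ).det := by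
  have : LinearMap.toMatrix' (fderiv ℝ (sliceTransition e e') y : Coord m →ₗ[ℝ] Coord m)
      = Matrix.of fun k l : Fin m => jacobian e e' (slice y) k.succ.succ l.succ.succ := by
    ext k l
    rw [LinearMap.toMatrix'_apply, Matrix.of_apply, jacobian, Matrix.of_apply]
    have h1 : pd (fun y => sliceTransition e e' y k) l y
        = pd (fun z => transition e e' z k.succ.succ) l.succ.succ (slice y) :=
      pd_comp_line (s := 0) (differentiableAt_of_contDiffOn (transition e e').open_source
        (contDiffOn_transition_apply e e' k.succ.succ) hy) l
    have h2 := (ContinuousLinearMap.proj (R := ℝ) (φ := fun _ : Fin m => ℝ) k).hasFDerivAt.comp y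
      (hasFDerivAt_sliceTransition hy)
    have h3 : (fun y => sliceTransition e e' y k)
      = (ContinuousLinearMap.proj (R := ℝ) (φ := fun _ : Fin m => ℝ) k) ∘ sliceTransition e e' := rfl
    rw [← h1, pd, h3, h2.fderiv]
    rfl
  rw [ContinuousLinearMap.det, ← LinearMap.det_toMatrix', this]

/-- Restricted to the surface, the form has top degree and so transforms by the Jacobian determinant
of the coordinate change on the surface. -/
theorem DiffForm.comp_sliceIdx (he : IsSliceChart S e) (he' : IsSliceChart S e')
    (α : DiffForm (m + 2) M m) {y : Coord m} (hy : slice y ∈ (transition e e').source) :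
    α.comp e (slice y) (sliceIdx m) = (fderiv ℝ (sliceTransition e e') y).det
      * α.comp e' (slice (sliceTransition e e' y)) (sliceIdx m) := by
  have hyT := mem_transition_source.1 hy
  have hy' := transition_mem_source hy
  have h := congrFun (α.transform e' e _ hy') (sliceIdx m)
  rw [transition_transition hy, transition_self hyT.1] at h
  rw [h, slice_sliceTransition he he' hy, det_fderiv_sliceTransition hy, Matrix.det_apply',
    Finset.sum_mul]
  simp only [transformArr, zpow_zero, one_mul, Bool.false_eq_true, if_false, jacobian_inv hy]
  -- The coordinates `x^0` and `x^1` of the second chart vanish identically along the slice of the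
  -- first.
  have hz : ∀ (k : Fin m) (a : Fin (m + 2)), a = 0 ∨ a = 1 →
      jacobian e e' (slice y) a k.succ.succ = 0 := by
    intro k a ha
    rw [jacobian, Matrix.of_apply]
    refine pd_slice_eq_zero (differentiableAt_of_contDiffOn (transition e e').open_source
        (contDiffOn_transition_apply e e' a) hy) ?_ k
    filter_upwards [(isOpen_slice_preimage (transition e e').open_source).mem_nhds hy] with z hz
    rw [← slice_sliceTransition he he' hz]
    rcases ha with rfl | rfl <;> rfl
  have inj : Function.Injective fun k : Fin m => k.succ.succ := fun k l hkl =>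
    Fin.succ_injective _ (Fin.succ_injective _ hkl)
  symm
  -- Permutations of `(2, …, n-1)` reproduce the Leibniz formula for the determinant. Any other
  -- index list contains `0` or `1`, where the Jacobian entry is zero, or a repetition, where the
  -- form is zero.
  refine Fintype.sum_of_injective (fun π : Equiv.Perm (Fin m) => sliceIdx m ∘ π)
    (fun π π' hπ => Equiv.ext fun k => inj (congrFun hπ k)) _ _ (fun I hI => ?_) fun π => ?_
  · by_cases h01 : ∃ k, I k = 0 ∨ I k = 1
    · obtain ⟨k, hk⟩ := h01
      rw [Finset.prod_eq_zero (Finset.mem_univ k), zero_mul]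
      exact hz k _ hk
    · push Not at h01
      have : ∀ k, ∃ l : Fin m, l.succ.succ = I k := fun k => by
        obtain ⟨l, hl⟩ := Fin.exists_succ_eq.2 (h01 k).1
        obtain ⟨l', rfl⟩ := Fin.exists_succ_eq.2
          (fun h : l = 0 => (h01 k).2 (by rw [← hl, h]; rfl))
        exact ⟨l', hl⟩
      choose f hf using this
      have hfi : ¬Function.Injective f := fun hi => hI
        ⟨Equiv.ofBijective f (Finite.injective_iff_bijective.1 hi), funext hf⟩
      simp only [Function.Injective, not_forall] at hfi
      obtain ⟨k, l, hkl, hne⟩ := hfi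
      have hsw : I ∘ Equiv.swap k l = I := by
        funext j
        rw [Function.comp_apply, Equiv.swap_apply_def]
        split_ifs with h1 h2
        · rw [h1, ← hf, ← hf, hkl]
        · rw [h2, ← hf, ← hf, hkl]
        · rfl
      have := α.antisymm e' _ (mem_transition_source.1 hy').1 I (Equiv.swap k l)
      rw [hsw, Equiv.Perm.sign_swap hne] at this
      have h0 : α.comp e' (transition e e' (slice y)) I = 0 := by
        push_cast at this
        linarith
      rw [h0, mul_zero]
  · rw [α.antisymm e' _ (mem_transition_source.1 hy').1 (sliceIdx m) π]
    simp only [Function.comp_apply, Matrix.of_apply, sliceIdx]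
    ring

end Surface

/-! ### Gluing slice integrals by a partition of unity -/

section Surface

variable {m : ℕ} {M : Type*} [TopologicalSpace M] [ChartedSpace (Coord (m + 2)) M] {S : Set M}

theorem image_sliceTransition {e e' : OChart (m + 2) M} (he : IsSliceChart S e)
    (he' : IsSliceChart S e') :
    sliceTransition e e' '' {y | slice y ∈ (transition e e').source}
      = {y | slice y ∈ (transition e' e).source} := by
  ext z
  constructor
  · rintro ⟨y, hy, rfl⟩
    rw [Set.mem_ofPred_eq, slice_sliceTransition he he' hy]
    exact transition_mem_source hy
  · intro hz
    refine ⟨sliceTransition e' e z, ?_, ?_⟩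
    · rw [Set.mem_ofPred_eq, slice_sliceTransition he' he hz]
      exact transition_mem_source hz
    · funext k
      rw [sliceTransition, slice_sliceTransition he' he hz, transition_transition hz,
        transition_self (mem_transition_source.1 hz).1]
      rfl

theorem injOn_sliceTransition {e e' : OChart (m + 2) M} (he : IsSliceChart S e)
    (he' : IsSliceChart S e') :
    Set.InjOn (sliceTransition e e') {y | slice y ∈ (transition e e').source} := by
  have key : ∀ y, slice y ∈ (transition e e').source →
      transition e' e (slice (sliceTransition e e' y)) = slice y := fun y hy => by
    rw [slice_sliceTransition he he' hy, transition_transition hy,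
      transition_self (mem_transition_source.1 hy).1]
  intro y hy z hz hyz
  exact (isClosedEmbedding_line (m := m) 0).injective ((key y hy).symm.trans (hyz ▸ key z hz))

/-- The integral of a form over the part of the surface where two slice charts overlap. -/
theorem OrientedSurface.integral_transition (σ : OrientedSurface (m := m) M S) (i j : Fin σ.num)
    (α : DiffForm (m + 2) M m) {χ : M → ℝ} (hχ : ∀ p ∉ (σ.chart i).1.source, χ p = 0)
    (hα : ∀ x ∈ (σ.chart i).1.target, (σ.chart i).1.symm x ∉ (σ.chart j).1.source →
      α.comp (σ.chart i) x = 0) :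
    σ.sign i * ∫ y in {y : Coord m | slice y ∈ (σ.chart i).1.target},
        χ ((σ.chart i).1.symm (slice y)) * α.comp (σ.chart i) (slice y) (sliceIdx m)
      = σ.sign j * ∫ y in {y : Coord m | slice y ∈ (σ.chart j).1.target},
        χ ((σ.chart j).1.symm (slice y)) * α.comp (σ.chart j) (slice y) (sliceIdx m) := by
  set e := σ.chart i with he
  set e' := σ.chart j with he'
  have hs : IsSliceChart S e := σ.chart_slice i
  have hs' : IsSliceChart S e' := σ.chart_slice j
  have hsub : ∀ e e' : OChart (m + 2) M, {y : Coord m | slice y ∈ (transition e e').source}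
      ⊆ {y : Coord m | slice y ∈ e.1.target} := fun e e' y hy => (mem_transition_source.1 hy).1
  have hmeas : ∀ {T : Set (Coord (m + 2))}, IsOpen T → MeasurableSet {y : Coord m | slice y ∈ T} :=
    fun hT => (isOpen_slice_preimage hT).measurableSet
  -- Off the overlap of the charts the first integrand vanishes because of `α`, the second because
  -- of `χ`; the rest is a change of variables.
  rw [setIntegral_eq_of_subset_of_forall_sdiff_eq_zero (hmeas e.1.open_target) (hsub e e'),
    setIntegral_eq_of_subset_of_forall_sdiff_eq_zero (hmeas e'.1.open_target) (hsub e' e),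
    ← image_sliceTransition hs hs', integral_image_eq_integral_abs_det_fderiv_smul _
      (hmeas (transition e e').open_source)
      (fun y hy => (hasFDerivAt_sliceTransition hy).hasFDerivWithinAt)
      (injOn_sliceTransition hs hs'), ← integral_const_mul, ← integral_const_mul]
  · refine setIntegral_congr_fun (hmeas (transition e e').open_source) fun y hy => ?_
    have horient : 0 < σ.sign i * σ.sign j * (fderiv ℝ (sliceTransition e e') y).det :=
      σ.oriented i j y hy
    -- Coherence of the orientation signs reconciles the signed determinant in the transformation of
    -- forms with the absolute value in the change of variables.
    have habs : σ.sign i * (fderiv ℝ (sliceTransition e e') y).det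
        = σ.sign j * |(fderiv ℝ (sliceTransition e e') y).det| := by
      rcases σ.sign_eq i with h1 | h1 <;> rcases σ.sign_eq j with h2 | h2 <;>
        rw [h1, h2] at horient ⊢
      · rw [abs_of_pos (by linarith)]
      · rw [abs_of_neg (by linarith)]; ring
      · rw [abs_of_neg (by linarith)]; ring
      · rw [abs_of_pos (by linarith)]
    simp only [smul_eq_mul]
    rw [slice_sliceTransition hs hs' hy, symm_transition hy, α.comp_sliceIdx hs hs' hy,
      slice_sliceTransition hs hs' hy]
    linear_combination χ (e.1.symm (slice y))
      * α.comp e' (transition e e' (slice y)) (sliceIdx m) * habs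
  · intro y hy
    rw [hχ, zero_mul]
    exact fun h => hy.2 (mem_transition_source.2 ⟨hy.1, h⟩)
  · intro y hy
    rw [hα _ hy.1 fun h => hy.2 (mem_transition_source.2 ⟨hy.1, h⟩)]
    simp

/-- The chart domain may be unbounded, but the slice is a closed embedding, so the part of it lying
over `K` is compact and carries the whole integrand. -/
theorem integrableOn_slice [T2Space M] {e : OChart (m + 2) M} {K : Set M} (hK : IsCompact K)
    (hKe : K ⊆ e.1.source) {f : Coord m → ℝ}
    (hf : ContinuousOn f {y | slice y ∈ e.1.target})
    (h0 : ∀ y, slice y ∈ e.1.target → e.1.symm (slice y) ∉ K → f y = 0) :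
    IntegrableOn f {y | slice y ∈ e.1.target} := by
  have hK' : IsCompact {y : Coord m | slice y ∈ e.1 '' K} :=
    (isClosedEmbedding_line (m := m) 0).isCompact_preimage
      (hK.image_of_continuousOn (e.1.continuousOn.mono hKe))
  have hsub : {y : Coord m | slice y ∈ e.1 '' K} ⊆ {y | slice y ∈ e.1.target} := by
    rintro y ⟨p, hp, hpy⟩
    rw [Set.mem_ofPred_eq, ← hpy]
    exact e.1.map_source (hKe hp)
  refine ((hf.mono hsub).integrableOn_compact hK').of_forall_sdiff_eq_zero
    (isOpen_slice_preimage e.1.open_target).measurableSet fun y hy => ?_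
  exact h0 y hy.1 fun h => hy.2 ⟨_, h, e.1.right_inv hy.1⟩

theorem OrientedSurface.slice_weight_sum (σ : OrientedSurface (m := m) M S) {e : OChart (m + 2) M}
    (he : IsSliceChart S e) {y : Coord m} (hy : slice y ∈ e.1.target) :
    ∀ᶠ x in 𝓝 (slice y), ∑ i, σ.weight i (e.1.symm x) = 1 :=
  (e.1.continuousAt_symm hy).eventually
    ((eventually_nhdsSet_iff_forall.1 σ.weight_sum) _ (he.symm_slice_mem hy))

variable {L : Theory (m + 2)} {φ : Config M L} {Q : VectorField (m + 2) M → DiffForm (m + 2) M m}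

/-- The integral of a Noether charge over a surface is the sum of the contributions of the pieces
into which the vector field is cut by the partition of unity. -/
theorem IsNoetherCharge.integral_eq_sum [T2Space M] (hQ : IsNoetherCharge φ Q)
    (σ : OrientedSurface (m := m) M S) (V : VectorField (m + 2) M) :
    σ.integral (Q V).comp = ∑ j, σ.sign j * ∫ y in {y : Coord m | slice y ∈ (σ.chart j).1.target},
      (Q (VectorField.mul (σ.weight_smooth j) V)).comp (σ.chart j) (slice y) (sliceIdx m) := by
  set W : Fin σ.num → VectorField (m + 2) M := fun j => VectorField.mul (σ.weight_smooth j) V with hW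
  have hcont : ∀ (i j k : Fin σ.num), ContinuousOn (fun y : Coord m =>
      σ.weight i ((σ.chart k).1.symm (slice y)) * (Q (W j)).comp (σ.chart k) (slice y) (sliceIdx m))
      {y | slice y ∈ (σ.chart k).1.target} := fun i j k =>
    (((contDiffOn_comp_symm (σ.weight_smooth i) (σ.chart k)).mul
      ((Q (W j)).smooth (σ.chart k) (sliceIdx m))).comp contDiff_slice.contDiffOn
        fun y hy => hy).continuousOn
  have hint1 : ∀ i j, IntegrableOn (fun y : Coord m =>
      σ.weight i ((σ.chart i).1.symm (slice y)) * (Q (W j)).comp (σ.chart i) (slice y) (sliceIdx m))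
      {y | slice y ∈ (σ.chart i).1.target} := fun i j =>
    integrableOn_slice (σ.weight_compact i) (σ.weight_support i) (hcont i j i) fun y _ h => by
      rw [image_eq_zero_of_notMem_tsupport h, zero_mul]
  have hint2 : ∀ i j, IntegrableOn (fun y : Coord m =>
      σ.weight i ((σ.chart j).1.symm (slice y)) * (Q (W j)).comp (σ.chart j) (slice y) (sliceIdx m))
      {y | slice y ∈ (σ.chart j).1.target} := fun i j =>
    integrableOn_slice (σ.weight_compact j) (σ.weight_support j) (hcont i j j) fun y hy h => by
      rw [hQ.comp_mul_eq_zero (σ.weight_smooth j) V hy h, Pi.zero_apply, mul_zero]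
  have hmeas : ∀ e : OChart (m + 2) M, MeasurableSet {y : Coord m | slice y ∈ e.1.target} :=
    fun e => (isOpen_slice_preimage e.1.open_target).measurableSet
  -- The weights sum to `1` in a neighbourhood of the surface and not merely on it. Hence `V = ∑ W
  -- j` on an open set, where locality and linearity of `Q` apply.
  have step1 : ∀ i, ∫ y in {y : Coord m | slice y ∈ (σ.chart i).1.target},
      σ.weight i ((σ.chart i).1.symm (slice y)) * (Q V).comp (σ.chart i) (slice y) (sliceIdx m)
      = ∑ j, ∫ y in {y : Coord m | slice y ∈ (σ.chart i).1.target},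
        σ.weight i ((σ.chart i).1.symm (slice y))
          * (Q (W j)).comp (σ.chart i) (slice y) (sliceIdx m) := by
    intro i
    rw [← integral_finsetSum _ fun j _ => hint1 i j]
    refine setIntegral_congr_fun (hmeas _) fun y hy => ?_
    have hnear := (σ.slice_weight_sum (σ.chart_slice i) hy).and
      ((σ.chart i).1.open_target.mem_nhds hy)
    obtain ⟨O, hO, hOo, hyO⟩ := eventually_nhds_iff.1 hnear
    rw [← Finset.mul_sum, hQ.comp_congr (V := VectorField.sum Finset.univ W) hOo
      (fun z hz => (hO z hz).2) (fun z hz => ?_) hyO, hQ.comp_sum _ _ hy, Finset.sum_apply]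
    simp only [VectorField.sum, hW, VectorField.mul]
    rw [← Finset.sum_smul, (hO z hz).1, one_smul]
  -- The same partition is now reinserted as a factor `1`, so that the double sums can be compared
  -- term by term after changing from chart `i` to chart `j`.
  have step2 : ∀ j, ∫ y in {y : Coord m | slice y ∈ (σ.chart j).1.target},
      (Q (W j)).comp (σ.chart j) (slice y) (sliceIdx m)
      = ∑ i, ∫ y in {y : Coord m | slice y ∈ (σ.chart j).1.target},
        σ.weight i ((σ.chart j).1.symm (slice y))
          * (Q (W j)).comp (σ.chart j) (slice y) (sliceIdx m) := by
    intro j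
    rw [← integral_finsetSum _ fun i _ => hint2 i j]
    refine setIntegral_congr_fun (hmeas _) fun y hy => ?_
    rw [← Finset.sum_mul, (σ.slice_weight_sum (σ.chart_slice j) hy).self_of_nhds, one_mul]
  calc σ.integral (Q V).comp
      = ∑ i, ∑ j, σ.sign i * ∫ y in {y : Coord m | slice y ∈ (σ.chart i).1.target},
        σ.weight i ((σ.chart i).1.symm (slice y))
          * (Q (W j)).comp (σ.chart i) (slice y) (sliceIdx m) := by
        refine Finset.sum_congr rfl fun i _ => ?_
        rw [← Finset.mul_sum, ← step1]
        rfl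
    _ = ∑ j, ∑ i, σ.sign j * ∫ y in {y : Coord m | slice y ∈ (σ.chart j).1.target},
        σ.weight i ((σ.chart j).1.symm (slice y))
          * (Q (W j)).comp (σ.chart j) (slice y) (sliceIdx m) := by
        rw [Finset.sum_comm]
        refine Finset.sum_congr rfl fun j _ => Finset.sum_congr rfl fun i _ => ?_
        exact σ.integral_transition i j (Q (W j))
          (fun p hp => image_eq_zero_of_notMem_tsupport fun h => hp (σ.weight_support i h))
          fun x hx hxj => hQ.comp_mul_eq_zero (σ.weight_smooth j) V hx
            fun h => hxj (σ.weight_support j h)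
    _ = _ := by
        refine Finset.sum_congr rfl fun j _ => ?_
        rw [← Finset.mul_sum, ← step2]

end Surface

/-! ### Comparison with the entropy form -/

section Entropy

variable {m : ℕ} {M : Type*} [TopologicalSpace M] [ChartedSpace (Coord (m + 2)) M]
  {L : Theory (m + 2)} {φ : Config M L} {V : VectorField (m + 2) M} {HA HB S : Set M} {κ : ℝ}
  {b : OChart (m + 2) M → Coord (m + 2) → Fin (m + 2) → Fin (m + 2) → ℝ}

/-- The index pairs `01` and `10` contribute equally, since `ε` and `E_R` both change sign; hence
the factor `2`. -/
theorem entropyForm_sliceIdx {n : ℕ} {L : Theory (n + 2)} (φ : LocalFields L)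
    (b : Coord (n + 2) → Fin (n + 2) → Fin (n + 2) → ℝ) (x : Coord (n + 2)) :
    entropyForm φ b x (sliceIdx n) = ∑ c, ∑ d, 2 * eulerRUp φ x d c 0 1 * b x c d := by
  have anti : ∀ c d, eulerRUp φ x d c 1 0 = -eulerRUp φ x d c 0 1 := fun c d => by
    simp only [eulerRUp, ← Finset.sum_neg_distrib, eulerR_antisymm _ _ _ _ 0 1, mul_neg]
  refine Finset.sum_congr rfl fun c _ => Finset.sum_congr rfl fun d _ => ?_
  congr 1
  have h1 : ∀ p q, eps (Fin.cons p (Fin.cons q (sliceIdx n) : Idx (n + 2) (n + 1)) :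
      Idx (n + 2) (n + 2)) * eulerRUp φ x d c p q
      = (if p = 0 then if q = 1 then eulerRUp φ x d c 0 1 else 0 else 0)
        + (if p = 1 then if q = 0 then eulerRUp φ x d c 0 1 else 0 else 0) := by
    intro p q
    rw [eps_cons_cons_sliceIdx]
    by_cases p0 : p = 0
    · subst p0
      by_cases q1 : q = 1
      · subst q1; simp
      · simp [q1]
    · by_cases p1 : p = 1
      · subst p1
        by_cases q0 : q = 0
        · subst q0; simp [anti]
        · simp [q0]
      · simp [p0, p1]
  simp only [h1, Finset.sum_add_distrib]
  simp
  ring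

/-- The contraction of the Noether charge with the gradient of the Killing field. -/
theorem sum_eulerR_killing_gradient (hκ : κ ≠ 0) (hV : IsBifurcateKillingHorizon φ.g V HA HB S κ)
    (hb : IsBinormal φ.g HA HB S b) {e : OChart (m + 2) M} (he : IsSliceChart S e) {y : Coord m}
    (hy : slice y ∈ e.1.target) :
    ∑ a, ∑ c, 2 * eulerR (φ.loc e) (slice y) ![a, c, 0, 1] * pd (fun x => vec V e x a) c (slice y)
      = κ * entropyForm (φ.loc e) (b e) (slice y) (sliceIdx m) := by
  set G : Matrix (Fin (m + 2)) (Fin (m + 2)) ℝ := gramMatrix (φ.g.comp e (slice y)) with hG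
  have hdet : IsUnit G.det := isUnit_iff_ne_zero.2 (φ.g.det_ne_zero e hy)
  have hGG : ∀ a d, ∑ f, G a f * G⁻¹ f d = if a = d then 1 else 0 := fun a d => by
    rw [← Matrix.mul_apply, Matrix.mul_nonsing_inv G hdet, Matrix.one_apply]
  have hsymm : ∀ a d, G a d = G d a := fun a d => φ.g.symm e _ hy a d
  have grad : ∀ c d, κ * b e (slice y) c d
      = ∑ f, G d f * pd (fun x => vec V e x f) c (slice y) := fun c d =>
    (killing_gradient hκ hV hb e he hy c d).symm
  rw [entropyForm_sliceIdx, Finset.sum_comm, Finset.mul_sum]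
  refine Finset.sum_congr rfl fun c _ => ?_
  -- Replacing `κ b_{cd}` by `g_{df} ∂_c V^f` makes the inverse metric in `eulerRUp` contract with
  -- the metric to the identity.
  have h1 : κ * ∑ d, 2 * eulerRUp (φ.loc e) (slice y) d c 0 1 * b e (slice y) c d
      = ∑ d, ∑ f, ∑ a, (G f d * G⁻¹ d a) * (2 * eulerR (φ.loc e) (slice y) ![a, c, 0, 1]
        * pd (fun x => vec V e x f) c (slice y)) := by
    rw [Finset.mul_sum]
    refine Finset.sum_congr rfl fun d _ => ?_
    have : κ * (2 * eulerRUp (φ.loc e) (slice y) d c 0 1 * b e (slice y) c d)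
        = 2 * eulerRUp (φ.loc e) (slice y) d c 0 1 * (κ * b e (slice y) c d) := by ring
    rw [this, grad, Finset.mul_sum]
    refine Finset.sum_congr rfl fun f _ => ?_
    rw [eulerRUp, Finset.mul_sum, Finset.sum_mul, hsymm d f]
    refine Finset.sum_congr rfl fun a _ => ?_
    change 2 * (G⁻¹ d a * _) * _ = _
    ring
  rw [h1, Finset.sum_comm]
  refine Finset.sum_congr rfl fun f _ => ?_
  rw [Finset.sum_comm]
  simp only [← Finset.sum_mul, hGG]
  simp

/-- The field `χ V` vanishes on the surface together with `V`, so the chart formula applies to it,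
and there `∂_c (χ V^a) = χ ∂_c V^a`. -/
theorem sliceIntegral_mul [T2Space M] {Q : VectorField (m + 2) M → DiffForm (m + 2) M m}
    (hQ : IsNoetherCharge φ Q) (hκ : κ ≠ 0) (hV : IsBifurcateKillingHorizon φ.g V HA HB S κ)
    (hb : IsBinormal φ.g HA HB S b) {e : OChart (m + 2) M} (he : IsSliceChart S e) {χ : M → ℝ}
    (hχ : ContMDiff 𝓘(ℝ, Coord (m + 2)) 𝓘(ℝ, ℝ) ∞ χ) (hc : HasCompactSupport χ)
    (hs : tsupport χ ⊆ e.1.source) :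
    ∫ y in {y : Coord m | slice y ∈ e.1.target},
        (Q (VectorField.mul hχ V)).comp e (slice y) (sliceIdx m)
      = κ * ∫ y in {y : Coord m | slice y ∈ e.1.target},
        χ (e.1.symm (slice y)) * entropyForm (φ.loc e) (b e) (slice y) (sliceIdx m) := by
  classical
  have hT : IsOpen e.1.target := e.1.open_target
  set w : Coord (m + 2) → Fin (m + 2) → ℝ := fun x a =>
    if x ∈ e.1.target then χ (e.1.symm x) * vec V e x a else 0 with hw
  have hK : IsCompact (e.1 '' tsupport χ) :=
    IsCompact.image_of_continuousOn hc (e.1.continuousOn.mono hs)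
  have hKT : e.1 '' tsupport χ ⊆ e.1.target := by
    rintro _ ⟨p, hp, rfl⟩
    exact e.1.map_source (hs hp)
  have hw0 : ∀ x ∉ e.1 '' tsupport χ, w x = 0 := by
    intro x hx
    funext a
    simp only [hw]
    split_ifs with h
    · rw [image_eq_zero_of_notMem_tsupport fun h' => hx ⟨_, h', e.1.right_inv h⟩, zero_mul]
      rfl
    · rfl
  have hsupp : tsupport w ⊆ e.1 '' tsupport χ :=
    closure_minimal (fun x hx => by_contra fun h => hx (hw0 x h)) hK.isClosed
  have hsm : ContDiff ℝ ∞ w := contDiff_pi.2 fun a => contDiff_iff_contDiffAt.2 fun x => by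
    by_cases hx : x ∈ e.1.target
    · refine (((contDiffOn_comp_symm hχ e).mul (V.smooth e ![a])).contDiffAt
        (hT.mem_nhds hx)).congr_of_eventuallyEq ?_
      filter_upwards [hT.mem_nhds hx] with z hz
      simp only [hw, if_pos hz]
      rfl
    · refine contDiffAt_const (c := (0 : ℝ)) |>.congr_of_eventuallyEq ?_
      filter_upwards [hK.isClosed.isOpen_compl.mem_nhds fun h => hx (hKT h)] with z hz
      rw [hw0 z hz]
      rfl
  have hvan : ∀ y : Coord m, slice y ∈ e.1.target → vec V e (slice y) = 0 := fun y hy =>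
    hV.vanishes e _ hy (he.symm_slice_mem hy)
  have hslice : ∀ y : Coord m, w (slice y) = 0 := by
    intro y
    funext a
    simp only [hw]
    split_ifs with h
    · rw [hvan y h]; simp
    · rfl
  rw [hQ.integral_slice e hsm (HasCompactSupport.of_support_subset_isCompact hK
    (subset_closure.trans hsupp)) (hsupp.trans hKT) hslice, ← integral_const_mul]
  · refine setIntegral_congr_fun (hT.preimage contDiff_slice.continuous).measurableSet
      fun y hy => ?_
    have hpd : ∀ a c, pd (fun x => w x a) c (slice y)
        = χ (e.1.symm (slice y)) * pd (fun x => vec V e x a) c (slice y) := by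
      intro a c
      have near : (fun x => w x a) =ᶠ[𝓝 (slice y)] fun x => χ (e.1.symm x) * vec V e x a := by
        filter_upwards [hT.mem_nhds hy] with z hz
        simp only [hw, if_pos hz]
      rw [pd_congr near, pd_mul (differentiableAt_of_contDiffOn hT (contDiffOn_comp_symm hχ e) hy)
        (differentiableAt_of_contDiffOn (f := fun x => vec V e x a) hT (V.smooth e ![a]) hy),
        hvan y hy]
      simp
    simp only [hpd]
    rw [mul_left_comm, ← sum_eulerR_killing_gradient hκ hV hb he hy, Finset.mul_sum]
    refine Finset.sum_congr rfl fun a _ => ?_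
    rw [Finset.mul_sum]
    exact Finset.sum_congr rfl fun c _ => by ring
  · intro x hx I
    have hI : (![I 0] : Idx (m + 2) 1) = I := by
      funext k
      rw [Subsingleton.elim k 0]
      rfl
    simp only [hw, if_pos hx, VectorField.mul, vec, hI]
    rfl

end Entropy

end Palatini

end

/-! ### The entropy formula -/

open Palatini

theorem mainTheorem2 (m : ℕ) (M : Type*) [TopologicalSpace M] [T2Space M]
    [SecondCountableTopology M] [ChartedSpace (Coord (m + 2)) M]
    [IsManifold (modelWithCornersSelf ℝ (Coord (m + 2))) ∞ M]
    (hM : IsOrientedAtlas (m + 2) M)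
    (L : Theory (m + 2)) (φ : Config M L) (hφ : φ.OnShell)
    (V : VectorField (m + 2) M) (HA HB Sig : Set M) (κ : ℝ) (hκ : κ ≠ 0)
    (hV : IsBifurcateKillingHorizon φ.g V HA HB Sig κ)
    (b : OChart (m + 2) M → Coord (m + 2) → Fin (m + 2) → Fin (m + 2) → ℝ)
    (hb : IsBinormal φ.g HA HB Sig b)
    (σ : OrientedSurface (m := m) M Sig)
    (Q : VectorField (m + 2) M → DiffForm (m + 2) M m) (hQ : IsNoetherCharge φ Q)
    (S : ℝ) (hS : σ.integral (Q V).comp = κ / (2 * Real.pi) * S) :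
    S = 2 * Real.pi * σ.integral (fun e => entropyForm (φ.loc e) (b e)) := by
  have h : σ.integral (Q V).comp = κ * σ.integral (fun e => entropyForm (φ.loc e) (b e)) := by
    rw [hQ.integral_eq_sum σ V, OrientedSurface.integral, Finset.mul_sum]
    refine Finset.sum_congr rfl fun j _ => ?_
    rw [sliceIntegral_mul hQ hκ hV hb (σ.chart_slice j) (σ.weight_smooth j) (σ.weight_compact j)
      (σ.weight_support j), mul_left_comm]
    rfl
  have hπ := Real.pi_ne_zero
  rw [hS] at h
  field_simp at h
  linarith
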